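/- Let $Q$ be a smooth manifold, $\mathcal L(v)=\tfrac12\kappa(v,v)+U$ a lagrangian of mechanical type ($\kappa$ a Riemannian metric, $U\in C^\infty(Q)$) and $D\subseteq TQ$ a smooth vector subbundle (the constraints). Let $\mathcal M=\kappa^\flat(D)\subset T^*Q$ be the constraint manifold, $\iota:\mathcal M\hookrightarrow T^*Q$ the inclusion, $\tau:\mathcal M\to Q$ the projection, $\Theta_{\mathcal M}=\iota^*\Theta_Q$ and $\Omega_{\mathcal M}=\iota^*\Omega_Q$, where $\Theta_Q$ is the Liouville form and $\Omega_Q=-d\Theta_Q$, and let $\mathcal C_m=\{v\in T_m\mathcal M: T\tau(v)\in D_{\tau(m)}\}$. For a bivector $\pi$ write $\beta(\pi^\sharp(\alpha))=\pi(\alpha,\beta)$ and $\{f,g\}=\pi(df,dg)$. The restriction $\Omega_{\mathcal M}|_{\mathcal C}$ is nondegenerate, and the nonholonomic bivector field $\pi_{nh}$ is defined by $\pi_{nh}^\sharp(\alpha)=-X$ if and only if $X\in\mathcal C$ and $\mathbf i_X\Omega_{\mathcal M}|_{\mathcal C}=\alpha|_{\mathcal C}$. Let a Lie group $G$ with Lie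 algebra $\mathfrak g$ act smoothly, freely and properly on $Q$, preserving $\mathcal L$ and $D$, and act on $\mathcal M$ by the restriction $\varphi$ of the cotangent lift, with infinitesimal generators $\xi_{\mathcal M}$, vertical spaces $\mathcal V_m=\{\xi_{\mathcal M}(m):\xi\in\mathfrak g\}$ and momentum map $\langle\mathcal J(m),\eta\rangle=\Theta_{\mathcal M}(\eta_{\mathcal M}(m))$. Let $\mathcal W$ be a $G$-invariant vertical complement of $\mathcal C$, i.e. a smooth $G$-invariant distribution on $\mathcal M$ with $T\mathcal M=\mathcal C\oplus\mathcal W$ and $\mathcal W\subseteq\mathcal V$ (so that the dimension assumption $T\mathcal M=\mathcal C+\mathcal V$ holds), and let $P_{\mathcal C},P_{\mathcal W}$ be the associated projections. Define the $\mathfrak g$-valued forms $\mathcal A_{\mathcal W}$, $\mathcal K_{\mathcal W}$ by $\mathcal A_{\mathcal W}(v_m)=\xi\iff P_{\mathcal W}(v_m)=\xi_{\mathcal M}(m)$ and $\mathcal K_{\mathcal W}(X,Y)=d\mathcal A_{\mathcal W}(P_{\mathcal C}X,P_{\mathcal C}Y)$. Assume the vertical-symmetry condition: there is a Lie subalgebra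 $\mathfrak g_{\mathcal W}\subseteq\mathfrak g$ with $\mathcal W_m=\{\xi_{\mathcal M}(m):\xi\in\mathfrak g_{\mathcal W}\}$ for all $m\in\mathcal M$. Then: 1. The 2-form $\langle\mathcal J,\mathcal K_{\mathcal W}\rangle$ is semi-basic with respect to $\tau$ ($\mathbf i_X\langle\mathcal J,\mathcal K_{\mathcal W}\rangle=0$ if $T\tau(X)=0$) and $G$-invariant, and for $B=-\langle\mathcal J,\mathcal K_{\mathcal W}\rangle$ the endomorphism $\mathrm{Id}+B^\flat\circ\pi_{nh}^\sharp$ of $T^*\mathcal M$ is invertible, where $B^\flat(X)=\mathbf i_XB$. Hence the gauge transformation $\pi_{\mathcal J\mathcal K}$ of $\pi_{nh}$ by $B$, given by $\pi_{\mathcal J\mathcal K}^\sharp=\pi_{nh}^\sharp\circ(\mathrm{Id}+B^\flat\circ\pi_{nh}^\sharp)^{-1}$, is well defined. 2. $\pi_{\mathcal J\mathcal K}$ is a smooth $G$-invariant bivector field on $\mathcal M$ satisfying $$\tfrac12[\pi_{\mathcal J\mathcal K},\pi_{\mathcal J\mathcal K}]=-\psi_{\pi_{\mathcal J\mathcal K}},\qquad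 \psi_{\pi}(\alpha,\beta,\gamma)=\sum_{\text{cyclic}}\gamma\Big(\big(\mathcal K_{\mathcal W}(\pi^\sharp(\alpha),\pi^\sharp(\beta))\big)_{\mathcal M}\Big),$$ where the Schouten bracket is normalized by $\tfrac12[\pi,\pi](df,dg,dh)=\{f,\{g,h\}\}+\{g,\{h,f\}\}+\{h,\{f,g\}\}$. 3. $\pi_{\mathcal J\mathcal K}$ descends to a Poisson structure $\Lambda$ on $\mathcal M/G$: with $\rho:\mathcal M\to\mathcal M/G$ the orbit projection, there is a unique bracket on $C^\infty(\mathcal M/G)=\{f: f\circ\rho\in C^\infty(\mathcal M)\}$ with $\{f,g\}_{\Lambda}\circ\rho=\{f\circ\rho,g\circ\rho\}_{\mathcal J\mathcal K}$, and it is a Poisson bracket; equivalently, for the smooth manifold structure on $\mathcal M/G$ making $\rho$ a submersion, there is a unique bivector field $\Lambda$ with $\Lambda^\sharp(\alpha)=T\rho\circ\pi_{\mathcal J\mathcal K}^\sharp(\rho^*\alpha)$, and it is Poisson. -/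

import Mathlib

open Bundle Manifold Set Function
open scoped ContDiff Manifold Topology

namespace Nonholonomic

noncomputable section

/-! ### Forms, bivector fields and brackets on a manifold -/

section General

variable {E : Type*} [NormedAddCommGroup E] [NormedSpace ℝ E]
  {H : Type*} [TopologicalSpace H] (I : ModelWithCorners ℝ E H)
  {P : Type*} [TopologicalSpace P] [ChartedSpace H P]

/-- The differential `df` of a real function, as a covector at each point. -/
def differential (f : P → ℝ) (p : P) : TangentSpace I p →L[ℝ] ℝ :=
  mfderiv I 𝓘(ℝ, ℝ) f p

/-- The exterior derivative `dα` of a vector-valued 1-form `α`, computed in the preferred chart at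
`p` (in which `TangentSpace I p` is read): if `α'` is the coordinate expression of `α`, then
`dα (u, v) = (D_u α') v - (D_v α') u`. Equivalently, `dα (X, Y) = X (α Y) - Y (α X) - α [X, Y]`. -/
def extDerivOne {A : Type*} [NormedAddCommGroup A] [NormedSpace ℝ A]
    (α : ∀ p : P, TangentSpace I p →L[ℝ] A) (p : P) :
    TangentSpace I p →L[ℝ] TangentSpace I p →L[ℝ] A :=
  let α' : E → E →L[ℝ] A := fun y =>
    α ((extChartAt I p).symm y) ∘L
      mfderivWithin 𝓘(ℝ, E) I (extChartAt I p).symm (range I) y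
  let D : E →L[ℝ] E →L[ℝ] A := fderivWithin ℝ α' (range I) (extChartAt I p p)
  D - D.flip

/-- Data of the type of a bivector field `ϖ`, given by `ϖ♯ : T*P → TP`; the bivector itself is
`ϖ (α, β) = β (ϖ♯ α)`. -/
abbrev BivectorData :=
  ∀ p : P, (TangentSpace I p →L[ℝ] ℝ) →ₗ[ℝ] TangentSpace I p

/-- The bracket `{f, g} = ϖ (df, dg) = dg (ϖ♯ df)`. -/
def bracket (ϖ : BivectorData I (P := P)) (f g : P → ℝ) (p : P) : ℝ :=
  differential I g p (ϖ p (differential I f p))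

/-- `ϖ` is a (smooth) bivector field: it is skew, and brackets of smooth functions are smooth. -/
structure IsBivectorField (ϖ : BivectorData I (P := P)) : Prop where
  skew : ∀ (p : P) (α β : TangentSpace I p →L[ℝ] ℝ), β (ϖ p α) = -α (ϖ p β)
  smooth : ∀ f g : P → ℝ, ContMDiff I 𝓘(ℝ, ℝ) ∞ f → ContMDiff I 𝓘(ℝ, ℝ) ∞ g →
    ContMDiff I 𝓘(ℝ, ℝ) ∞ (bracket I ϖ f g)

/-- The Jacobiator `{f, {g, h}} + {g, {h, f}} + {h, {f, g}}`. -/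
def jacobiator (ϖ : BivectorData I (P := P)) (f g h : P → ℝ) (p : P) : ℝ :=
  bracket I ϖ f (bracket I ϖ g h) p + bracket I ϖ g (bracket I ϖ h f) p
    + bracket I ϖ h (bracket I ϖ f g) p

/-- The function, linear in the preferred chart at `p`, whose differential at `p` is `α`
(only its germ at `p` is meaningful). -/
def linearFunction (p : P) (α : TangentSpace I p →L[ℝ] ℝ) (x : P) : ℝ :=
  (α : E →L[ℝ] ℝ) (extChartAt I p x)

/-- The trivector field `[ϖ, ϖ]` (Schouten bracket), characterized by
`½ [ϖ, ϖ] (df, dg, dh) = {f, {g, h}} + {g, {h, f}} + {h, {f, g}}`; the covectors `α, β, γ` at `p`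
are realized as differentials of coordinate functions. -/
def schouten (ϖ : BivectorData I (P := P)) (p : P) (α β γ : TangentSpace I p →L[ℝ] ℝ) : ℝ :=
  2 * jacobiator I ϖ (linearFunction I p α) (linearFunction I p β) (linearFunction I p γ) p

/-- `ϖ` is a Poisson structure: a bivector field whose bracket satisfies the Jacobi identity. -/
structure IsPoisson (ϖ : BivectorData I (P := P)) : Prop where
  isBivectorField : IsBivectorField I ϖ
  jacobi : ∀ f g h : P → ℝ, ContMDiff I 𝓘(ℝ, ℝ) ∞ f → ContMDiff I 𝓘(ℝ, ℝ) ∞ g →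
    ContMDiff I 𝓘(ℝ, ℝ) ∞ h → ∀ p, jacobiator I ϖ f g h p = 0

variable {I}

/-- The endomorphism `Id + B♭ ∘ ϖ♯` of `T*_p P`, where `B♭ X = B (X, ·)`. -/
def gaugeEndo (ϖ : BivectorData I (P := P))
    (B : ∀ p : P, TangentSpace I p →L[ℝ] TangentSpace I p →L[ℝ] ℝ) (p : P) :
    Module.End ℝ (TangentSpace I p →L[ℝ] ℝ) :=
  1 + (B p).toLinearMap ∘ₗ ϖ p

/-- The gauge transformation of `ϖ` by the 2-form `B`: `ϖ_B♯ = ϖ♯ ∘ (Id + B♭ ∘ ϖ♯)⁻¹`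
(meaningful when `Id + B♭ ∘ ϖ♯` is invertible at each point). -/
def gauge (ϖ : BivectorData I (P := P))
    (B : ∀ p : P, TangentSpace I p →L[ℝ] TangentSpace I p →L[ℝ] ℝ) : BivectorData I (P := P) :=
  fun p => ϖ p ∘ₗ Ring.inverse (gaugeEndo ϖ B p)

end General

section LinearAlgebra

variable {T : Type*} [AddCommGroup T] [Module ℝ T] [TopologicalSpace T]

/-- `X ↦ (i_X Ω)|_K`, from the subspace `K` to its dual. -/
def restrictForm (K : Submodule ℝ T) (Ω : T →L[ℝ] T →L[ℝ] ℝ) : K →ₗ[ℝ] Module.Dual ℝ K where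
  toFun X := (Ω X).toLinearMap.domRestrict K
  map_add' X Y := by ext Z; simp
  map_smul' c X := by ext Z; simp

/-- `α ↦ α|_K`. -/
def restrictCovector (K : Submodule ℝ T) : (T →L[ℝ] ℝ) →ₗ[ℝ] Module.Dual ℝ K where
  toFun α := α.toLinearMap.domRestrict K
  map_add' α β := by ext Z; simp
  map_smul' c α := by ext Z; simp

open Classical in
/-- The map `ϖ♯` determined by a subspace `K` and a form `Ω` that is nondegenerate on `K`:
`ϖ♯ α = -X`, where `X ∈ K` is the vector with `(i_X Ω)|_K = α|_K`
(and `0` by convention when `Ω` is degenerate on `K`). -/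
def sharpOfPair (K : Submodule ℝ T) (Ω : T →L[ℝ] T →L[ℝ] ℝ) : (T →L[ℝ] ℝ) →ₗ[ℝ] T :=
  if h : Bijective (restrictForm K Ω) then
    -(K.subtype ∘ₗ (LinearEquiv.ofBijective (restrictForm K Ω) h).symm.toLinearMap ∘ₗ
      restrictCovector K)
  else 0

/-- The pullback `(u, v) ↦ B (L u, L v)` of a bilinear form by a linear map. -/
def pullbackForm {T' A : Type*} [AddCommGroup T'] [Module ℝ T'] [TopologicalSpace T']
    [AddCommGroup A] [Module ℝ A] [TopologicalSpace A] [IsTopologicalAddGroup A]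
    [ContinuousConstSMul ℝ A] (L : T →L[ℝ] T') (B : T' →L[ℝ] T' →L[ℝ] A) :
    T →L[ℝ] T →L[ℝ] A :=
  ContinuousLinearMap.precomp A L ∘L B ∘L L

/-- A Poisson bracket on a commutative algebra. -/
structure IsPoissonBracket {𝒜 : Type*} [CommRing 𝒜] [Algebra ℝ 𝒜]
    (Λ : 𝒜 →ₗ[ℝ] 𝒜 →ₗ[ℝ] 𝒜) : Prop where
  skew : ∀ f g, Λ f g = -Λ g f
  leibniz : ∀ f g h, Λ (f * g) h = f * Λ g h + Λ f h * g
  jacobi : ∀ f g h, Λ f (Λ g h) + Λ g (Λ h f) + Λ h (Λ f g) = 0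

end LinearAlgebra

/-! ### The cotangent bundle -/

section Cotangent

variable (E : Type*) [NormedAddCommGroup E] [NormedSpace ℝ E]
  (Q : Type*) [TopologicalSpace Q] [ChartedSpace E Q] [IsManifold 𝓘(ℝ, E) ∞ Q]

/-- The cotangent bundle `T*Q`. -/
abbrev CotangentBundle :=
  TotalSpace (E →L[ℝ] ℝ) (fun q : Q => TangentSpace 𝓘(ℝ, E) q →L[ℝ] ℝ)

/-- The model of `T*Q` as a manifold. -/
abbrev cotangentModel := (𝓘(ℝ, E)).prod 𝓘(ℝ, E →L[ℝ] ℝ)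

/-- The Liouville 1-form `Θ_Q` on `T*Q`: `Θ_Q (p) (v) = p (T τ_Q v)`. -/
def liouville (p : CotangentBundle E Q) : TangentSpace (cotangentModel E) p →L[ℝ] ℝ :=
  p.2 ∘L mfderiv (cotangentModel E) 𝓘(ℝ, E) (fun x : CotangentBundle E Q => x.1) p

/-- The canonical symplectic form `Ω_Q = -dΘ_Q` on `T*Q`. -/
def canonicalForm (p : CotangentBundle E Q) :
    TangentSpace (cotangentModel E) p →L[ℝ] TangentSpace (cotangentModel E) p →L[ℝ] ℝ :=
  -extDerivOne (cotangentModel E) (liouville E Q) p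

variable {E Q}

/-- The cotangent lift `p ↦ p ∘ (T_q g)⁻¹` of the action of `g`. -/
def cotangentLift {G : Type*} [Group G] [MulAction G Q] (g : G) (p : CotangentBundle E Q) :
    CotangentBundle E Q :=
  ⟨g • p.1, p.2 ∘L (mfderiv 𝓘(ℝ, E) 𝓘(ℝ, E) (fun q : Q => g • q) p.1).inverse⟩

end Cotangent

/-! ### Nonholonomic systems -/

section System

variable (E F : Type*) [NormedAddCommGroup E] [NormedSpace ℝ E]
  [NormedAddCommGroup F] [NormedSpace ℝ F]
  (Q : Type*) [TopologicalSpace Q] [ChartedSpace E Q] [IsManifold 𝓘(ℝ, E) ∞ Q]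
  (V : Q → Type*) [TopologicalSpace (TotalSpace F V)] [∀ q, TopologicalSpace (V q)]
  [∀ q, AddCommGroup (V q)] [∀ q, Module ℝ (V q)] [FiberBundle F V] [VectorBundle ℝ F V]
  [ContMDiffVectorBundle ∞ F V 𝓘(ℝ, E)]

/-- A nonholonomic system on `Q`: a kinetic energy metric `κ`, a potential `U` and a constraint
distribution `D ⊆ TQ`, i.e. a smooth vector subbundle, presented as the image of a smooth fibrewise
injective morphism `incl : V → TQ` of vector bundles over `Q`. -/
structure NonholonomicSystem where
  metric : ContMDiffRiemannianMetric 𝓘(ℝ, E) ∞ E (fun q : Q => TangentSpace 𝓘(ℝ, E) q)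
  potential : Q → ℝ
  potential_smooth : ContMDiff 𝓘(ℝ, E) 𝓘(ℝ, ℝ) ∞ potential
  incl : ∀ q, V q →ₗ[ℝ] TangentSpace 𝓘(ℝ, E) q
  incl_injective : ∀ q, Injective (incl q)
  incl_smooth : ContMDiff ((𝓘(ℝ, E)).prod 𝓘(ℝ, F)) (𝓘(ℝ, E)).tangent ∞
    (fun v : TotalSpace F V => (⟨v.1, incl v.1 v.2⟩ : TangentBundle 𝓘(ℝ, E) Q))

/-- The model of the constraint manifold. -/
abbrev phaseModel := (𝓘(ℝ, E)).prod 𝓘(ℝ, F)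

namespace NonholonomicSystem

variable {E F Q V}
variable (S : NonholonomicSystem E F Q V)

/-- The lagrangian `L (v) = ½ κ (v, v) + U`. -/
def lagrangian (v : TangentBundle 𝓘(ℝ, E) Q) : ℝ :=
  (1 / 2) * S.metric.inner v.1 v.2 v.2 + S.potential v.1

/-- The constraint distribution `D`. -/
def D (q : Q) : Submodule ℝ (TangentSpace 𝓘(ℝ, E) q) := LinearMap.range (S.incl q)

/-- The Legendre transform `TQ → T*Q`, `v ↦ κ (v, ·)`. -/
def legendre (v : TangentBundle 𝓘(ℝ, E) Q) : CotangentBundle E Q :=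
  ⟨v.1, S.metric.inner v.1 v.2⟩

/-- The constraint manifold `M = Leg (D)`. As a manifold it is the total space of the bundle `D`,
embedded in `T*Q` by `NonholonomicSystem.embed`. -/
abbrev Phase (_ : NonholonomicSystem E F Q V) := TotalSpace F V

/-- The embedding `ι : M → T*Q`, with image `Leg (D)`. -/
def embed (m : S.Phase) : CotangentBundle E Q := S.legendre ⟨m.1, S.incl m.1 m.2⟩

/-- The derivative of `ι`. -/
def tangentEmbed (m : S.Phase) :
    TangentSpace (phaseModel E F) m →L[ℝ] TangentSpace (cotangentModel E) (S.embed m) :=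
  mfderiv (phaseModel E F) (cotangentModel E) S.embed m

/-- The derivative `T_m τ` of the projection `τ : M → Q`. -/
def tangentProj (m : S.Phase) :
    TangentSpace (phaseModel E F) m →L[ℝ] TangentSpace 𝓘(ℝ, E) m.1 :=
  mfderiv (phaseModel E F) 𝓘(ℝ, E) (fun x : S.Phase => x.1) m

/-- `Θ_M = ι^* Θ_Q`. -/
def theta (m : S.Phase) : TangentSpace (phaseModel E F) m →L[ℝ] ℝ :=
  liouville E Q (S.embed m) ∘L S.tangentEmbed m

/-- `Ω_M = ι^* Ω_Q`. -/
def omega (m : S.Phase) :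
    TangentSpace (phaseModel E F) m →L[ℝ] TangentSpace (phaseModel E F) m →L[ℝ] ℝ :=
  pullbackForm (S.tangentEmbed m) (canonicalForm E Q (S.embed m))

/-- The constraint distribution on `M`: `C_m = {v | T τ (v) ∈ D}`. -/
def C (m : S.Phase) : Submodule ℝ (TangentSpace (phaseModel E F) m) :=
  (S.D m.1).comap (S.tangentProj m).toLinearMap

/-- The nonholonomic bivector field `π_nh`, associated with `C` and `Ω_M`. -/
def piNh : BivectorData (phaseModel E F) (P := S.Phase) :=
  fun m => sharpOfPair (S.C m) (S.omega m)

/-! ### Symmetries -/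

section Symmetry

variable (EG : Type*) [NormedAddCommGroup EG] [NormedSpace ℝ EG]
  (G : Type*) [TopologicalSpace G] [ChartedSpace EG G] [Group G] [LieGroup 𝓘(ℝ, EG) ∞ G]
  [MulAction G Q]

/-- `G` acts smoothly, freely and properly on `Q`, preserving the lagrangian and `D`. -/
structure IsSymmetryGroup : Prop where
  smooth : ContMDiffSMul 𝓘(ℝ, EG) 𝓘(ℝ, E) ∞ G Q
  free : ∀ (g : G) (q : Q), g • q = q → g = 1
  proper : ProperSMul G Q
  lagrangian_invariant : ∀ (g : G) (v : TangentBundle 𝓘(ℝ, E) Q),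
    S.lagrangian (tangentMap 𝓘(ℝ, E) 𝓘(ℝ, E) (fun q : Q => g • q) v) = S.lagrangian v
  D_invariant : ∀ (g : G) (q : Q),
    (S.D q).map (mfderiv 𝓘(ℝ, E) 𝓘(ℝ, E) (fun q : Q => g • q) q).toLinearMap = S.D (g • q)

variable {G}

/-- The restriction to `M` of the cotangent lift of the action: `φ_g m` is the point of `M` with
`ι (φ_g m) = g · ι (m)`, which exists when `G` is a symmetry group. -/
def act (g : G) (m : S.Phase) : S.Phase :=
  haveI : Nonempty S.Phase := ⟨m⟩
  invFun S.embed (cotangentLift g (S.embed m))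

/-- `T_m φ_g`. -/
def tangentAct (g : G) (m : S.Phase) :
    TangentSpace (phaseModel E F) m →L[ℝ] TangentSpace (phaseModel E F) (S.act g m) :=
  mfderiv (phaseModel E F) (phaseModel E F) (S.act g) m

variable (G)

/-- The infinitesimal generators `ξ ↦ ξ_M (m)`, the derivative at `1` of `g ↦ φ_g m`
(recall `φ_1 m = m`). -/
def infGen (m : S.Phase) :
    GroupLieAlgebra 𝓘(ℝ, EG) G →L[ℝ] TangentSpace (phaseModel E F) m :=
  (mfderiv 𝓘(ℝ, EG) (phaseModel E F) (fun g : G => S.act g m) 1 :)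

/-- The vertical space: the tangent space to the orbit through `m`. -/
def vertical (m : S.Phase) : Submodule ℝ (TangentSpace (phaseModel E F) m) :=
  LinearMap.range (S.infGen EG G m).toLinearMap

/-- The canonical momentum map on `M`: `⟨J (m), η⟩ = Θ_M (η_M (m))`. -/
def momentum (m : S.Phase) : GroupLieAlgebra 𝓘(ℝ, EG) G →L[ℝ] ℝ :=
  S.theta m ∘L S.infGen EG G m

/-- A `G`-invariant vertical complement `W` of `C`: a smooth `G`-invariant distribution with
`T_m M = C_m ⊕ W_m` and `W_m` contained in the vertical space. -/
structure VerticalComplement where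
  W : ∀ m : S.Phase, Submodule ℝ (TangentSpace (phaseModel E F) m)
  smooth : ∀ (m : S.Phase), ∀ w ∈ W m, ∃ X : ∀ x : S.Phase, TangentSpace (phaseModel E F) x,
    ContMDiff (phaseModel E F) (phaseModel E F).tangent ∞
      (fun x => (⟨x, X x⟩ : TangentBundle (phaseModel E F) S.Phase)) ∧
    (∀ x, X x ∈ W x) ∧ X m = w
  invariant : ∀ (g : G) (m : S.Phase), (W m).map (S.tangentAct g m).toLinearMap = W (S.act g m)
  isCompl : ∀ m, IsCompl (S.C m) (W m)
  vertical_le : ∀ m, W m ≤ S.vertical EG G m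

/-- The orbit space `M / G`, with the quotient topology. -/
abbrev OrbitSpace := Quot (fun m m' : S.Phase => ∃ g : G, S.act g m = m')

/-- The orbit projection `ρ : M → M / G`. -/
def orbitProj (m : S.Phase) : S.OrbitSpace G := Quot.mk _ m

/-- `C^∞ (M / G)`: the functions on the orbit space whose pullback to `M` is smooth. -/
def smoothOrbitFunctions : Subalgebra ℝ (S.OrbitSpace G → ℝ) where
  carrier := {f | ContMDiff (phaseModel E F) 𝓘(ℝ, ℝ) ∞ (f ∘ S.orbitProj G)}
  mul_mem' hf hg := ContMDiff.mul hf hg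
  add_mem' hf hg := ContMDiff.add hf hg
  algebraMap_mem' _ := contMDiff_const

end Symmetry

end NonholonomicSystem

namespace NonholonomicSystem.VerticalComplement

variable {E F Q V}
variable [FiniteDimensional ℝ E] [FiniteDimensional ℝ F]
variable {S : NonholonomicSystem E F Q V}
  {EG : Type*} [NormedAddCommGroup EG] [NormedSpace ℝ EG]
  {G : Type*} [TopologicalSpace G] [ChartedSpace EG G] [Group G] [LieGroup 𝓘(ℝ, EG) ∞ G]
  [MulAction G Q]
  (𝓦 : S.VerticalComplement EG G)

instance (m : S.Phase) : FiniteDimensional ℝ (TangentSpace (phaseModel E F) m) :=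
  inferInstanceAs (FiniteDimensional ℝ (E × F))

instance (m : S.Phase) : T2Space (TangentSpace (phaseModel E F) m) :=
  inferInstanceAs (T2Space (E × F))

/-- The projection `P_C` onto `C` along `W`. -/
def projC (m : S.Phase) :
    TangentSpace (phaseModel E F) m →L[ℝ] TangentSpace (phaseModel E F) m :=
  LinearMap.toContinuousLinearMap ((S.C m).projection (𝓦.W m) (𝓦.isCompl m))

/-- The projection `P_W` onto `W` along `C`. -/
def projW (m : S.Phase) :
    TangentSpace (phaseModel E F) m →L[ℝ] TangentSpace (phaseModel E F) m :=
  LinearMap.toContinuousLinearMap ((𝓦.W m).projection (S.C m) (𝓦.isCompl m).symm)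

/-- The `𝔤`-valued 1-form `A_W`: `A_W (v) = ξ` if and only if `P_W (v) = ξ_M (m)`. For a free
action `ξ ↦ ξ_M (m)` is injective, and it is inverted here by a left inverse; its image contains
`W_m`. -/
def connection (m : S.Phase) :
    TangentSpace (phaseModel E F) m →L[ℝ] GroupLieAlgebra 𝓘(ℝ, EG) G :=
  LinearMap.toContinuousLinearMap
    ((S.infGen EG G m).toLinearMap.leftInverse ∘ₗ (𝓦.projW m).toLinearMap)

variable (EG G) in
/-- The Lie algebra `𝔤` is, as a topological vector space, the model space of `G`. -/
def lieAlgebraEquiv : GroupLieAlgebra 𝓘(ℝ, EG) G ≃L[ℝ] EG :=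
  (ContinuousLinearEquiv.refl ℝ EG :)

/-- The exterior derivative `dA_W`, a `𝔤`-valued 2-form. -/
def dConnection (m : S.Phase) :
    TangentSpace (phaseModel E F) m →L[ℝ] TangentSpace (phaseModel E F) m →L[ℝ]
      GroupLieAlgebra 𝓘(ℝ, EG) G :=
  ContinuousLinearMap.postcomp _ (lieAlgebraEquiv EG G).symm.toContinuousLinearMap ∘L
    extDerivOne (phaseModel E F)
      (fun x : S.Phase => (lieAlgebraEquiv EG G).toContinuousLinearMap ∘L 𝓦.connection x) m

/-- The `W`-curvature `K_W (X, Y) = dA_W (P_C X, P_C Y)`. -/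
def curvature (m : S.Phase) :
    TangentSpace (phaseModel E F) m →L[ℝ] TangentSpace (phaseModel E F) m →L[ℝ]
      GroupLieAlgebra 𝓘(ℝ, EG) G :=
  pullbackForm (𝓦.projC m) (𝓦.dConnection m)

/-- The 2-form `⟨J, K_W⟩` on `M`. -/
def formJK (m : S.Phase) :
    TangentSpace (phaseModel E F) m →L[ℝ] TangentSpace (phaseModel E F) m →L[ℝ] ℝ :=
  ContinuousLinearMap.postcomp _ (S.momentum EG G m) ∘L 𝓦.curvature m

/-- The bivector field `π_JK`: the gauge transformation of `π_nh` by `-⟨J, K_W⟩`. -/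
def piJK : BivectorData (phaseModel E F) (P := S.Phase) :=
  gauge S.piNh (fun m => -𝓦.formJK m)

/-- The trivector
`ψ_ϖ (α, β, γ) = γ ((K_W (ϖ♯ α, ϖ♯ β))_M) + cyclic permutations of (α, β, γ)`. -/
def psi (ϖ : BivectorData (phaseModel E F) (P := S.Phase)) (m : S.Phase)
    (α β γ : TangentSpace (phaseModel E F) m →L[ℝ] ℝ) : ℝ :=
  γ (S.infGen EG G m (𝓦.curvature m (ϖ m α) (ϖ m β)))
    + α (S.infGen EG G m (𝓦.curvature m (ϖ m β) (ϖ m γ)))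
    + β (S.infGen EG G m (𝓦.curvature m (ϖ m γ) (ϖ m α)))

/-- The vertical-symmetry condition: `W_m = {ξ_M (m) | ξ ∈ 𝔤_W}` for a Lie subalgebra `𝔤_W`. -/
def VerticalSymmetry : Prop :=
  ∃ gW : Submodule ℝ (GroupLieAlgebra 𝓘(ℝ, EG) G), (∀ ξ ∈ gW, ∀ η ∈ gW, ⁅ξ, η⁆ ∈ gW) ∧
    ∀ m : S.Phase, (𝓦.W m : Set (TangentSpace (phaseModel E F) m)) = {w | ∃ ξ ∈ gW, S.infGen EG G m ξ = w}

end NonholonomicSystem.VerticalComplement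

end System

end

end Nonholonomic

namespace Nonholonomic

set_option linter.unusedSectionVars false

noncomputable section

/-! ### Differential forms on a vector space -/

section Flat

variable {T T' A 𝔤 : Type*} [NormedAddCommGroup T] [NormedSpace ℝ T]
  [NormedAddCommGroup T'] [NormedSpace ℝ T'] [NormedAddCommGroup A] [NormedSpace ℝ A]
  [NormedAddCommGroup 𝔤] [NormedSpace ℝ 𝔤]

/-! Everything is governed by the 1-form `horTheta`, θ = Θ_M ∘ P_C = Θ_M − ⟨J, A_W⟩. Since A_W
vanishes on C, the Leibniz rule gives dθ = dΘ_M − ⟨J, K_W⟩ = −(Ω_M + ⟨J, K_W⟩) on C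
(`extDerivOne_horTheta`). Unwinding the gauge transformation, π_JK♯ α is therefore the unique X in C
with dθ(X, ·) = α on C (`extDerivOne_horTheta_piJK`, `eq_piJK`): the gauge term replaces Ω_M by an
exact form that has the same use along C.

The vertical-symmetry condition enters in two ways. First, W is spanned by generators ξ_M with ξ in
a fixed subspace of 𝔤, and C is defined through Tτ, so A_W(v) depends only on Tτ(v): the connection
is the pullback by τ of a form on Q (`connForm_eq_pull`). This makes ⟨J, K_W⟩ semi-basic. Pairing a
vector of C with vectors tangent to the fibres of τ (`omega_vertical`) then shows that Ω_M + ⟨J,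
K_W⟩ is nondegenerate on C, which is the invertibility of the gauge endomorphism. Secondly, θ is
G-invariant and vanishes on ξ_M for these fixed ξ, so by Cartan's formula i_{ξ_M} dθ = 0
(`extDerivOne_horTheta_infGen`). Thus dθ is closed on all of M, with kernel W.

The Jacobiator is then a computation in a vector space (`flatBracket_jacobi`). Put X_f = π_JK♯ df.
Closedness of dθ removes the derivatives of the form, and each remaining term dθ([X_f, X_g], X_h)
is, up to sign, dh applied to the C-part of the commutator. The discrepancy with dh[X_f, X_g] is dh
of the W-part, which is −(dA_W(X_f, X_g))_M because A_W vanishes on X_f and X_g. The cyclic sum is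
−ψ.

Finally ψ differentiates functions along generators only, so it vanishes on invariant functions. As
π_JK is invariant, the bracket descends to M/G and satisfies the Jacobi identity there; if ρ is a
submersion, its local sections transfer smoothness to the quotient. -/

/-- The exterior derivative of a 1-form on a vector space. -/
def flatD (β : T → T →L[ℝ] A) (y : T) : T →L[ℝ] T →L[ℝ] A :=
  fderiv ℝ β y - (fderiv ℝ β y).flip

lemma flatD_apply (β : T → T →L[ℝ] A) (y u v : T) :
    flatD β y u v = fderiv ℝ β y u v - fderiv ℝ β y v u := by
  simp [flatD]

lemma flatD_swap (β : T → T →L[ℝ] A) (y u v : T) : flatD β y u v = -flatD β y v u := by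
  simp [flatD_apply]

lemma flatD_congr {β β' : T → T →L[ℝ] A} {y : T} (h : β =ᶠ[𝓝 y] β') :
    flatD β y = flatD β' y := by
  simp [flatD, h.fderiv_eq]

/-- Naturality of d: the product rule produces a term with the second derivative of `φ`, which is
symmetric and so disappears on antisymmetrization. -/
lemma flatD_comp {φ : T → T'} {β : T' → T' →L[ℝ] A} {y : T} (hφ : ContDiffAt ℝ 2 φ y)
    (hβ : DifferentiableAt ℝ β (φ y)) (u v : T) :
    flatD (fun z => β (φ z) ∘L fderiv ℝ φ z) y u v =
      flatD β (φ y) (fderiv ℝ φ y u) (fderiv ℝ φ y v) := by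
  have h1 : DifferentiableAt ℝ φ y := hφ.differentiableAt (by norm_num)
  have h2 : DifferentiableAt ℝ (fderiv ℝ φ) y :=
    (hφ.fderiv_right (m := 1) (by norm_num)).differentiableAt (by norm_num)
  have h3 : IsSymmSndFDerivAt ℝ φ y := hφ.isSymmSndFDerivAt (by simp)
  have h4 : HasFDerivAt (fun z => β (φ z)) (fderiv ℝ β (φ y) ∘L fderiv ℝ φ y) y :=
    hβ.hasFDerivAt.comp y h1.hasFDerivAt
  have h5 := h4.clm_comp h2.hasFDerivAt
  rw [flatD_apply, flatD_apply, h5.fderiv]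
  simp [h3 u v]

lemma two_le_infty : (2 : WithTop ℕ∞) ≤ ∞ :=
  WithTop.coe_le_coe.2 le_top

set_option synthInstance.maxHeartbeats 200000 in
lemma contDiffAt_flatD {β : T → T →L[ℝ] A} {y : T} (hβ : ContDiffAt ℝ ∞ β y) :
    ContDiffAt ℝ ∞ (flatD β) y := by
  have h := hβ.fderiv_right (m := ∞) (by simp)
  let fl : (T →L[ℝ] T →L[ℝ] A) →L[ℝ] (T →L[ℝ] T →L[ℝ] A) :=
    (ContinuousLinearMap.flipₗᵢ ℝ T T A).toContinuousLinearEquiv.toContinuousLinearMap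
  have h' : ContDiffAt ℝ ∞ (fun z => fl (fderiv ℝ β z)) y := by fun_prop
  exact h.sub h'

-- This is d² = 0: expanding each `flatD` gives six second derivatives of `β`, which cancel in pairs
-- by symmetry.
set_option synthInstance.maxHeartbeats 200000 in
lemma fderiv_flatD_cyclic {β : T → T →L[ℝ] A} {y : T} (hβ : ContDiffAt ℝ ∞ β y) (u v w : T) :
    fderiv ℝ (flatD β) y u v w + fderiv ℝ (flatD β) y v w u + fderiv ℝ (flatD β) y w u v = 0 := by
  have h := (hβ.fderiv_right (m := ∞) (by simp)).differentiableAt (by simp)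
  let fl : (T →L[ℝ] T →L[ℝ] A) →L[ℝ] (T →L[ℝ] T →L[ℝ] A) :=
    (ContinuousLinearMap.flipₗᵢ ℝ T T A).toContinuousLinearEquiv.toContinuousLinearMap
  have h' := h.hasFDerivAt.sub (fl.hasFDerivAt.comp y h.hasFDerivAt)
  have h3 : IsSymmSndFDerivAt ℝ β y := hβ.isSymmSndFDerivAt (by simpa using two_le_infty)
  have e : ∀ u v w, fderiv ℝ (flatD β) y u v w =
      fderiv ℝ (fderiv ℝ β) y u v w - fderiv ℝ (fderiv ℝ β) y u w v := by
    intro u v w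
    have : fderiv ℝ (flatD β) y = _ := h'.fderiv
    rw [this]; rfl
  rw [e, e, e, h3 u v, h3 u w, h3 v w]
  abel

/-- Cartan's formula dβ(X, Y) = X(β Y) − Y(β X) − β[X, Y] with its first two terms zero. Applied to
a connection, it says that the curvature measures the failure of the kernel to be involutive. -/
lemma flatD_eq_neg_of_apply_eq_zero {β : T → T →L[ℝ] A} {X Y : T → T} {y : T}
    (hβ : DifferentiableAt ℝ β y) (hX : DifferentiableAt ℝ X y) (hY : DifferentiableAt ℝ Y y)
    (hβX : ∀ᶠ z in 𝓝 y, β z (X z) = 0) (hβY : ∀ᶠ z in 𝓝 y, β z (Y z) = 0) :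
    flatD β y (X y) (Y y) = -β y (fderiv ℝ Y y (X y) - fderiv ℝ X y (Y y)) := by
  have key : ∀ Z : T → T, DifferentiableAt ℝ Z y → (∀ᶠ z in 𝓝 y, β z (Z z) = 0) →
      ∀ u, fderiv ℝ β y u (Z y) = -β y (fderiv ℝ Z y u) := by
    intro Z hZ h u
    have h1 := (hβ.hasFDerivAt.clm_apply hZ.hasFDerivAt).fderiv
    have h2 : (fun z => β z (Z z)) =ᶠ[𝓝 y] fun _ => (0 : A) := h
    rw [h2.fderiv_eq] at h1
    have := congrArg (fun L => L u) h1
    simp at this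
    exact eq_neg_of_add_eq_zero_right this.symm
  rw [flatD_apply, key Y hY hβY, key X hX hβX, map_sub]
  abel

/-- Near `y`, the 2-form `dθ` is nondegenerate on the kernel of `a` and vanishes on the image of
the projection `R ∘ a`, where `a` is a connection with generators `R`. -/
structure KernelPair (θ : T → T →L[ℝ] ℝ) (a : T → T →L[ℝ] 𝔤) (R : T → 𝔤 →L[ℝ] T) (y : T) : Prop where
  smooth_form : ContDiffAt ℝ ∞ θ y
  smooth_conn : ContDiffAt ℝ ∞ a y
  smooth_gen : ContDiffAt ℝ ∞ R y
  conn_gen : ∀ᶠ z in 𝓝 y, ∀ u, a z (R z (a z u)) = a z u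
  kernel : ∀ᶠ z in 𝓝 y, ∀ u v, flatD θ z (R z (a z u)) v = 0
  nondegenerate : ∀ᶠ z in 𝓝 y, ∀ u, a z u = 0 → (∀ v, a z v = 0 → flatD θ z u v = 0) → u = 0

/-- `ϖ β` is the vector in `ker a` with `dθ (ϖ β, ·) = β` on `ker a`. -/
def IsSharpAt (θ : T → T →L[ℝ] ℝ) (a : T → T →L[ℝ] 𝔤) (ϖ : T → (T →L[ℝ] ℝ) → T) (z : T) : Prop :=
  ∀ β, a z (ϖ z β) = 0 ∧ ∀ v, a z v = 0 → flatD θ z (ϖ z β) v = β v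

variable {θ : T → T →L[ℝ] ℝ} {a : T → T →L[ℝ] 𝔤} {R : T → 𝔤 →L[ℝ] T}
  {ϖ : T → (T →L[ℝ] ℝ) → T} {y : T}

/-- The definition of `ϖ β` tests only vectors of ker a. Since the image of R ∘ a lies in the kernel
of dθ, any `v` may be replaced by its projection v − R(a v) to ker a. -/
lemma flatD_sharp {z : T} (h1 : ∀ u, a z (R z (a z u)) = a z u)
    (h2 : ∀ u v, flatD θ z (R z (a z u)) v = 0) (hϖ : IsSharpAt θ a ϖ z) (β : T →L[ℝ] ℝ) (v : T) :
    flatD θ z (ϖ z β) v = β (v - R z (a z v)) := by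
  have h : a z (v - R z (a z v)) = 0 := by simp [h1]
  rw [← (hϖ β).2 _ h, map_sub, flatD_swap θ z _ (R z (a z v)), h2]
  simp

variable [FiniteDimensional ℝ T]

lemma exists_equiv_of_injective (N : T →L[ℝ] T →L[ℝ] ℝ) (hN : Injective N) :
    ∃ e : T ≃L[ℝ] (T →L[ℝ] ℝ), (e : T →L[ℝ] T →L[ℝ] ℝ) = N := by
  have hd : Module.finrank ℝ T = Module.finrank ℝ (T →L[ℝ] ℝ) := by
    rw [← (LinearMap.toContinuousLinearMap (𝕜 := ℝ) (E := T) (F' := ℝ)).finrank_eq]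
    exact (Subspace.dual_finrank_eq (K := ℝ) (V := T)).symm
  refine ⟨(LinearEquiv.ofInjectiveOfFinrankEq N.toLinearMap hN hd).toContinuousLinearEquiv, ?_⟩
  ext; rfl

variable [FiniteDimensional ℝ 𝔤]

-- `ϖ β` is defined by a linear system on the moving subspace ker a. Adding an inner product of
-- values of `a` to dθ turns it into an invertible system on the whole space, with right-hand side β
-- ∘ (1 − R a). Smoothness then comes from smoothness of inversion.
set_option synthInstance.maxHeartbeats 200000 in
set_option maxHeartbeats 1000000 in
lemma contDiffAt_sharp (K : KernelPair θ a R y) (hϖ : ∀ᶠ z in 𝓝 y, IsSharpAt θ a ϖ z)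
    {b : T → T →L[ℝ] ℝ} (hb : ContDiffAt ℝ ∞ b y) : ContDiffAt ℝ ∞ (fun z => ϖ z (b z)) y := by
  -- An arbitrary inner product on 𝔤, transported from a Euclidean space; only its definiteness
  -- matters.
  let ip : 𝔤 →L[ℝ] 𝔤 →L[ℝ] ℝ :=
    (ContinuousLinearMap.compL ℝ 𝔤 _ ℝ).flip (toEuclidean (E := 𝔤)).toContinuousLinearMap ∘L
      innerSL ℝ ∘L (toEuclidean (E := 𝔤)).toContinuousLinearMap
  have hip : ∀ ξ, ip ξ ξ = 0 → ξ = 0 := by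
    intro ξ h
    have : inner ℝ (toEuclidean ξ) (toEuclidean ξ) = 0 := h
    simpa using this
  let N : T → T →L[ℝ] T →L[ℝ] ℝ := fun z =>
    flatD θ z + (ContinuousLinearMap.compL ℝ T 𝔤 ℝ).flip (a z) ∘L ip ∘L a z
  have N_apply : ∀ z u v, N z u v = flatD θ z u v + ip (a z u) (a z v) := fun z u v => rfl
  have hN : ContDiffAt ℝ ∞ N y := by
    let pre : (T →L[ℝ] 𝔤) →L[ℝ] (𝔤 →L[ℝ] ℝ) →L[ℝ] (T →L[ℝ] ℝ) :=
      (ContinuousLinearMap.compL ℝ T 𝔤 ℝ).flip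
    have h1 : ContDiffAt ℝ ∞ (fun z => pre (a z)) y := by
      have := K.smooth_conn
      fun_prop
    have h2 : ContDiffAt ℝ ∞ (fun z => ip ∘L a z) y := contDiffAt_const.clm_comp K.smooth_conn
    exact (contDiffAt_flatD K.smooth_form).add (h1.clm_comp h2)
  have hinj : ∀ᶠ z in 𝓝 y, Injective (N z) := by
    filter_upwards [K.conn_gen, K.kernel, K.nondegenerate] with z h1 h2 h3
    rw [injective_iff_map_eq_zero]
    intro u hu
    have ha : a z u = 0 := by
      -- Testing N u = 0 on R(a u) kills the dθ term and leaves the squared norm of a u.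
      apply hip
      have := congrArg (fun L => L (R z (a z u))) hu
      simpa [N_apply, h1, flatD_swap θ z u, h2] using this
    refine h3 u ha fun v hv => ?_
    have := congrArg (fun L => L v) hu
    simpa [N_apply, ha, hv] using this
  have hsol : (fun z => ϖ z (b z)) =ᶠ[𝓝 y] fun z =>
      (N z).inverse (b z ∘L (ContinuousLinearMap.id ℝ T - R z ∘L a z)) := by
    filter_upwards [K.conn_gen, K.kernel, hinj, hϖ] with z h1 h2 h3 h4
    obtain ⟨e, he⟩ := exists_equiv_of_injective (N z) h3
    rw [← he, ContinuousLinearMap.inverse_equiv]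
    symm
    rw [ContinuousLinearEquiv.coe_coe, ContinuousLinearEquiv.symm_apply_eq]
    ext v
    have : e (ϖ z (b z)) = N z (ϖ z (b z)) := by rw [← he]; rfl
    rw [this, N_apply, flatD_sharp h1 h2 h4, (h4 _).1]
    simp
  obtain ⟨e, he⟩ := exists_equiv_of_injective (N y) hinj.self_of_nhds
  have hinv : ContDiffAt ℝ ∞ (fun z => (N z).inverse) y := by
    refine ContDiffAt.comp (g := ContinuousLinearMap.inverse) y ?_ hN
    rw [← he]
    exact contDiffAt_map_inverse e
  exact (hinv.clm_apply (hb.clm_comp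
    (contDiffAt_const.sub (K.smooth_gen.clm_comp K.smooth_conn)))).congr_of_eventuallyEq hsol

/-- The bracket defined by `ϖ` on a vector space. -/
def flatBracket (ϖ : T → (T →L[ℝ] ℝ) → T) (f g : T → ℝ) (z : T) : ℝ :=
  fderiv ℝ g z (ϖ z (fderiv ℝ f z))

lemma contDiffAt_flatBracket (K : KernelPair θ a R y) (hϖ : ∀ᶠ z in 𝓝 y, IsSharpAt θ a ϖ z)
    {f g : T → ℝ} (hf : ContDiffAt ℝ ∞ f y) (hg : ContDiffAt ℝ ∞ g y) :
    ContDiffAt ℝ ∞ (flatBracket ϖ f g) y :=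
  (hg.fderiv_right (by simp)).clm_apply (contDiffAt_sharp K hϖ (hf.fderiv_right (by simp)))

/-- For an honest symplectic form, closedness and dθ(X_h, ·) = dh give the Jacobi identity. Here
dθ(X_h, ·) equals dh only after projection to ker a, and the error is dh of the part of [X_f, X_g]
along the image of R, which the curvature of `a` computes. -/
lemma flatBracket_jacobi (K : KernelPair θ a R y) (hϖ : ∀ᶠ z in 𝓝 y, IsSharpAt θ a ϖ z)
    {f g h : T → ℝ} (hf : ContDiffAt ℝ ∞ f y) (hg : ContDiffAt ℝ ∞ g y) (hh : ContDiffAt ℝ ∞ h y) :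
    flatBracket ϖ f (flatBracket ϖ g h) y + flatBracket ϖ g (flatBracket ϖ h f) y
      + flatBracket ϖ h (flatBracket ϖ f g) y =
    -(fderiv ℝ h y (R y (flatD a y (ϖ y (fderiv ℝ f y)) (ϖ y (fderiv ℝ g y))))
      + fderiv ℝ f y (R y (flatD a y (ϖ y (fderiv ℝ g y)) (ϖ y (fderiv ℝ h y))))
      + fderiv ℝ g y (R y (flatD a y (ϖ y (fderiv ℝ h y)) (ϖ y (fderiv ℝ f y))))) := by
  have d1 : ∀ {f : T → ℝ}, ContDiffAt ℝ ∞ f y → ContDiffAt ℝ ∞ (fderiv ℝ f) y :=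
    fun hf => hf.fderiv_right (by simp)
  have dX : ∀ {f : T → ℝ}, ContDiffAt ℝ ∞ f y →
      DifferentiableAt ℝ (fun z => ϖ z (fderiv ℝ f z)) y := fun hf =>
    (contDiffAt_sharp K hϖ (d1 hf)).differentiableAt (by simp)
  have ha0 : ∀ f : T → ℝ, ∀ᶠ z in 𝓝 y, a z (ϖ z (fderiv ℝ f z)) = 0 := fun f => by
    filter_upwards [hϖ] with z hz using (hz _).1
  have hω := (contDiffAt_flatD K.smooth_form).differentiableAt (by simp)
  -- The product rule for {f, {g, h}} = −X_f (dθ(X_g, X_h)), where X_f = ϖ(df).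
  have key : ∀ {f g h : T → ℝ}, ContDiffAt ℝ ∞ f y → ContDiffAt ℝ ∞ g y → ContDiffAt ℝ ∞ h y →
      flatBracket ϖ f (flatBracket ϖ g h) y =
        -(fderiv ℝ (flatD θ) y (ϖ y (fderiv ℝ f y)) (ϖ y (fderiv ℝ g y)) (ϖ y (fderiv ℝ h y))
        + flatD θ y (fderiv ℝ (fun z => ϖ z (fderiv ℝ g z)) y (ϖ y (fderiv ℝ f y)))
            (ϖ y (fderiv ℝ h y))
        + flatD θ y (ϖ y (fderiv ℝ g y))
            (fderiv ℝ (fun z => ϖ z (fderiv ℝ h z)) y (ϖ y (fderiv ℝ f y)))) := by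
    intro f g h hf hg hh
    have e : flatBracket ϖ g h =ᶠ[𝓝 y] fun z =>
        -flatD θ z (ϖ z (fderiv ℝ g z)) (ϖ z (fderiv ℝ h z)) := by
      filter_upwards [hϖ] with z hz
      rw [flatD_swap, (hz _).2 _ (hz _).1]
      simp [flatBracket]
    have e2 := ((hω.hasFDerivAt.clm_apply (dX hg).hasFDerivAt).clm_apply (dX hh).hasFDerivAt).neg
    rw [flatBracket, e.fderiv_eq]
    have := e2.fderiv
    rw [Pi.neg_def] at this
    rw [this]
    simp
    ring
  -- Split Z = [X_f, X_g] along ker a and the image of R: the whole of dh(Z) is a difference of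
  -- iterated brackets, the ker a part is dθ(X_h, Z), and the rest is −dh(R(da(X_f, X_g))).
  have key2 : ∀ {f g h : T → ℝ}, ContDiffAt ℝ ∞ f y → ContDiffAt ℝ ∞ g y → ContDiffAt ℝ ∞ h y →
      fderiv ℝ h y (R y (flatD a y (ϖ y (fderiv ℝ f y)) (ϖ y (fderiv ℝ g y)))) =
      flatBracket ϖ g (flatBracket ϖ f h) y - flatBracket ϖ f (flatBracket ϖ g h) y
      - flatD θ y (fderiv ℝ (fun z => ϖ z (fderiv ℝ g z)) y (ϖ y (fderiv ℝ f y)) -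
          fderiv ℝ (fun z => ϖ z (fderiv ℝ f z)) y (ϖ y (fderiv ℝ g y))) (ϖ y (fderiv ℝ h y)) := by
    intro f g h hf hg hh
    rw [flatD_eq_neg_of_apply_eq_zero (K.smooth_conn.differentiableAt (by simp)) (dX hf) (dX hg)
      (ha0 f) (ha0 g)]
    have hB : ∀ {f g : T → ℝ}, ContDiffAt ℝ ∞ f y → ContDiffAt ℝ ∞ g y →
        flatBracket ϖ f (flatBracket ϖ g h) y =
          fderiv ℝ (fderiv ℝ h) y (ϖ y (fderiv ℝ f y)) (ϖ y (fderiv ℝ g y)) +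
          fderiv ℝ h y (fderiv ℝ (fun z => ϖ z (fderiv ℝ g z)) y (ϖ y (fderiv ℝ f y))) := by
      intro f g hf hg
      have := (((d1 hh).differentiableAt (by simp)).hasFDerivAt.clm_apply
        (dX hg).hasFDerivAt).fderiv
      rw [flatBracket, show flatBracket ϖ g h = fun z => fderiv ℝ h z (ϖ z (fderiv ℝ g z)) from rfl,
        this]
      simp [add_comm]
    rw [hB hg hf, hB hf hg]
    rw [flatD_swap, flatD_sharp K.conn_gen.self_of_nhds K.kernel.self_of_nhds hϖ.self_of_nhds]
    have := hh.isSymmSndFDerivAt (by simpa using two_le_infty) (ϖ y (fderiv ℝ f y)) (ϖ y (fderiv ℝ g y))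
    rw [this]
    simp only [map_sub, map_neg]
    ring
  -- Skewness of the inner bracket is needed on a neighbourhood, since the outer bracket
  -- differentiates it.
  have anti : ∀ {f g h : T → ℝ}, flatBracket ϖ f (flatBracket ϖ g h) y =
      -flatBracket ϖ f (flatBracket ϖ h g) y := by
    intro f g h
    have : flatBracket ϖ g h =ᶠ[𝓝 y] fun z => -flatBracket ϖ h g z := by
      filter_upwards [hϖ] with z hz
      simp only [flatBracket]
      rw [← (hz _).2 _ (hz _).1, flatD_swap, (hz _).2 _ (hz _).1]
    rw [flatBracket, this.fderiv_eq, flatBracket, ← Pi.neg_def, fderiv_neg]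
    rfl
  rw [key2 hf hg hh, key2 hg hh hf, key2 hh hf hg]
  have c := fderiv_flatD_cyclic K.smooth_form (ϖ y (fderiv ℝ f y)) (ϖ y (fderiv ℝ g y))
    (ϖ y (fderiv ℝ h y))
  have k1 := key hf hg hh
  have k2 := key hg hh hf
  have k3 := key hh hf hg
  rw [flatD_swap _ _ (ϖ y (fderiv ℝ g y))] at k1
  rw [flatD_swap _ _ (ϖ y (fderiv ℝ h y))] at k2
  rw [flatD_swap _ _ (ϖ y (fderiv ℝ f y))] at k3
  have a1 := @anti f g h
  have a2 := @anti g h f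
  have a3 := @anti h f g
  simp only [map_sub, sub_apply]
  linarith

end Flat

/-! ### Pullback of 1-forms on manifolds -/

section Pullback

variable {E : Type*} [NormedAddCommGroup E] [NormedSpace ℝ E]
  {H : Type*} [TopologicalSpace H] {I : ModelWithCorners ℝ E H}
  {P : Type*} [TopologicalSpace P] [ChartedSpace H P]
  {E' : Type*} [NormedAddCommGroup E'] [NormedSpace ℝ E']
  {H' : Type*} [TopologicalSpace H'] {I' : ModelWithCorners ℝ E' H'}
  {P' : Type*} [TopologicalSpace P'] [ChartedSpace H' P']
  {E'' : Type*} [NormedAddCommGroup E''] [NormedSpace ℝ E'']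
  {H'' : Type*} [TopologicalSpace H''] {I'' : ModelWithCorners ℝ E'' H''}
  {P'' : Type*} [TopologicalSpace P''] [ChartedSpace H'' P'']
  {A : Type*} [NormedAddCommGroup A] [NormedSpace ℝ A]

variable (I I') in
/-- The pullback of a vector-valued 1-form by a map. -/
def pull (φ : P → P') (α : ∀ p : P', TangentSpace I' p →L[ℝ] A) (p : P) :
    TangentSpace I p →L[ℝ] A :=
  α (φ p) ∘L mfderiv I I' φ p

lemma pull_congr {φ ψ : P → P'} {p : P} (h : φ =ᶠ[𝓝 p] ψ)
    (α : ∀ p : P', TangentSpace I' p →L[ℝ] A) : pull I I' φ α p = pull I I' ψ α p := by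
  have h1 : mfderiv I I' φ p = mfderiv I I' ψ p := h.mfderiv_eq
  have h2 : (α (φ p) : E' →L[ℝ] A) = α (ψ p) :=
    congrArg (fun x : P' => (show E' →L[ℝ] A from α x)) h.self_of_nhds
  show (α (φ p) : E' →L[ℝ] A) ∘L (mfderiv I I' φ p : E →L[ℝ] E') = _
  rw [h1, h2]; rfl

lemma pull_comp {φ : P → P'} {ψ : P' → P''} {p : P} (hφ : MDifferentiableAt I I' φ p)
    (hψ : MDifferentiableAt I' I'' ψ (φ p)) (α : ∀ p : P'', TangentSpace I'' p →L[ℝ] A) :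
    pull I I'' (ψ ∘ φ) α p = pull I I' φ (pull I' I'' ψ α) p := by
  simp only [pull, mfderiv_comp p hψ hφ, ContinuousLinearMap.comp_assoc]
  rfl

lemma pull_id (α : ∀ p : P, TangentSpace I p →L[ℝ] A) (p : P) : pull I I id α p = α p := by
  simp [pull, mfderiv_id]

variable (I) in
/-- The coordinate expression of a 1-form in the preferred chart at `p`. -/
abbrev chartForm (α : ∀ p : P, TangentSpace I p →L[ℝ] A) (p : P) : E → E →L[ℝ] A :=
  pull 𝓘(ℝ, E) I (extChartAt I p).symm α

variable [I.Boundaryless]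

lemma contDiffAt_writtenInExtChartAt {φ : P → P'} {p : P} (hφ : ContMDiffAt I I' ∞ φ p) :
    ContDiffAt ℝ ∞ (writtenInExtChartAt I I' p φ) (extChartAt I p p) := by
  have := (contMDiffAt_iff.1 hφ).2
  rwa [I.range_eq_univ, contDiffWithinAt_univ] at this

variable [I'.Boundaryless]

lemma extDerivOne_eq (α : ∀ p : P, TangentSpace I p →L[ℝ] A) (p : P) :
    extDerivOne I α p = flatD (chartForm I α p) (extChartAt I p p) := by
  simp only [extDerivOne, flatD, I.range_eq_univ, fderivWithin_univ, mfderivWithin_univ]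
  rfl

variable (I) in
/-- A 1-form is smooth at a point if its coordinate expression is. -/
def SmoothFormAt (α : ∀ p : P, TangentSpace I p →L[ℝ] A) (p : P) : Prop :=
  ContDiffAt ℝ ∞ (chartForm I α p) (extChartAt I p p)

lemma chartForm_model (α : ∀ p : E, TangentSpace 𝓘(ℝ, E) p →L[ℝ] A) (p y : E) :
    chartForm 𝓘(ℝ, E) α p y = α y := by
  have : ((extChartAt 𝓘(ℝ, E) p).symm : E → E) = id := by
    ext; rfl
  rw [chartForm, this, pull_id]

lemma smoothFormAt_model {α : ∀ p : E, TangentSpace 𝓘(ℝ, E) p →L[ℝ] A} {p : E} :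
    SmoothFormAt 𝓘(ℝ, E) α p ↔ ContDiffAt ℝ ∞ (F := E →L[ℝ] A) (fun y => α y) p := by
  have : chartForm 𝓘(ℝ, E) α p = (fun y => α y : E → E →L[ℝ] A) :=
    funext fun y => chartForm_model α p y
  rw [SmoothFormAt, this]; rfl

lemma extDerivOne_model (α : ∀ p : E, TangentSpace 𝓘(ℝ, E) p →L[ℝ] A) (p : E) :
    extDerivOne 𝓘(ℝ, E) α p = flatD (fun y => α y : E → E →L[ℝ] A) p := by
  have : chartForm 𝓘(ℝ, E) α p = (fun y => α y : E → E →L[ℝ] A) :=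
    funext fun y => chartForm_model α p y
  rw [extDerivOne_eq, this]; rfl

variable [IsManifold I ∞ P] [IsManifold I' ∞ P']

lemma mdifferentiableAt_chart_symm {p : P} {y : E} (hy : y ∈ (extChartAt I p).target) :
    MDifferentiableAt 𝓘(ℝ, E) I (extChartAt I p).symm y := by
  have : IsManifold I 1 P := IsManifold.of_le (n := ∞) (by simp)
  have := mdifferentiableWithinAt_extChartAt_symm (I := I) hy
  rwa [I.range_eq_univ, mdifferentiableWithinAt_univ] at this

lemma contMDiffAt_chart_symm {p : P} {y : E} (hy : y ∈ (extChartAt I p).target) :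
    ContMDiffAt 𝓘(ℝ, E) I ∞ (extChartAt I p).symm y :=
  (contMDiffOn_extChartAt_symm p).contMDiffAt ((isOpen_extChartAt_target p).mem_nhds hy)

/-- Pulling back commutes with passing to coordinates wherever φ stays inside the chart at `φ p`,
hence near the centre of the chart at `p`. -/
lemma chartForm_pull {φ : P → P'} {p : P} (hφ : ContMDiffAt I I' ∞ φ p)
    (α : ∀ p : P', TangentSpace I' p →L[ℝ] A) :
    chartForm I (pull I I' φ α) p =ᶠ[𝓝 (extChartAt I p p)] fun y =>
      chartForm I' α (φ p) (writtenInExtChartAt I I' p φ y) ∘L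
        fderiv ℝ (writtenInExtChartAt I I' p φ) y := by
  have : IsManifold I 1 P := IsManifold.of_le (n := ∞) (by simp)
  have : IsManifold I' 1 P' := IsManifold.of_le (n := ∞) (by simp)
  have hc : Filter.Tendsto (extChartAt I p).symm (𝓝 (extChartAt I p p)) (𝓝 p) := by
    have := continuousAt_extChartAt_symm (I := I) p
    rwa [ContinuousAt, extChartAt_to_inv] at this
  have h1 : ∀ᶠ x in 𝓝 p, ContMDiffAt I I' 1 φ x :=
    contMDiffAt_iff_contMDiffAt_nhds (by simp) |>.1 (hφ.of_le (mod_cast le_top))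
  have h2 : ∀ᶠ x in 𝓝 p, φ x ∈ (extChartAt I' (φ p)).source :=
    hφ.continuousAt.eventually (extChartAt_source_mem_nhds (I := I') (φ p))
  filter_upwards [hc.eventually h1, hc.eventually h2, hc.eventually h2.eventually_nhds,
    extChartAt_target_mem_nhds (I := I) p] with y hy1 hy2 hy3 hy4
  have hs := mdifferentiableAt_chart_symm (I := I) hy4
  have hd : MDifferentiableAt 𝓘(ℝ, E) I' (φ ∘ (extChartAt I p).symm) y :=
    (hy1.mdifferentiableAt (by simp)).comp y hs
  have hd' : MDifferentiableAt 𝓘(ℝ, E) 𝓘(ℝ, E') (writtenInExtChartAt I I' p φ) y :=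
    (mdifferentiableAt_extChartAt (by simpa using hy2)).comp y hd
  rw [chartForm, ← pull_comp hs (hy1.mdifferentiableAt (by simp)), ← mfderiv_eq_fderiv]
  have e : (φ ∘ (extChartAt I p).symm) =ᶠ[𝓝 y]
      (extChartAt I' (φ p)).symm ∘ writtenInExtChartAt I I' p φ := by
    filter_upwards [hs.continuousAt.eventually hy3] with z hz
    simp only [writtenInExtChartAt, comp_apply]
    rw [(extChartAt I' (φ p)).left_inv hz]
  rw [pull_congr e, pull_comp hd' (mdifferentiableAt_chart_symm
    ((extChartAt I' (φ p)).map_source hy2))]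
  rfl

lemma SmoothFormAt.pull {φ : P → P'} {p : P} (hφ : ContMDiffAt I I' ∞ φ p)
    {α : ∀ p : P', TangentSpace I' p →L[ℝ] A} (hα : SmoothFormAt I' α (φ p)) :
    SmoothFormAt I (pull I I' φ α) p := by
  have hw := contDiffAt_writtenInExtChartAt hφ
  refine ContDiffAt.congr_of_eventuallyEq ?_ (chartForm_pull hφ α)
  have e : writtenInExtChartAt I I' p φ (extChartAt I p p) = extChartAt I' (φ p) (φ p) := by
    simp [writtenInExtChartAt]
  have h1 : ContDiffAt ℝ ∞ (chartForm I' α (φ p)) (writtenInExtChartAt I I' p φ (extChartAt I p p)) := by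
    rw [e]; exact hα
  exact ContDiffAt.clm_comp (h1.comp (extChartAt I p p) hw) (hw.fderiv_right (by simp))

/-- `extDerivOne` uses a different chart at every point; this reduces its naturality to that of
`flatD` under the coordinate expression of φ. -/
lemma extDerivOne_pull {φ : P → P'} {p : P} (hφ : ContMDiffAt I I' ∞ φ p)
    {α : ∀ p : P', TangentSpace I' p →L[ℝ] A} (hα : SmoothFormAt I' α (φ p))
    (u v : TangentSpace I p) :
    extDerivOne I (Nonholonomic.pull I I' φ α) p u v =
      extDerivOne I' α (φ p) (mfderiv I I' φ p u) (mfderiv I I' φ p v) := by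
  have hw := contDiffAt_writtenInExtChartAt hφ
  have e : writtenInExtChartAt I I' p φ (extChartAt I p p) = extChartAt I' (φ p) (φ p) := by
    simp [writtenInExtChartAt]
  have e' : mfderiv I I' φ p = fderiv ℝ (writtenInExtChartAt I I' p φ) (extChartAt I p p) := by
    rw [(hφ.mdifferentiableAt (by simp)).mfderiv, I.range_eq_univ, fderivWithin_univ]
  rw [extDerivOne_eq, extDerivOne_eq, flatD_congr (chartForm_pull hφ α), e', ← e]
  refine flatD_comp (hw.of_le two_le_infty) ?_ u v
  rw [e]
  exact hα.differentiableAt (by simp)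

/-- Naturality applied to the inverse chart. It reads dα at all points of one chart domain in that
single chart, so that dα itself can be differentiated there. -/
lemma SmoothFormAt.flatD_chartForm {α : ∀ p : P, TangentSpace I p →L[ℝ] A} {p : P} {y : E}
    (hy : y ∈ (extChartAt I p).target) (hα : SmoothFormAt I α ((extChartAt I p).symm y)) (u v : E) :
    flatD (chartForm I α p) y u v =
      extDerivOne I α ((extChartAt I p).symm y) (mfderiv 𝓘(ℝ, E) I (extChartAt I p).symm y u)
        (mfderiv 𝓘(ℝ, E) I (extChartAt I p).symm y v) := by
  refine Eq.trans ?_ (extDerivOne_pull (contMDiffAt_chart_symm hy) hα u v)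
  rw [extDerivOne_model]
  rfl

end Pullback

/-! ### Smoothness of tangent vectors -/

section TangentVectors

variable {E : Type*} [NormedAddCommGroup E] [NormedSpace ℝ E]
  {H : Type*} [TopologicalSpace H] {I : ModelWithCorners ℝ E H}
  {P : Type*} [TopologicalSpace P] [ChartedSpace H P] [IsManifold I ∞ P]
  {E' : Type*} [NormedAddCommGroup E'] [NormedSpace ℝ E']
  {H' : Type*} [TopologicalSpace H'] {I' : ModelWithCorners ℝ E' H'}
  {P' : Type*} [TopologicalSpace P'] [ChartedSpace H' P'] [IsManifold I' ∞ P']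
  {E'' : Type*} [NormedAddCommGroup E''] [NormedSpace ℝ E'']
  {H'' : Type*} [TopologicalSpace H''] {I'' : ModelWithCorners ℝ E'' H''}
  {P'' : Type*} [TopologicalSpace P''] [ChartedSpace H'' P'']
  {A B : Type*} [NormedAddCommGroup A] [NormedSpace ℝ A] [NormedAddCommGroup B] [NormedSpace ℝ B]

omit [IsManifold I ∞ P] in
lemma contMDiffAt_clm_of_apply [FiniteDimensional ℝ A] {φ : P → A →L[ℝ] B} {p : P}
    (h : ∀ a, ContMDiffAt I 𝓘(ℝ, B) ∞ (fun x => φ x a) p) :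
    ContMDiffAt I 𝓘(ℝ, A →L[ℝ] B) ∞ φ p := by
  let b := Module.finBasis ℝ A
  have e : φ = fun x => ∑ i, ContinuousLinearMap.smulRightL ℝ A B
      (LinearMap.toContinuousLinearMap (b.coord i)) (φ x (b i)) := by
    ext x a
    simp only [sum_apply, ContinuousLinearMap.smulRightL_apply_apply]
    conv_lhs => rw [← b.sum_repr a]
    simp [-Module.Basis.sum_repr]
  rw [e]
  refine contMDiffAt_finsetSum fun i _ => ?_
  exact contMDiffAt_const.clm_apply (h (b i))

/-- The fibre part of the preferred trivialization of the tangent bundle is the derivative of the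
preferred chart. -/
lemma contMDiffAt_chartVec {x : P'' → TangentBundle I P} {z : P''}
    (hx : ContMDiffAt I'' I.tangent ∞ x z) :
    ContMDiffAt I'' 𝓘(ℝ, E) ∞
      (fun n => (mfderiv I 𝓘(ℝ, E) (extChartAt I (x z).1) (x n).1 (x n).2 : E)) z := by
  have : IsManifold I 1 P := IsManifold.of_le (n := ∞) (by simp)
  have h := contMDiffAt_totalSpace.1 hx
  refine h.2.congr_of_eventuallyEq ?_
  have h2 : ∀ᶠ n in 𝓝 z, (x n).1 ∈ (chartAt H (x z).1).source :=
    h.1.continuousAt.eventually ((chartAt H (x z).1).open_source.mem_nhds (mem_chart_source H _))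
  filter_upwards [h2] with n hn
  refine (congrArg (fun L : TangentSpace I (x n).1 →L[ℝ] E => L (x n).2)
    (TangentBundle.continuousLinearMapAt_trivializationAt hn).symm).trans ?_
  simp only [Trivialization.continuousLinearMapAt_apply]
  rw [Trivialization.coe_linearMapAt_of_mem _ hn]

lemma contMDiffAt_tangentMap {f : P → P'} {U : Set P} (hU : IsOpen U)
    (hf : ContMDiffOn I I' ∞ f U) {v : TangentBundle I P} (hv : v.1 ∈ U) :
    ContMDiffAt I.tangent I'.tangent ∞ (tangentMap I I' f) v := by
  have : IsManifold I 1 P := IsManifold.of_le (n := ∞) (by simp)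
  have : IsManifold I' 1 P' := IsManifold.of_le (n := ∞) (by simp)
  have h := hf.contMDiffOn_tangentMapWithin (m := ∞) (by simp) hU.uniqueMDiffOn
  have hV : IsOpen (π E (TangentSpace I : P → Type _) ⁻¹' U) :=
    hU.preimage (FiberBundle.continuous_proj E _)
  refine (h.contMDiffAt (hV.mem_nhds hv)).congr_of_eventuallyEq ?_
  filter_upwards [hV.mem_nhds hv] with w hw
  rw [tangentMapWithin_eq_tangentMap (hU.uniqueMDiffWithinAt hw)]
  exact ((hf.contMDiffAt (hU.mem_nhds hw)).mdifferentiableAt (by simp))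

lemma contMDiff_constVec (u : E) : ContMDiff 𝓘(ℝ, E) 𝓘(ℝ, E).tangent ∞
    (fun y : E => (⟨y, u⟩ : TangentBundle 𝓘(ℝ, E) E)) :=
  contMDiff_vectorSpace_iff_contDiff.2 contDiff_const

lemma contMDiffAt_mfderiv_const {f : E → P'} {U : Set E} (hU : IsOpen U)
    (hf : ContMDiffOn 𝓘(ℝ, E) I' ∞ f U) {y : E} (hy : y ∈ U) (u : E) :
    ContMDiffAt 𝓘(ℝ, E) I'.tangent ∞
      (fun z => (⟨f z, mfderiv 𝓘(ℝ, E) I' f z u⟩ : TangentBundle I' P')) y :=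
  ContMDiffAt.comp y (contMDiffAt_tangentMap (v := ⟨y, u⟩) hU hf hy) (contMDiff_constVec u y)

variable [IsManifold I'' ∞ P'']

/-- A partial derivative is the full tangent map applied to a vector with zero first component, so
it depends smoothly on the parameter as well. For an action this is the joint smoothness of its
tangent lift. -/
lemma contMDiff_tangent_right {Φ : P × P' → P''} (hΦ : ContMDiff (I.prod I') I'' ∞ Φ) :
    ContMDiff (I.prod I'.tangent) I''.tangent ∞ (fun p : P × TangentBundle I' P' =>
      (⟨Φ (p.1, p.2.1), mfderiv I' I'' (fun x => Φ (p.1, x)) p.2.1 p.2.2⟩ :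
        TangentBundle I'' P'')) := by
  have : IsManifold I 1 P := IsManifold.of_le (n := ∞) (by simp)
  have : IsManifold I' 1 P' := IsManifold.of_le (n := ∞) (by simp)
  have : IsManifold I'' 1 P'' := IsManifold.of_le (n := ∞) (by simp)
  have h1 : ContMDiff (I.prod I'.tangent) (I.tangent.prod I'.tangent) ∞
      (fun p : P × TangentBundle I' P' =>
        ((zeroSection E (TangentSpace I) p.1 : TangentBundle I P), p.2)) :=
    ((contMDiff_zeroSection ℝ (TangentSpace I)).comp contMDiff_fst).prodMk contMDiff_snd
  have h2 := (hΦ.contMDiff_tangentMap (m := ∞) (by simp)).comp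
    (contMDiff_equivTangentBundleProd_symm.comp h1)
  refine h2.congr fun p => ?_
  have e : mfderiv I' I'' (fun x => Φ (p.1, x)) p.2.1 =
      mfderiv (I.prod I') I'' Φ (p.1, p.2.1) ∘L mfderiv I' (I.prod I') (fun x => (p.1, x)) p.2.1 :=
    mfderiv_comp (g := Φ) (f := fun x => (p.1, x)) p.2.1 (hΦ.mdifferentiableAt (by simp))
      (contMDiff_const.prodMk contMDiff_id |>.mdifferentiableAt (n := ∞) (by simp))
  rw [e, mfderiv_prod_right]
  rfl

/-- The same with the zero vector in the second factor. For an action, at the identity of the group,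
it gives the smoothness of infinitesimal generators. -/
lemma contMDiff_tangent_left {Φ : P × P' → P''} (hΦ : ContMDiff (I.prod I') I'' ∞ Φ) (p : P)
    (ξ : TangentSpace I p) :
    ContMDiff I' I''.tangent ∞ (fun x : P' =>
      (⟨Φ (p, x), mfderiv I I'' (fun g => Φ (g, x)) p ξ⟩ : TangentBundle I'' P'')) := by
  have : IsManifold I 1 P := IsManifold.of_le (n := ∞) (by simp)
  have : IsManifold I' 1 P' := IsManifold.of_le (n := ∞) (by simp)
  have : IsManifold I'' 1 P'' := IsManifold.of_le (n := ∞) (by simp)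
  have h1 : ContMDiff I' (I.tangent.prod I'.tangent) ∞ (fun x : P' =>
        ((⟨p, ξ⟩ : TangentBundle I P), (zeroSection E' (TangentSpace I') x : TangentBundle I' P'))) :=
    contMDiff_const.prodMk (contMDiff_zeroSection ℝ (TangentSpace I'))
  have h2 := (hΦ.contMDiff_tangentMap (m := ∞) (by simp)).comp
    (contMDiff_equivTangentBundleProd_symm.comp h1)
  refine h2.congr fun x => ?_
  have e : mfderiv I I'' (fun g => Φ (g, x)) p =
      mfderiv (I.prod I') I'' Φ (p, x) ∘L mfderiv I (I.prod I') (fun g => (g, x)) p :=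
    mfderiv_comp (g := Φ) (f := fun g => (g, x)) p (hΦ.mdifferentiableAt (by simp))
      (contMDiff_id.prodMk contMDiff_const |>.mdifferentiableAt (n := ∞) (by simp))
  rw [e, mfderiv_prod_left]
  rfl

omit [IsManifold I ∞ P] [IsManifold I' ∞ P'] [IsManifold I'' ∞ P''] in
/-- A curve whose velocity vanishes near a time is locally constant there. -/
lemma eventually_const_of_mfderiv_eq_zero [I.Boundaryless] {c : ℝ → P} {t : ℝ} [IsManifold I 1 P]
    (hc : ∀ᶠ s in 𝓝 t, MDifferentiableAt 𝓘(ℝ, ℝ) I c s ∧ mfderiv 𝓘(ℝ, ℝ) I c s = 0) :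
    ∀ᶠ s in 𝓝 t, c s = c t := by
  have hcont := hc.self_of_nhds.1.continuousAt
  have h1 : ∀ᶠ s in 𝓝 t, c s ∈ (extChartAt I (c t)).source :=
    hcont.eventually (extChartAt_source_mem_nhds (I := I) (c t))
  obtain ⟨ε, hε, hb⟩ := Metric.eventually_nhds_iff_ball.1 (hc.and h1)
  have hd : ∀ s ∈ Metric.ball t ε, HasFDerivAt (extChartAt I (c t) ∘ c) (0 : ℝ →L[ℝ] E) s := by
    intro s hs
    obtain ⟨⟨h2, h3⟩, h4⟩ := hb s hs
    have h5 := (mdifferentiableAt_extChartAt (I := I) (x := c t) (by simpa using h4)).hasMFDerivAt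
    have h6 := (h5.comp s h2.hasMFDerivAt).hasFDerivAt
    exact h6.congr_fderiv (by rw [h3]; exact ContinuousLinearMap.comp_zero _)
  filter_upwards [Metric.ball_mem_nhds t hε] with s hs
  have e : (extChartAt I (c t) ∘ c) s = (extChartAt I (c t) ∘ c) t :=
    (convex_ball t ε).is_const_of_fderivWithin_eq_zero (𝕜 := ℝ)
      (fun x hx => (hd x hx).differentiableAt.differentiableWithinAt)
      (fun x hx => by
        rw [fderivWithin_of_isOpen Metric.isOpen_ball hx, (hd x hx).fderiv]) hs
      (Metric.mem_ball_self hε)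
  exact (extChartAt I (c t)).injOn (hb s hs).2 (mem_extChartAt_source (c t)) e

end TangentVectors

/-! ### The constraint manifold and the action on it -/

namespace NonholonomicSystem

section Action

variable {E F : Type*} [NormedAddCommGroup E] [NormedSpace ℝ E]
  [NormedAddCommGroup F] [NormedSpace ℝ F]
  {Q : Type*} [TopologicalSpace Q] [ChartedSpace E Q] [IsManifold 𝓘(ℝ, E) ∞ Q]
  {V : Q → Type*} [TopologicalSpace (TotalSpace F V)] [∀ q, TopologicalSpace (V q)]
  [∀ q, AddCommGroup (V q)] [∀ q, Module ℝ (V q)] [FiberBundle F V] [VectorBundle ℝ F V]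
  [ContMDiffVectorBundle ∞ F V 𝓘(ℝ, E)]
  {S : NonholonomicSystem E F Q V}

variable (S) in
/-- The inclusion of `D ≅ M` into `TQ`. -/
def velocity (m : S.Phase) : TangentBundle 𝓘(ℝ, E) Q := ⟨m.1, S.incl m.1 m.2⟩

variable (S) in
lemma contMDiff_velocity : ContMDiff (phaseModel E F) 𝓘(ℝ, E).tangent ∞ S.velocity :=
  S.incl_smooth

lemma velocity_injective : Injective S.velocity := by
  rintro ⟨q, n⟩ ⟨q', n'⟩ h
  obtain rfl : q = q' := congrArg TotalSpace.proj h
  have h2 : S.incl q n = S.incl q n' := by simpa [velocity] using h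
  rw [S.incl_injective q h2]

lemma legendre_injective : Injective S.legendre := by
  rintro ⟨q, v⟩ ⟨q', v'⟩ h
  obtain rfl : q = q' := congrArg TotalSpace.proj h
  have h2 : S.metric.inner q v = S.metric.inner q v' := by simpa [legendre] using h
  have h3 : S.metric.inner q (v - v') (v - v') = 0 := by
    have h : S.metric.inner q (v - v') = 0 := by rw [map_sub, h2, sub_self]
    rw [h]; rfl
  have h4 : v - v' = 0 := by
    by_contra hne
    exact (S.metric.pos q _ hne).ne' h3
  rw [sub_eq_zero.1 h4]

lemma embed_injective : Injective S.embed := legendre_injective.comp velocity_injective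

variable (S) in
lemma contMDiff_embed : ContMDiff (phaseModel E F) (cotangentModel E) ∞ S.embed := by
  have h1 : ContMDiff (phaseModel E F) ((𝓘(ℝ, E)).prod 𝓘(ℝ, E →L[ℝ] E →L[ℝ] ℝ)) ∞
      (fun m : S.Phase => TotalSpace.mk' (E →L[ℝ] E →L[ℝ] ℝ)
        (E := fun q : Q => TangentSpace 𝓘(ℝ, E) q →L[ℝ] TangentSpace 𝓘(ℝ, E) q →L[ℝ] ℝ)
        m.1 (S.metric.inner m.1)) :=
    S.metric.contMDiff.comp (contMDiff_proj V)
  exact ContMDiff.clm_bundle_apply (F₁ := E) (F₂ := E →L[ℝ] ℝ)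
    (E₁ := fun q : Q => TangentSpace 𝓘(ℝ, E) q)
    (E₂ := fun q : Q => TangentSpace 𝓘(ℝ, E) q →L[ℝ] ℝ) h1 S.contMDiff_velocity

/-- A map to the constraint manifold is smooth if the corresponding map to `TQ` is. -/
lemma contMDiffAt_of_velocity [FiniteDimensional ℝ E] [FiniteDimensional ℝ F]
    {E' : Type*} [NormedAddCommGroup E'] [NormedSpace ℝ E']
    {H' : Type*} [TopologicalSpace H'] {I' : ModelWithCorners ℝ E' H'}
    {N : Type*} [TopologicalSpace N] [ChartedSpace H' N] {s : N → S.Phase} {x : N}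
    (hs : ContMDiffAt I' 𝓘(ℝ, E).tangent ∞ (fun y => S.velocity (s y)) x) :
    ContMDiffAt I' (phaseModel E F) ∞ s x := by
  have hs' := contMDiffAt_totalSpace.1 hs
  have hproj : ContMDiffAt I' 𝓘(ℝ, E) ∞ (fun y => (s y).1) x := hs'.1
  refine contMDiffAt_totalSpace.2 ⟨hproj, ?_⟩
  set q₀ := (s x).1 with hq₀
  let e := trivializationAt F V q₀
  let eT := trivializationAt E (TangentSpace 𝓘(ℝ, E) : Q → Type _) q₀
  have he : ∀ᶠ q in 𝓝 q₀, q ∈ e.baseSet :=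
    e.open_baseSet.mem_nhds (FiberBundle.mem_baseSet_trivializationAt' q₀)
  have heT : ∀ᶠ q in 𝓝 q₀, q ∈ eT.baseSet :=
    eT.open_baseSet.mem_nhds (FiberBundle.mem_baseSet_trivializationAt' q₀)
  -- The inclusion D → TQ, read in trivializations on both sides.
  let L : Q → F →L[ℝ] E := fun q =>
    LinearMap.toContinuousLinearMap (eT.linearMapAt ℝ q ∘ₗ S.incl q ∘ₗ e.symmₗ ℝ q)
  have hL : ∀ q ∈ eT.baseSet, q ∈ e.baseSet → ∀ f, L q f = (eT ⟨q, S.incl q (e.symm q f)⟩).2 := by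
    intro q hq hq' f
    simp only [L, LinearMap.coe_toContinuousLinearMap', LinearMap.comp_apply,
      Trivialization.coe_linearMapAt_of_mem _ hq]
    exact congrArg (fun n => (eT ⟨q, S.incl q n⟩).2) (e.symmₗ_apply hq' f)
  have hLs : ContMDiffAt 𝓘(ℝ, E) 𝓘(ℝ, F →L[ℝ] E) ∞ L q₀ := by
    refine contMDiffAt_clm_of_apply fun f => ?_
    have h1 : ContMDiffAt 𝓘(ℝ, E) (phaseModel E F) ∞ (fun q => (⟨q, e.symm q f⟩ : S.Phase)) q₀ := by
      have h := (e.contMDiffOn_symm (IB := 𝓘(ℝ, E)) (n := ∞)).contMDiffAt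
        (x := (q₀, f)) (e.open_target.mem_nhds (e.mem_target.2 he.self_of_nhds))
      refine (ContMDiffAt.comp q₀ h (contMDiffAt_id.prodMk contMDiffAt_const)).congr_of_eventuallyEq ?_
      filter_upwards [he] with q hq
      exact e.mk_symm hq f
    have h2 := (contMDiffAt_totalSpace.1 (S.contMDiff_velocity.contMDiffAt.comp q₀ h1)).2
    refine h2.congr_of_eventuallyEq ?_
    filter_upwards [heT, he] with q hq hq' using hL q hq hq' f
  have hinj : LinearMap.ker (L q₀).toLinearMap = ⊥ := by
    rw [LinearMap.ker_eq_bot']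
    intro f hf
    have h1 : eT.linearMapAt ℝ q₀ (S.incl q₀ (e.symmₗ ℝ q₀ f)) = 0 := hf
    have h2 : S.incl q₀ (e.symmₗ ℝ q₀ f) = 0 := by
      rw [← eT.symmₗ_linearMapAt (R := ℝ) heT.self_of_nhds (S.incl q₀ (e.symmₗ ℝ q₀ f)), h1, map_zero]
    have h3 : e.symmₗ ℝ q₀ f = 0 := S.incl_injective q₀ (by rw [h2, map_zero])
    rw [← e.linearMapAt_symmₗ (R := ℝ) he.self_of_nhds f, h3, map_zero]
  -- A left inverse B of L at the base point alone suffices: nearby B L is close to the identity,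
  -- hence invertible, and (B L)⁻¹ B is a smooth family of left inverses that recovers the fibre
  -- coordinate of `s`.
  obtain ⟨B, hB⟩ := (L q₀).toLinearMap.exists_leftInverse_of_injective hinj
  let B' : E →L[ℝ] F := LinearMap.toContinuousLinearMap B
  let M : N → F →L[ℝ] F := fun y => B' ∘L L (s y).1
  have hMx : M x = ContinuousLinearMap.id ℝ F := by
    ext f; exact congrArg (fun T => T f) hB
  have hM : ContMDiffAt I' 𝓘(ℝ, F →L[ℝ] F) ∞ M x :=
    (contMDiffAt_const (c := B')).clm_comp (ContMDiffAt.comp (g := L) x hLs hproj)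
  have hMinv : ContMDiffAt I' 𝓘(ℝ, F →L[ℝ] F) ∞ (fun y => (M y).inverse) x := by
    refine ContMDiffAt.comp (g := ContinuousLinearMap.inverse) x (ContDiffAt.contMDiffAt ?_) hM
    rw [hMx]
    exact contDiffAt_map_inverse (ContinuousLinearEquiv.refl ℝ F)
  have hM1 : ∀ᶠ y in 𝓝 x, ∃ T : F ≃L[ℝ] F, (T : F →L[ℝ] F) = M y := by
    refine hM.continuousAt.eventually (p := fun A => ∃ T : F ≃L[ℝ] F, (T : F →L[ℝ] F) = A) ?_
    rw [hMx]
    exact ContinuousLinearEquiv.nhds (ContinuousLinearEquiv.refl ℝ F)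
  have key := hMinv.clm_apply ((contMDiffAt_const (c := B')).clm_apply hs'.2)
  refine key.congr_of_eventuallyEq ?_
  filter_upwards [hM1, hproj.continuousAt.eventually he, hproj.continuousAt.eventually heT] with
    y ⟨T, hT⟩ hy hyT
  rw [← hT, ContinuousLinearMap.inverse_equiv, ContinuousLinearEquiv.coe_coe]
  symm
  rw [ContinuousLinearEquiv.symm_apply_eq]
  have h1 : T (e (s y)).2 = M y (e (s y)).2 := by rw [← hT]; rfl
  refine Eq.trans ?_ h1.symm
  refine congrArg B' ?_
  refine Eq.trans ?_ (hL _ hyT hy _).symm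
  have h2 : e.symm (s y).1 (e (s y)).2 = (s y).2 := e.symm_apply_apply_mk hy (s y).2
  rw [h2]
  rfl

variable {EG : Type*} [NormedAddCommGroup EG] [NormedSpace ℝ EG]
  {G : Type*} [TopologicalSpace G] [ChartedSpace EG G] [Group G] [LieGroup 𝓘(ℝ, EG) ∞ G]
  [MulAction G Q]

lemma IsSymmetryGroup.contMDiff_smul (hG : S.IsSymmetryGroup EG G) :
    ContMDiff (𝓘(ℝ, EG).prod 𝓘(ℝ, E)) 𝓘(ℝ, E) ∞ (fun p : G × Q => p.1 • p.2) :=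
  hG.smooth.contMDiff_smul

lemma IsSymmetryGroup.contMDiff_const_smul (hG : S.IsSymmetryGroup EG G) (g : G) :
    ContMDiff 𝓘(ℝ, E) 𝓘(ℝ, E) ∞ (fun q : Q => g • q) :=
  hG.contMDiff_smul.comp (contMDiff_const.prodMk contMDiff_id)

lemma IsSymmetryGroup.mdifferentiable_smul (hG : S.IsSymmetryGroup EG G) (g : G) (q : Q) :
    MDifferentiableAt 𝓘(ℝ, E) 𝓘(ℝ, E) (fun q : Q => g • q) q :=
  (hG.contMDiff_const_smul g).mdifferentiableAt (by simp)

lemma IsSymmetryGroup.tangentMap_mul (hG : S.IsSymmetryGroup EG G) (g h : G)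
    (v : TangentBundle 𝓘(ℝ, E) Q) :
    tangentMap 𝓘(ℝ, E) 𝓘(ℝ, E) (fun q : Q => g • q)
      (tangentMap 𝓘(ℝ, E) 𝓘(ℝ, E) (fun q : Q => h • q) v) =
    tangentMap 𝓘(ℝ, E) 𝓘(ℝ, E) (fun q : Q => (g * h) • q) v := by
  rw [← tangentMap_comp_at (I := 𝓘(ℝ, E)) v (hG.mdifferentiable_smul g _) (hG.mdifferentiable_smul h _)]
  congr 1
  ext q
  simp [mul_smul]

lemma IsSymmetryGroup.tangentMap_one (v : TangentBundle 𝓘(ℝ, E) Q) :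
    tangentMap 𝓘(ℝ, E) 𝓘(ℝ, E) (fun q : Q => (1 : G) • q) v = v := by
  have : (fun q : Q => (1 : G) • q) = id := by ext; simp
  rw [this, tangentMap_id]; rfl

/-- The lagrangian at zero velocity is the potential, so U is invariant; subtracting it leaves the
quadratic form of κ, and polarization gives κ. -/
lemma IsSymmetryGroup.metric_invariant (hG : S.IsSymmetryGroup EG G) (g : G) (q : Q)
    (v w : TangentSpace 𝓘(ℝ, E) q) :
    S.metric.inner (g • q) (mfderiv 𝓘(ℝ, E) 𝓘(ℝ, E) (fun q : Q => g • q) q v)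
      (mfderiv 𝓘(ℝ, E) 𝓘(ℝ, E) (fun q : Q => g • q) q w) = S.metric.inner q v w := by
  let T : TangentSpace 𝓘(ℝ, E) q →L[ℝ] TangentSpace 𝓘(ℝ, E) (g • q) :=
    mfderiv 𝓘(ℝ, E) 𝓘(ℝ, E) (fun q : Q => g • q) q
  have hinv : ∀ v, (1 / 2) * S.metric.inner (g • q) (T v) (T v) + S.potential (g • q) =
      (1 / 2) * S.metric.inner q v v + S.potential q :=
    fun v => hG.lagrangian_invariant g ⟨q, v⟩
  show S.metric.inner (g • q) (T v) (T w) = S.metric.inner q v w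
  have h0 : S.potential (g • q) = S.potential q := by
    have := hinv 0
    simpa using this
  have h1 : ∀ v, S.metric.inner (g • q) (T v) (T v) = S.metric.inner q v v := by
    intro v
    have := hinv v
    linarith
  have h2 := h1 (v + w)
  simp only [map_add, add_apply, h1] at h2
  have h3 := S.metric.symm (g • q) (T w) (T v)
  have h4 := S.metric.symm q v w
  linarith

end Action

/-! ### The lifted action on the constraint manifold -/

section Orbits

variable {E F : Type*} [NormedAddCommGroup E] [NormedSpace ℝ E]
  [NormedAddCommGroup F] [NormedSpace ℝ F]
  {Q : Type*} [TopologicalSpace Q] [ChartedSpace E Q] [IsManifold 𝓘(ℝ, E) ∞ Q]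
  {V : Q → Type*} [TopologicalSpace (TotalSpace F V)] [∀ q, TopologicalSpace (V q)]
  [∀ q, AddCommGroup (V q)] [∀ q, Module ℝ (V q)] [FiberBundle F V] [VectorBundle ℝ F V]
  [ContMDiffVectorBundle ∞ F V 𝓘(ℝ, E)]
  {S : NonholonomicSystem E F Q V}
variable {EG : Type*} [NormedAddCommGroup EG] [NormedSpace ℝ EG]
  {G : Type*} [TopologicalSpace G] [ChartedSpace EG G] [Group G] [LieGroup 𝓘(ℝ, EG) ∞ G]
  [MulAction G Q]

lemma IsSymmetryGroup.mfderiv_inverse (hG : S.IsSymmetryGroup EG G) (g : G) (q : Q) :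
    (mfderiv 𝓘(ℝ, E) 𝓘(ℝ, E) (fun q : Q => g⁻¹ • q) (g • q) : E →L[ℝ] E) ∘L
      (mfderiv 𝓘(ℝ, E) 𝓘(ℝ, E) (fun q : Q => g • q) q : E →L[ℝ] E) =
        ContinuousLinearMap.id ℝ E := by
  have h := mfderiv_comp (I := 𝓘(ℝ, E)) q (hG.mdifferentiable_smul g⁻¹ (g • q))
    (hG.mdifferentiable_smul g q)
  have e : (fun q : Q => g⁻¹ • q) ∘ (fun q : Q => g • q) = id := by ext; simp
  rw [e, mfderiv_id] at h
  exact h.symm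

lemma IsSymmetryGroup.isInvertible_mfderiv (hG : S.IsSymmetryGroup EG G) (g : G) (q : Q) :
    (mfderiv 𝓘(ℝ, E) 𝓘(ℝ, E) (fun q : Q => g • q) q).IsInvertible := by
  have h1 := hG.mfderiv_inverse g q
  have h2 := hG.mfderiv_inverse g⁻¹ (g • q)
  have h3 : (mfderiv 𝓘(ℝ, E) 𝓘(ℝ, E) (fun q : Q => g⁻¹⁻¹ • q) (g⁻¹ • g • q) : E →L[ℝ] E) =
      mfderiv 𝓘(ℝ, E) 𝓘(ℝ, E) (fun q : Q => g • q) q := by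
    have := congrArg (fun x : Q =>
      (show E →L[ℝ] E from mfderiv 𝓘(ℝ, E) 𝓘(ℝ, E) (fun q : Q => g • q) x)) (inv_smul_smul g q)
    rw [inv_inv]; exact this
  rw [h3] at h2
  exact ContinuousLinearMap.IsInvertible.of_inverse h2 h1

/-- Invariance of κ makes the Legendre transform equivariant, and invariance of D keeps the
translated velocity in D. Hence the `invFun` in the definition of `act` does find a preimage. -/
lemma IsSymmetryGroup.exists_velocity (hG : S.IsSymmetryGroup EG G) (g : G) (m : S.Phase) :
    ∃ m' : S.Phase, S.velocity m' = tangentMap 𝓘(ℝ, E) 𝓘(ℝ, E) (fun q : Q => g • q) (S.velocity m) ∧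
      S.embed m' = cotangentLift g (S.embed m) := by
  let T : TangentSpace 𝓘(ℝ, E) m.1 →L[ℝ] TangentSpace 𝓘(ℝ, E) (g • m.1) :=
    mfderiv 𝓘(ℝ, E) 𝓘(ℝ, E) (fun q : Q => g • q) m.1
  have h1 : T (S.incl m.1 m.2) ∈ S.D (g • m.1) := by
    rw [← hG.D_invariant g m.1]
    exact ⟨_, ⟨m.2, rfl⟩, rfl⟩
  obtain ⟨n, hn⟩ := h1
  refine ⟨⟨g • m.1, n⟩, ?_, ?_⟩
  · show (⟨g • m.1, S.incl (g • m.1) n⟩ : TangentBundle 𝓘(ℝ, E) Q) = ⟨g • m.1, _⟩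
    rw [hn]; rfl
  · show (⟨g • m.1, S.metric.inner (g • m.1) (S.incl (g • m.1) n)⟩ : CotangentBundle E Q) =
      ⟨g • m.1, (S.metric.inner m.1 (S.incl m.1 m.2)) ∘L T.inverse⟩
    congr 1
    rw [hn]
    ext w
    have hT : T.IsInvertible := hG.isInvertible_mfderiv g m.1
    have hw : w = T (T.inverse w) := by rw [hT.self_apply_inverse]
    conv_lhs => rw [hw]
    exact hG.metric_invariant g m.1 _ _

/-- Seen in TQ, the action on M is the tangent lift. The action laws and the smoothness of `act` are
all deduced from this. -/
lemma IsSymmetryGroup.velocity_act (hG : S.IsSymmetryGroup EG G) (g : G) (m : S.Phase) :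
    S.velocity (S.act g m) =
      tangentMap 𝓘(ℝ, E) 𝓘(ℝ, E) (fun q : Q => g • q) (S.velocity m) := by
  obtain ⟨m', h1, h2⟩ := hG.exists_velocity g m
  have : Nonempty S.Phase := ⟨m⟩
  have h3 : S.act g m = m' := by
    apply embed_injective
    exact (invFun_eq ⟨m', h2⟩).trans h2.symm
  rw [h3, h1]

lemma IsSymmetryGroup.act_fst (hG : S.IsSymmetryGroup EG G) (g : G) (m : S.Phase) :
    (S.act g m).1 = g • m.1 :=
  congrArg TotalSpace.proj (hG.velocity_act g m)

lemma IsSymmetryGroup.act_act (hG : S.IsSymmetryGroup EG G) (g h : G) (m : S.Phase) :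
    S.act g (S.act h m) = S.act (g * h) m := by
  apply velocity_injective
  rw [hG.velocity_act, hG.velocity_act, hG.tangentMap_mul, hG.velocity_act]

lemma IsSymmetryGroup.act_one (hG : S.IsSymmetryGroup EG G) (m : S.Phase) :
    S.act (1 : G) m = m := by
  apply velocity_injective
  rw [hG.velocity_act, IsSymmetryGroup.tangentMap_one]

lemma IsSymmetryGroup.eq_one_of_act_eq (hG : S.IsSymmetryGroup EG G) {g : G} {m : S.Phase}
    (h : S.act g m = m) : g = 1 :=
  hG.free g m.1 (by rw [← hG.act_fst, h])

variable [FiniteDimensional ℝ E] [FiniteDimensional ℝ F]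

/-- Smoothness into M is tested in TQ by `contMDiffAt_of_velocity`, where the map becomes the
tangent lift composed with the inclusion of D. -/
lemma IsSymmetryGroup.contMDiff_act (hG : S.IsSymmetryGroup EG G) :
    ContMDiff (𝓘(ℝ, EG).prod (phaseModel E F)) (phaseModel E F) ∞
      (fun p : G × S.Phase => S.act p.1 p.2) := by
  have : IsManifold 𝓘(ℝ, EG) ∞ G := ContMDiffMul.toIsManifold
  have h1 := contMDiff_tangent_right hG.contMDiff_smul
  have h2 := h1.comp (contMDiff_fst.prodMk (S.contMDiff_velocity.comp contMDiff_snd) :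
    ContMDiff (𝓘(ℝ, EG).prod (phaseModel E F)) (𝓘(ℝ, EG).prod 𝓘(ℝ, E).tangent) ∞
      (fun p : G × S.Phase => (p.1, S.velocity p.2)))
  intro p
  apply contMDiffAt_of_velocity
  refine (h2 p).congr_of_eventuallyEq (Filter.Eventually.of_forall fun p => ?_)
  exact hG.velocity_act p.1 p.2

lemma IsSymmetryGroup.contMDiff_act_right (hG : S.IsSymmetryGroup EG G) (g : G) :
    ContMDiff (phaseModel E F) (phaseModel E F) ∞ (S.act g) :=
  hG.contMDiff_act.comp (contMDiff_const.prodMk contMDiff_id)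

lemma IsSymmetryGroup.mdifferentiableAt_act (hG : S.IsSymmetryGroup EG G) (g : G) (m : S.Phase) :
    MDifferentiableAt (phaseModel E F) (phaseModel E F) (S.act g) m :=
  (hG.contMDiff_act_right g).mdifferentiableAt (by simp)

lemma IsSymmetryGroup.contMDiff_orbit (hG : S.IsSymmetryGroup EG G) (m : S.Phase) :
    ContMDiff 𝓘(ℝ, EG) (phaseModel E F) ∞ (fun g : G => S.act g m) :=
  hG.contMDiff_act.comp (contMDiff_id.prodMk contMDiff_const)

lemma IsSymmetryGroup.mdifferentiableAt_orbit (hG : S.IsSymmetryGroup EG G) (m : S.Phase) (g : G) :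
    MDifferentiableAt 𝓘(ℝ, EG) (phaseModel E F) (fun g : G => S.act g m) g :=
  (hG.contMDiff_orbit m).mdifferentiableAt (by simp)

/-- The derivative of the action, as a map between model spaces. -/
def modelTangentAct (S : NonholonomicSystem E F Q V) (g : G) (m : S.Phase) :
    (E × F) →L[ℝ] (E × F) := S.tangentAct g m

lemma IsSymmetryGroup.modelTangentAct_comp (hG : S.IsSymmetryGroup EG G) (g h : G) (m : S.Phase) :
    S.modelTangentAct g (S.act h m) ∘L S.modelTangentAct h m = S.modelTangentAct (g * h) m := by
  have h1 := mfderiv_comp (I := phaseModel E F) m (hG.mdifferentiableAt_act g (S.act h m))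
    (hG.mdifferentiableAt_act h m)
  have e : S.act g ∘ S.act h = S.act (g * h) := funext fun m => hG.act_act g h m
  rw [e] at h1
  exact h1.symm

lemma IsSymmetryGroup.modelTangentAct_one (hG : S.IsSymmetryGroup EG G) (m : S.Phase) :
    S.modelTangentAct (1 : G) m = ContinuousLinearMap.id ℝ (E × F) := by
  have e : S.act (1 : G) = id := funext fun m => hG.act_one m
  show (mfderiv (phaseModel E F) (phaseModel E F) (S.act (1 : G)) m : (E × F) →L[ℝ] (E × F)) = _
  rw [e, mfderiv_id]
  rfl

lemma IsSymmetryGroup.inv_modelTangentAct (hG : S.IsSymmetryGroup EG G) (g : G) (m : S.Phase)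
    (v : E × F) : S.modelTangentAct g⁻¹ (S.act g m) (S.modelTangentAct g m v) = v := by
  have h := hG.modelTangentAct_comp g⁻¹ g m
  rw [inv_mul_cancel, hG.modelTangentAct_one] at h
  exact congrArg (fun L => L v) h

lemma IsSymmetryGroup.modelTangentAct_inv (hG : S.IsSymmetryGroup EG G) (g : G) (m : S.Phase)
    (v : E × F) : S.modelTangentAct g m (S.modelTangentAct g⁻¹ (S.act g m) v) = v := by
  have h := hG.inv_modelTangentAct g⁻¹ (S.act g m) v
  have e : S.act g⁻¹ (S.act g m) = m := by rw [hG.act_act, inv_mul_cancel, hG.act_one]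
  rw [e, inv_inv] at h
  exact h

lemma IsSymmetryGroup.tangentAct_surjective (hG : S.IsSymmetryGroup EG G) (g : G) (m : S.Phase) :
    Surjective (S.tangentAct g m) :=
  fun v => ⟨S.modelTangentAct g⁻¹ (S.act g m) v, hG.modelTangentAct_inv g m v⟩

lemma IsSymmetryGroup.tangentAct_injective (hG : S.IsSymmetryGroup EG G) (g : G) (m : S.Phase) :
    Injective (S.tangentAct g m) := by
  intro v w h
  have h' : S.modelTangentAct g m v = S.modelTangentAct g m w := h
  rw [← hG.inv_modelTangentAct g m v, h', hG.inv_modelTangentAct g m w]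

/-! ### Infinitesimal generators -/

lemma IsSymmetryGroup.contMDiff_infGen (hG : S.IsSymmetryGroup EG G)
    (ξ : GroupLieAlgebra 𝓘(ℝ, EG) G) :
    ContMDiff (phaseModel E F) (phaseModel E F).tangent ∞
      (fun m : S.Phase => (⟨m, S.infGen EG G m ξ⟩ : TangentBundle (phaseModel E F) S.Phase)) := by
  have : IsManifold 𝓘(ℝ, EG) ∞ G := ContMDiffMul.toIsManifold
  refine (contMDiff_tangent_left hG.contMDiff_act 1 ξ).congr fun m => ?_
  have h : ∀ m', m' = m → (⟨m, S.infGen EG G m ξ⟩ : TangentBundle (phaseModel E F) S.Phase) =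
      ⟨m', (S.infGen EG G m ξ : E × F)⟩ := by rintro _ rfl; rfl
  exact h _ (hG.act_one m)

/-- The orbit map intertwines left translation by g on G with φ_g on M. So if its derivative kills ξ
at the identity, it kills the left-invariant field of ξ everywhere. -/
lemma IsSymmetryGroup.mfderiv_orbit_eq_zero (hG : S.IsSymmetryGroup EG G) (m : S.Phase)
    {ξ : GroupLieAlgebra 𝓘(ℝ, EG) G} (hξ : S.infGen EG G m ξ = 0) (g : G) :
    mfderiv 𝓘(ℝ, EG) (phaseModel E F) (fun g : G => S.act g m) g (mulInvariantVectorField ξ g)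
      = 0 := by
  have hmul : MDifferentiableAt 𝓘(ℝ, EG) 𝓘(ℝ, EG) (fun h : G => g * h) 1 :=
    (contMDiff_mul_left (I := 𝓘(ℝ, EG)) (n := ∞)).mdifferentiableAt (by simp)
  have h1 := mfderiv_comp (I := 𝓘(ℝ, EG)) (1 : G) (hG.mdifferentiableAt_orbit m (g * 1)) hmul
  have h2 := mfderiv_comp (I := 𝓘(ℝ, EG)) (1 : G)
    (hG.mdifferentiableAt_act g (S.act 1 m)) (hG.mdifferentiableAt_orbit m 1)
  have e : (fun g : G => S.act g m) ∘ (fun h : G => g * h) = S.act g ∘ (fun g : G => S.act g m) := by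
    ext1 h
    exact (hG.act_act g h m).symm
  rw [e, h2] at h1
  -- The base points `g * 1` and `g` are equal but not definitionally so; the derivatives are
  -- compared as maps between model spaces.
  have h3 : (mfderiv 𝓘(ℝ, EG) (phaseModel E F) (fun g : G => S.act g m) (g * 1) : EG →L[ℝ] E × F) =
      mfderiv 𝓘(ℝ, EG) (phaseModel E F) (fun g : G => S.act g m) g :=
    congrArg (fun x : G => (show EG →L[ℝ] E × F from
      mfderiv 𝓘(ℝ, EG) (phaseModel E F) (fun g : G => S.act g m) x)) (mul_one g)
  have h4 := congrArg (fun L : EG →L[ℝ] E × F => L ξ) h1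
  have h5 := congrArg (fun L : EG →L[ℝ] E × F =>
    L (mfderiv 𝓘(ℝ, EG) 𝓘(ℝ, EG) (fun h : G => g * h) 1 ξ)) h3
  refine (h5.symm.trans h4.symm).trans ?_
  exact (congrArg (fun v => (mfderiv (phaseModel E F) (phaseModel E F) (S.act g) (S.act 1 m) :
    (E × F) →L[ℝ] E × F) v) hξ).trans (map_zero _)

/-- If ξ_M(m) = 0, the integral curve γ of the left-invariant field of ξ through 1 moves m with zero
velocity, so γ(t) fixes m for small t. Freeness makes γ locally constant, and its velocity ξ
vanishes. -/
lemma IsSymmetryGroup.infGen_injective [FiniteDimensional ℝ EG] (hG : S.IsSymmetryGroup EG G)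
    (m : S.Phase) : Injective (S.infGen EG G m) := by
  have : IsManifold 𝓘(ℝ, EG) 1 G := IsManifold.of_le (n := ∞) (by simp)
  have : CompleteSpace EG := FiniteDimensional.complete ℝ EG
  have : LieGroup 𝓘(ℝ, EG) (minSmoothness ℝ 3) G := LieGroup.of_le (n := ∞) (by
    simp only [minSmoothness_of_isRCLikeNormedField]; exact WithTop.coe_le_coe.2 le_top)
  rw [injective_iff_map_eq_zero]
  intro ξ hξ
  have hX : ContMDiffAt 𝓘(ℝ, EG) 𝓘(ℝ, EG).tangent 1
      (fun g : G => (⟨g, mulInvariantVectorField ξ g⟩ : TangentBundle 𝓘(ℝ, EG) G)) 1 :=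
    (contMDiff_mulInvariantVectorField ξ).contMDiffAt.of_le (by simp)
  obtain ⟨γ, hγ0, hγ⟩ := exists_isMIntegralCurveAt_of_contMDiffAt_boundaryless 0 hX
  have hγ' : ∀ᶠ t in 𝓝 (0 : ℝ), HasMFDerivAt 𝓘(ℝ, ℝ) 𝓘(ℝ, EG) γ t
    ((1 : ℝ →L[ℝ] ℝ).smulRight (mulInvariantVectorField ξ (γ t))) := hγ
  have h1 : ∀ᶠ t in 𝓝 (0 : ℝ), S.act (γ t) m = S.act (γ 0) m := by
    have : IsManifold (phaseModel E F) 1 S.Phase := IsManifold.of_le (n := ∞) (by simp)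
    refine eventually_const_of_mfderiv_eq_zero (I := phaseModel E F)
      (c := fun t => S.act (γ t) m) ?_
    filter_upwards [hγ'] with t ht
    have h2 := (hG.mdifferentiableAt_orbit m (γ t)).hasMFDerivAt.comp t ht
    refine ⟨h2.mdifferentiableAt, h2.mfderiv.trans ?_⟩
    ext1
    show (mfderiv 𝓘(ℝ, EG) (phaseModel E F) (fun g : G => S.act g m) (γ t) : EG →L[ℝ] E × F)
      ((1 : ℝ) • mulInvariantVectorField ξ (γ t)) = 0
    rw [one_smul]
    exact hG.mfderiv_orbit_eq_zero m hξ (γ t)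
  have h2 : γ =ᶠ[𝓝 0] fun _ => (1 : G) := by
    filter_upwards [h1] with t ht
    rw [hγ0, hG.act_one] at ht
    exact hG.eq_one_of_act_eq ht
  have h3 := (hγ'.self_of_nhds.congr_of_eventuallyEq h2.symm).mfderiv
  rw [mfderiv_const] at h3
  have h4 := congrArg (fun L : ℝ →L[ℝ] EG => L 1) h3
  have h5 : (0 : EG) = (1 : ℝ) • mulInvariantVectorField ξ (γ 0) := h4
  rw [one_smul, hγ0] at h5
  have h6 : (mulInvariantVectorField ξ (1 : G) : EG) = ξ := by
    have e : (fun h : G => 1 * h) = id := by ext; simp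
    show (mfderiv 𝓘(ℝ, EG) 𝓘(ℝ, EG) (fun h : G => 1 * h) 1 : EG →L[ℝ] EG) ξ = ξ
    rw [e, mfderiv_id]
    rfl
  exact (h5.trans h6).symm

end Orbits

end NonholonomicSystem

/-! ### The canonical forms -/

section Liouville

variable {E : Type*} [NormedAddCommGroup E] [NormedSpace ℝ E] [FiniteDimensional ℝ E]
  {Q : Type*} [TopologicalSpace Q] [ChartedSpace E Q] [IsManifold 𝓘(ℝ, E) ∞ Q]

/-- On a constant vector, the coordinate expression of Θ_Q pairs the covector at a point with the
image of the vector in TQ. Both vary smoothly over Q, and the pairing is a smooth bundle operation.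
-/
lemma smoothFormAt_liouville (p : CotangentBundle E Q) :
    SmoothFormAt (cotangentModel E) (liouville E Q) p := by
  rw [SmoothFormAt, ← contMDiffAt_iff_contDiffAt]
  refine contMDiffAt_clm_of_apply fun w => ?_
  set s := (extChartAt (cotangentModel E) p).symm with hs
  set y₀ := extChartAt (cotangentModel E) p p
  have hU : IsOpen (extChartAt (cotangentModel E) p).target := isOpen_extChartAt_target p
  have hy₀ : y₀ ∈ (extChartAt (cotangentModel E) p).target := mem_extChartAt_target p
  have hproj : ContMDiff (cotangentModel E) 𝓘(ℝ, E) ∞ (fun x : CotangentBundle E Q => x.1) :=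
    contMDiff_proj _
  have h1 : ContMDiffOn 𝓘(ℝ, E × (E →L[ℝ] ℝ)) 𝓘(ℝ, E) ∞ (fun y => (s y).1)
      (extChartAt (cotangentModel E) p).target :=
    hproj.comp_contMDiffOn (contMDiffOn_extChartAt_symm p)
  have h2 := contMDiffAt_mfderiv_const hU h1 hy₀ w
  have h3 : ContMDiffAt 𝓘(ℝ, E × (E →L[ℝ] ℝ)) (cotangentModel E) ∞ s y₀ :=
    contMDiffAt_chart_symm hy₀
  have h4 := ContMDiffAt.clm_bundle_apply (F₁ := E) (F₂ := ℝ)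
    (E₁ := fun q : Q => TangentSpace 𝓘(ℝ, E) q) (E₂ := Bundle.Trivial Q ℝ)
    (b := fun y => (s y).1) (ϕ := fun y => (s y).2)
    (v := fun y => mfderiv 𝓘(ℝ, E × (E →L[ℝ] ℝ)) 𝓘(ℝ, E) (fun y => (s y).1) y w) h3 h2
  refine (contMDiffAt_totalSpace.1 h4).2.congr_of_eventuallyEq ?_
  filter_upwards [hU.mem_nhds hy₀] with y hy
  have h5 := mfderiv_comp (I := 𝓘(ℝ, E × (E →L[ℝ] ℝ))) y
    (hproj.mdifferentiableAt (x := s y) (by simp)) (mdifferentiableAt_chart_symm hy)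
  exact (congrArg (fun L : (E × (E →L[ℝ] ℝ)) →L[ℝ] E => (show E →L[ℝ] ℝ from (s y).2) (L w))
    h5).symm

end Liouville

section Chart

variable {E : Type*} [NormedAddCommGroup E] [NormedSpace ℝ E]
  {H : Type*} [TopologicalSpace H] {I : ModelWithCorners ℝ E H} [I.Boundaryless]
  {P : Type*} [TopologicalSpace P] [ChartedSpace H P] [IsManifold I ∞ P]

lemma mfderiv_chart_symm_self (p : P) :
    (mfderiv 𝓘(ℝ, E) I (extChartAt I p).symm (extChartAt I p p) : E →L[ℝ] E) =
      ContinuousLinearMap.id ℝ E := by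
  have : IsManifold I 1 P := IsManifold.of_le (n := ∞) (by simp)
  have h := mfderivWithin_range_extChartAt_symm (I := I) (x := p)
  rw [I.range_eq_univ, mfderivWithin_univ] at h
  exact h

end Chart

namespace NonholonomicSystem

/-! ### Θ_M and Ω_M in coordinates; nondegeneracy on C -/

section Forms

variable {E F : Type*} [NormedAddCommGroup E] [NormedSpace ℝ E]
  [NormedAddCommGroup F] [NormedSpace ℝ F]
  {Q : Type*} [TopologicalSpace Q] [ChartedSpace E Q] [IsManifold 𝓘(ℝ, E) ∞ Q]
  {V : Q → Type*} [TopologicalSpace (TotalSpace F V)] [∀ q, TopologicalSpace (V q)]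
  [∀ q, AddCommGroup (V q)] [∀ q, Module ℝ (V q)] [FiberBundle F V] [VectorBundle ℝ F V]
  [ContMDiffVectorBundle ∞ F V 𝓘(ℝ, E)]
  {S : NonholonomicSystem E F Q V}
variable [FiniteDimensional ℝ E] [FiniteDimensional ℝ F]

lemma smoothFormAt_theta (m : S.Phase) : SmoothFormAt (phaseModel E F) S.theta m :=
  SmoothFormAt.pull (S.contMDiff_embed m) (smoothFormAt_liouville _)

lemma omega_apply (m : S.Phase) (X Y : TangentSpace (phaseModel E F) m) :
    S.omega m X Y = -extDerivOne (phaseModel E F) S.theta m X Y := by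
  have h := extDerivOne_pull (S.contMDiff_embed m) (smoothFormAt_liouville (S.embed m)) X Y
  exact (congrArg Neg.neg h).symm

lemma mdifferentiableAt_proj (m : S.Phase) :
    MDifferentiableAt (phaseModel E F) 𝓘(ℝ, E) (fun x : S.Phase => x.1) m :=
  (contMDiff_proj V : ContMDiff (phaseModel E F) 𝓘(ℝ, E) ∞ _).mdifferentiableAt (by simp)

lemma theta_apply (m : S.Phase) (v : TangentSpace (phaseModel E F) m) :
    S.theta m v = S.metric.inner m.1 (S.incl m.1 m.2) (S.tangentProj m v) := by
  have h := mfderiv_comp (I := phaseModel E F) m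
    ((contMDiff_proj _ : ContMDiff (cotangentModel E) 𝓘(ℝ, E) ∞
      (fun x : CotangentBundle E Q => x.1)).mdifferentiableAt (x := S.embed m) (by simp))
    (S.contMDiff_embed.mdifferentiableAt (x := m) (by simp))
  exact (congrArg (fun L : (E × F) →L[ℝ] E =>
    (show E →L[ℝ] ℝ from S.metric.inner m.1 (S.incl m.1 m.2)) (L v)) h).symm

/-- The coordinate expression of the projection `τ`. -/
lemma eventually_proj_chart_symm (m : S.Phase) {y : E × F}
    (hy : y ∈ (extChartAt (phaseModel E F) m).target) :
    (fun z => ((extChartAt (phaseModel E F) m).symm z).1) =ᶠ[𝓝 y]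
      fun z => (extChartAt 𝓘(ℝ, E) m.1).symm z.1 := by
  filter_upwards [(isOpen_extChartAt_target (I := phaseModel E F) m).mem_nhds hy] with z hz
  rw [FiberBundle.extChartAt_target] at hz
  rw [FiberBundle.extChartAt]
  exact (trivializationAt F V m.1).proj_symm_apply' hz.1.2

lemma chart_symm_eq (m : S.Phase) {z : E × F}
    (hz : z ∈ (extChartAt (phaseModel E F) m).target) :
    (extChartAt (phaseModel E F) m).symm z = ⟨(extChartAt 𝓘(ℝ, E) m.1).symm z.1,
      (trivializationAt F V m.1).symmₗ ℝ ((extChartAt 𝓘(ℝ, E) m.1).symm z.1) z.2⟩ := by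
  rw [FiberBundle.extChartAt_target] at hz
  rw [FiberBundle.extChartAt, Trivialization.symmₗ_apply _ hz.1.2]
  exact ((trivializationAt F V m.1).mk_symm hz.1.2 z.2).symm

lemma fst_mem_target (m : S.Phase) {y : E × F}
    (hy : y ∈ (extChartAt (phaseModel E F) m).target) : y.1 ∈ (extChartAt 𝓘(ℝ, E) m.1).target := by
  rw [FiberBundle.extChartAt_target] at hy
  exact hy.1.1

lemma mfderiv_proj_chart_symm (m : S.Phase) {y : E × F}
    (hy : y ∈ (extChartAt (phaseModel E F) m).target) (w : E × F) :
    (S.tangentProj ((extChartAt (phaseModel E F) m).symm y)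
      (mfderiv 𝓘(ℝ, E × F) (phaseModel E F) (extChartAt (phaseModel E F) m).symm y w) : E) =
    mfderiv 𝓘(ℝ, E) 𝓘(ℝ, E) (extChartAt 𝓘(ℝ, E) m.1).symm y.1 w.1 := by
  have h1 := mfderiv_comp (I := 𝓘(ℝ, E × F)) y
    (mdifferentiableAt_proj ((extChartAt (phaseModel E F) m).symm y))
    (mdifferentiableAt_chart_symm hy)
  have h2 := mfderiv_comp (I := 𝓘(ℝ, E × F)) y (f := Prod.fst) (g := (extChartAt 𝓘(ℝ, E) m.1).symm)
    (mdifferentiableAt_chart_symm (fst_mem_target m hy)) differentiableAt_fst.mdifferentiableAt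
  have h3 := (eventually_proj_chart_symm m hy).mfderiv_eq (I := 𝓘(ℝ, E × F)) (I' := 𝓘(ℝ, E))
  have h4 : (mfderiv 𝓘(ℝ, E × F) 𝓘(ℝ, E) (Prod.fst : E × F → E) y : E × F →L[ℝ] E) =
    ContinuousLinearMap.fst ℝ E F := by
    rw [mfderiv_eq_fderiv, fderiv_fst]
  have h5 : (mfderiv 𝓘(ℝ, E × F) 𝓘(ℝ, E) (Prod.fst : E × F → E) y : E × F →L[ℝ] E) w = w.1 := by
    rw [h4]; rfl
  refine (congrArg (fun L : (E × F) →L[ℝ] E => L w) (h1.symm.trans (h3.trans h2))).trans ?_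
  exact congrArg (mfderiv 𝓘(ℝ, E) 𝓘(ℝ, E) (extChartAt 𝓘(ℝ, E) m.1).symm y.1 : E →L[ℝ] E) h5

lemma extChartAt_self_fst (m : S.Phase) :
    (extChartAt (phaseModel E F) m m).1 = extChartAt 𝓘(ℝ, E) m.1 m.1 := by
  rw [FiberBundle.extChartAt]
  simp

lemma tangentProj_apply (m : S.Phase) (w : TangentSpace (phaseModel E F) m) :
    (S.tangentProj m w : E) = (w : E × F).1 := by
  have h := mfderiv_proj_chart_symm m (mem_extChartAt_target (I := phaseModel E F) m) w
  have h1 : ∀ m' : S.Phase, m' = m → ∀ v : E × F, v = w →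
      (S.tangentProj m w : E) = S.tangentProj m' v := by rintro _ rfl _ rfl; rfl
  rw [h1 _ (extChartAt_to_inv (I := phaseModel E F) m) _
    (congrArg (fun L : (E × F) →L[ℝ] E × F => L w) (mfderiv_chart_symm_self (I := phaseModel E F) (P := S.Phase) m))]
  refine h.trans ?_
  rw [extChartAt_self_fst]
  exact congrArg (fun L : E →L[ℝ] E => L (w : E × F).1) (mfderiv_chart_symm_self m.1)

/-- In bundle coordinates Θ_M is linear in the fibre coordinate of the point and ignores the fibre
component of the vector; `omega_vertical` rests on these two facts. -/
lemma chartForm_theta_apply (m : S.Phase) {y : E × F}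
    (hy : y ∈ (extChartAt (phaseModel E F) m).target) (u : E × F) :
    chartForm (phaseModel E F) S.theta m y u =
      S.metric.inner ((extChartAt 𝓘(ℝ, E) m.1).symm y.1)
        (S.incl _ ((trivializationAt F V m.1).symmₗ ℝ ((extChartAt 𝓘(ℝ, E) m.1).symm y.1) y.2))
        (mfderiv 𝓘(ℝ, E) 𝓘(ℝ, E) (extChartAt 𝓘(ℝ, E) m.1).symm y.1 u.1) := by
  have h1 := theta_apply ((extChartAt (phaseModel E F) m).symm y)
    (mfderiv 𝓘(ℝ, E × F) (phaseModel E F) (extChartAt (phaseModel E F) m).symm y u)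
  refine h1.trans ?_
  refine (congrArg (show E →L[ℝ] ℝ from S.metric.inner _ (S.incl _ _))
    (mfderiv_proj_chart_symm m hy u)).trans ?_
  exact congrArg (fun m' : S.Phase => (show E →L[ℝ] ℝ from S.metric.inner m'.1 (S.incl m'.1 m'.2))
    (mfderiv 𝓘(ℝ, E) 𝓘(ℝ, E) (extChartAt 𝓘(ℝ, E) m.1).symm y.1 u.1)) (chart_symm_eq m hy)

variable (S) in
/-- A tangent vector given by its components in the preferred chart. -/
def ofModel (m : S.Phase) (x : E × F) : TangentSpace (phaseModel E F) m := x

/-- Of the two terms of dΘ_M(X, (0, w)), one differentiates Θ_M(0, w) = 0; the other differentiates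
Θ_M(X) along the fibre, where it is linear. This is the analogue of dp ∧ dq, with momenta restricted
to D. -/
lemma omega_vertical (m : S.Phase) (X : TangentSpace (phaseModel E F) m) (w : F) :
    S.omega m X (S.ofModel m (0, w)) =
      S.metric.inner m.1 (S.incl m.1 ((trivializationAt F V m.1).symmₗ ℝ m.1 w))
        (S.tangentProj m X) := by
  refine Eq.trans ?_ (congrArg (show E →L[ℝ] ℝ from S.metric.inner m.1 (S.incl m.1 _))
    (tangentProj_apply m X)).symm
  rw [omega_apply, extDerivOne_eq]
  change E × F at X
  set θ := chartForm (phaseModel E F) S.theta m with hθ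
  set c := extChartAt (phaseModel E F) m m with hc
  have hd : DifferentiableAt ℝ θ c := (smoothFormAt_theta m).differentiableAt (by simp)
  have ht : ∀ᶠ y in 𝓝 c, y ∈ (extChartAt (phaseModel E F) m).target :=
    extChartAt_target_mem_nhds (I := phaseModel E F) m
  have h1 : fderiv ℝ θ c X (0, w) = 0 := by
    have h2 := (hd.hasFDerivAt.clm_apply (hasFDerivAt_const ((0, w) : E × F) c)).fderiv
    have h3 : (fun y => θ y ((0, w) : E × F)) =ᶠ[𝓝 c] fun _ => (0 : ℝ) := by
      filter_upwards [ht] with y hy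
      refine (chartForm_theta_apply m hy _).trans ?_
      exact (congrArg (show E →L[ℝ] ℝ from S.metric.inner _ (S.incl _ _))
        (map_zero (mfderiv 𝓘(ℝ, E) 𝓘(ℝ, E) (extChartAt 𝓘(ℝ, E) m.1).symm y.1))).trans (map_zero _)
    rw [h3.fderiv_eq] at h2
    simpa using! (congrArg (fun L : E × F →L[ℝ] ℝ => L X) h2).symm
  have h2 : fderiv ℝ θ c (0, w) X =
      S.metric.inner m.1 (S.incl m.1 ((trivializationAt F V m.1).symmₗ ℝ m.1 w)) X.1 := by
    -- Θ_M(X) as a function of the fibre coordinate over the fixed base point; being linear, its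
    -- derivative along w is `ℓ w`.
    let ℓ : F →ₗ[ℝ] ℝ :=
      { toFun := fun f => S.metric.inner ((extChartAt 𝓘(ℝ, E) m.1).symm c.1)
          (S.incl _ ((trivializationAt F V m.1).symmₗ ℝ ((extChartAt 𝓘(ℝ, E) m.1).symm c.1) f))
          (mfderiv 𝓘(ℝ, E) 𝓘(ℝ, E) (extChartAt 𝓘(ℝ, E) m.1).symm c.1 X.1)
        map_add' := fun f g => by simp only [map_add, add_apply]
        map_smul' := fun r f => by simp only [map_smul]; rfl }
    have h3 : HasDerivAt (fun t : ℝ => θ (c + t • ((0, w) : E × F)) X)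
        (fderiv ℝ θ c (0, w) X) 0 := by
      have h4 := (hd.hasFDerivAt.clm_apply (hasFDerivAt_const X c)).hasLineDerivAt
        ((0, w) : E × F)
      have h5 : HasDerivAt (fun t : ℝ => θ (c + t • ((0, w) : E × F)) X) _ 0 := h4
      convert h5 using 1
      simp
    have h4 : HasDerivAt (fun t : ℝ => ℓ c.2 + t * ℓ w) (ℓ w) 0 := by
      simpa using ((hasDerivAt_id (0 : ℝ)).mul_const (ℓ w)).const_add (ℓ c.2)
    have h5 : (fun t : ℝ => θ (c + t • ((0, w) : E × F)) X) =ᶠ[𝓝 0]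
        fun t : ℝ => ℓ c.2 + t * ℓ w := by
      have hcont : Filter.Tendsto (fun t : ℝ => c + t • ((0, w) : E × F)) (𝓝 0) (𝓝 c) := by
        have : Continuous (fun t : ℝ => c + t • ((0, w) : E × F)) := by fun_prop
        simpa using this.tendsto 0
      filter_upwards [hcont.eventually ht] with t ht
      have e1 : (c + t • ((0, w) : E × F)).1 = c.1 := by simp
      have e2 : (c + t • ((0, w) : E × F)).2 = c.2 + t • w := by simp
      refine (chartForm_theta_apply m ht X).trans ?_
      rw [e1, e2]
      show ℓ (c.2 + t • w) = _
      rw [map_add, map_smul, smul_eq_mul]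
    rw [h3.unique (h4.congr_of_eventuallyEq h5)]
    have e3 : c.1 = extChartAt 𝓘(ℝ, E) m.1 m.1 := extChartAt_self_fst m
    have e4 : (mfderiv 𝓘(ℝ, E) 𝓘(ℝ, E) (extChartAt 𝓘(ℝ, E) m.1).symm c.1 : E →L[ℝ] E) X.1 = X.1 := by
      rw [e3]
      exact congrArg (fun L : E →L[ℝ] E => L X.1) (mfderiv_chart_symm_self m.1)
    have e5 : (extChartAt 𝓘(ℝ, E) m.1).symm c.1 = m.1 := by rw [e3, extChartAt_to_inv]
    refine (congrArg (show E →L[ℝ] ℝ from S.metric.inner _ (S.incl _ _)) e4).trans ?_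
    exact congrArg (fun q : Q => (show E →L[ℝ] ℝ from S.metric.inner q
      (S.incl q ((trivializationAt F V m.1).symmₗ ℝ q w))) X.1) e5
  refine (congrArg Neg.neg (flatD_apply θ c X ((0, w) : E × F))).trans ?_
  rw [h1, h2, zero_sub, neg_neg]
  rfl

lemma omega_swap (m : S.Phase) (X Y : TangentSpace (phaseModel E F) m) :
    S.omega m X Y = -S.omega m Y X := by
  rw [omega_apply, omega_apply, extDerivOne_eq]
  exact congrArg Neg.neg (flatD_swap (T := E × F) _ _ _ _)

lemma mem_C_iff (m : S.Phase) (X : TangentSpace (phaseModel E F) m) :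
    X ∈ S.C m ↔ S.tangentProj m X ∈ S.D m.1 := Iff.rfl

lemma mem_C_of_tangentProj_eq_zero {m : S.Phase} {X : TangentSpace (phaseModel E F) m}
    (h : S.tangentProj m X = 0) : X ∈ S.C m := by
  rw [mem_C_iff, h]; exact zero_mem _

lemma incl_symm_linearMapAt (m : S.Phase) (n : V m.1) :
    (trivializationAt F V m.1).symmₗ ℝ m.1 ((trivializationAt F V m.1).linearMapAt ℝ m.1 n) = n :=
  (trivializationAt F V m.1).symmₗ_linearMapAt (R := ℝ)
    (FiberBundle.mem_baseSet_trivializationAt' m.1) n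

lemma metric_self_eq_zero {q : Q} {v : TangentSpace 𝓘(ℝ, E) q} (h : S.metric.inner q v v = 0) :
    v = 0 := by
  by_contra hne
  exact (S.metric.pos q v hne).ne' h

/-- A vector of `C` that is `Ω_M`-orthogonal to the fibre of `τ` is tangent to that fibre. -/
lemma tangentProj_eq_zero_of_omega {m : S.Phase} {X : TangentSpace (phaseModel E F) m}
    (hX : X ∈ S.C m) (h : ∀ Y, S.tangentProj m Y = 0 → S.omega m X Y = 0) :
    S.tangentProj m X = 0 := by
  obtain ⟨n, hn⟩ := hX
  have h1 := h (S.ofModel m (0, (trivializationAt F V m.1).linearMapAt ℝ m.1 n))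
    (tangentProj_apply m _)
  rw [omega_vertical, incl_symm_linearMapAt, hn] at h1
  exact metric_self_eq_zero (S := S) h1

/-- Vectors tangent to the fibre detect Tτ X, which lies in D, by positivity of κ. Once Tτ X = 0, X
is given by a fibre vector w, and pairing with a vector over incl(w) ∈ D gives κ(incl w, incl w) =
0. -/
lemma omega_nondegenerate {m : S.Phase} {X : TangentSpace (phaseModel E F) m}
    (hX : X ∈ S.C m) (h : ∀ Y ∈ S.C m, S.omega m X Y = 0) : X = 0 := by
  have h0 : S.tangentProj m X = 0 :=
    tangentProj_eq_zero_of_omega hX fun Y hY => h Y (mem_C_of_tangentProj_eq_zero hY)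
  have h1 : (X : E × F).1 = 0 := (tangentProj_apply m X).symm.trans h0
  set w : F := (X : E × F).2
  have hXw : X = S.ofModel m (0, w) :=
    Prod.ext h1 rfl
  set a : TangentSpace 𝓘(ℝ, E) m.1 := S.incl m.1 ((trivializationAt F V m.1).symmₗ ℝ m.1 w)
  have ha : S.tangentProj m (S.ofModel m (a, 0)) = a := tangentProj_apply m _
  have h2 := h (S.ofModel m (a, 0)) ⟨(trivializationAt F V m.1).symmₗ ℝ m.1 w, ha.symm⟩
  rw [omega_swap, neg_eq_zero, hXw, omega_vertical, ha] at h2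
  have h3 : a = 0 := metric_self_eq_zero (S := S) h2
  have h4 : (trivializationAt F V m.1).symmₗ ℝ m.1 w = 0 :=
    S.incl_injective m.1 (h3.trans (map_zero _).symm)
  have h5 := (trivializationAt F V m.1).linearMapAt_symmₗ (R := ℝ)
    (FiberBundle.mem_baseSet_trivializationAt' m.1) w
  rw [h4, map_zero] at h5
  rw [hXw, ← h5]
  rfl

end Forms

/-! ### Behaviour of C, Θ_M and the generators under the action -/

section Invariance

variable {E F : Type*} [NormedAddCommGroup E] [NormedSpace ℝ E]
  [NormedAddCommGroup F] [NormedSpace ℝ F]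
  {Q : Type*} [TopologicalSpace Q] [ChartedSpace E Q] [IsManifold 𝓘(ℝ, E) ∞ Q]
  {V : Q → Type*} [TopologicalSpace (TotalSpace F V)] [∀ q, TopologicalSpace (V q)]
  [∀ q, AddCommGroup (V q)] [∀ q, Module ℝ (V q)] [FiberBundle F V] [VectorBundle ℝ F V]
  [ContMDiffVectorBundle ∞ F V 𝓘(ℝ, E)]
  {S : NonholonomicSystem E F Q V}
variable {EG : Type*} [NormedAddCommGroup EG] [NormedSpace ℝ EG]
  {G : Type*} [TopologicalSpace G] [ChartedSpace EG G] [Group G] [LieGroup 𝓘(ℝ, EG) ∞ G]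
  [MulAction G Q]
variable [FiniteDimensional ℝ E] [FiniteDimensional ℝ F]

lemma mem_D_congr {q q' : Q} (h : q = q') {x : E}
    (hx : (show TangentSpace 𝓘(ℝ, E) q from x) ∈ S.D q) :
    (show TangentSpace 𝓘(ℝ, E) q' from x) ∈ S.D q' := by
  subst h; exact hx

lemma IsSymmetryGroup.tangentProj_act (hG : S.IsSymmetryGroup EG G) (g : G) (m : S.Phase)
    (v : TangentSpace (phaseModel E F) m) :
    (S.tangentProj (S.act g m) (S.tangentAct g m v) : E) =
      (mfderiv 𝓘(ℝ, E) 𝓘(ℝ, E) (fun q : Q => g • q) m.1 : E →L[ℝ] E) (S.tangentProj m v) := by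
  have h1 := mfderiv_comp (I := phaseModel E F) m (mdifferentiableAt_proj (S.act g m))
    (hG.mdifferentiableAt_act g m)
  have h2 := mfderiv_comp (I := phaseModel E F) m (hG.mdifferentiable_smul g m.1)
    (mdifferentiableAt_proj m)
  have e : (fun x : S.Phase => x.1) ∘ S.act g = (fun q : Q => g • q) ∘ (fun x : S.Phase => x.1) :=
    funext fun m => hG.act_fst g m
  rw [e] at h1
  exact congrArg (fun L : E × F →L[ℝ] E => L v) (h1.symm.trans h2)

lemma IsSymmetryGroup.tangentAct_mem_C (hG : S.IsSymmetryGroup EG G) (g : G) {m : S.Phase}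
    {v : TangentSpace (phaseModel E F) m} (hv : v ∈ S.C m) :
    S.tangentAct g m v ∈ S.C (S.act g m) := by
  have h : (mfderiv 𝓘(ℝ, E) 𝓘(ℝ, E) (fun q : Q => g • q) m.1) (S.tangentProj m v) ∈
      S.D (g • m.1) := by
    rw [← hG.D_invariant g m.1]
    exact Submodule.mem_map_of_mem hv
  have h2 := mem_D_congr (hG.act_fst g m).symm h
  rw [mem_C_iff]
  have h3 := hG.tangentProj_act g m v
  exact (congrArg (fun x : E => (show TangentSpace 𝓘(ℝ, E) (S.act g m).1 from x) ∈
    S.D (S.act g m).1) h3).mpr h2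

lemma IsSymmetryGroup.theta_act (hG : S.IsSymmetryGroup EG G) (g : G) (m : S.Phase)
    (v : TangentSpace (phaseModel E F) m) :
    S.theta (S.act g m) (S.tangentAct g m v) = S.theta m v := by
  rw [theta_apply, theta_apply]
  refine (congrArg (show E →L[ℝ] ℝ from S.metric.inner _ (S.incl _ _))
    (hG.tangentProj_act g m v)).trans ?_
  refine Eq.trans (congrArg (fun x : TangentBundle 𝓘(ℝ, E) Q =>
    (show E →L[ℝ] ℝ from S.metric.inner x.1 x.2)
      ((mfderiv 𝓘(ℝ, E) 𝓘(ℝ, E) (fun q : Q => g • q) m.1 : E →L[ℝ] E) (S.tangentProj m v)))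
    (hG.velocity_act g m)) ?_
  exact hG.metric_invariant g m.1 _ _

variable (S) in
/-- The derivative of `τ`, with values in the model space. -/
def projE (m : S.Phase) : TangentSpace (phaseModel E F) m →L[ℝ] E := S.tangentProj m

variable (S) in
/-- Membership in `D` for vectors of the model space. -/
def MemD (q : Q) (x : E) : Prop := (show TangentSpace 𝓘(ℝ, E) q from x) ∈ S.D q

/-- The infinitesimal generators on `Q`. -/
def genQ (E EG : Type*) [NormedAddCommGroup E] [NormedSpace ℝ E] {Q : Type*} [TopologicalSpace Q]
    [ChartedSpace E Q] [NormedAddCommGroup EG] [NormedSpace ℝ EG] (G : Type*) [TopologicalSpace G]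
    [ChartedSpace EG G] [Group G] [MulAction G Q] (q : Q) :
    GroupLieAlgebra 𝓘(ℝ, EG) G →L[ℝ] E :=
  (mfderiv 𝓘(ℝ, EG) 𝓘(ℝ, E) (fun g : G => g • q) 1 :)

lemma IsSymmetryGroup.tangentProj_infGen (hG : S.IsSymmetryGroup EG G) (m : S.Phase)
    (ξ : GroupLieAlgebra 𝓘(ℝ, EG) G) :
    S.projE m (S.infGen EG G m ξ) = genQ E EG G m.1 ξ := by
  have h1 := mfderiv_comp (I := 𝓘(ℝ, EG)) (1 : G) (mdifferentiableAt_proj (S.act 1 m))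
    (hG.mdifferentiableAt_orbit m 1)
  have e : (fun x : S.Phase => x.1) ∘ (fun g : G => S.act g m) = fun g : G => g • m.1 :=
    funext fun g => hG.act_fst g m
  rw [e] at h1
  refine Eq.trans ?_ (congrArg (fun L : EG →L[ℝ] E => L ξ) h1).symm
  exact (congrArg (fun x : S.Phase => (show E × F →L[ℝ] E from S.tangentProj x)
    (S.infGen EG G m ξ)) (hG.act_one m)).symm

end Invariance

namespace VerticalComplement

/-! ### The splitting C ⊕ W and the connection A_W -/

section Projections

variable {E F : Type*} [NormedAddCommGroup E] [NormedSpace ℝ E]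
  [NormedAddCommGroup F] [NormedSpace ℝ F]
  {Q : Type*} [TopologicalSpace Q] [ChartedSpace E Q] [IsManifold 𝓘(ℝ, E) ∞ Q]
  {V : Q → Type*} [TopologicalSpace (TotalSpace F V)] [∀ q, TopologicalSpace (V q)]
  [∀ q, AddCommGroup (V q)] [∀ q, Module ℝ (V q)] [FiberBundle F V] [VectorBundle ℝ F V]
  [ContMDiffVectorBundle ∞ F V 𝓘(ℝ, E)]
  {S : NonholonomicSystem E F Q V}
variable {EG : Type*} [NormedAddCommGroup EG] [NormedSpace ℝ EG]
  {G : Type*} [TopologicalSpace G] [ChartedSpace EG G] [Group G] [LieGroup 𝓘(ℝ, EG) ∞ G]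
  [MulAction G Q]
variable [FiniteDimensional ℝ E] [FiniteDimensional ℝ F] {𝓦 : S.VerticalComplement EG G}
  {m : S.Phase} {v : TangentSpace (phaseModel E F) m}

lemma projC_mem (v : TangentSpace (phaseModel E F) m) : 𝓦.projC m v ∈ S.C m :=
  Submodule.projection_apply_mem (𝓦.isCompl m) v

lemma projW_mem (v : TangentSpace (phaseModel E F) m) : 𝓦.projW m v ∈ 𝓦.W m :=
  Submodule.projection_apply_mem (𝓦.isCompl m).symm v

lemma projC_of_mem (hv : v ∈ S.C m) : 𝓦.projC m v = v :=
  Submodule.projection_apply_of_mem_left (𝓦.isCompl m) hv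

lemma projC_of_mem_W (hv : v ∈ 𝓦.W m) : 𝓦.projC m v = 0 :=
  (Submodule.projection_apply_eq_zero_iff (𝓦.isCompl m)).2 hv

lemma projC_add_projW (v : TangentSpace (phaseModel E F) m) : 𝓦.projC m v + 𝓦.projW m v = v :=
  Submodule.projection_add_projection_eq_self (𝓦.isCompl m) v

lemma projW_of_mem_C (hv : v ∈ S.C m) : 𝓦.projW m v = 0 :=
  (Submodule.projection_apply_eq_zero_iff (𝓦.isCompl m).symm).2 hv

lemma projW_of_mem (hv : v ∈ 𝓦.W m) : 𝓦.projW m v = v :=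
  Submodule.projection_apply_of_mem_left (𝓦.isCompl m).symm hv

lemma mem_C_of_projW (h : 𝓦.projW m v = 0) : v ∈ S.C m :=
  (Submodule.projection_apply_eq_zero_iff (𝓦.isCompl m).symm).1 h

lemma tangentAct_mem_W (g : G) (hv : v ∈ 𝓦.W m) : S.tangentAct g m v ∈ 𝓦.W (S.act g m) := by
  rw [← 𝓦.invariant g m]
  exact Submodule.mem_map_of_mem hv

/-- The action preserves both summands, hence commutes with the projection. -/
lemma projC_act (hG : S.IsSymmetryGroup EG G) (g : G) (v : TangentSpace (phaseModel E F) m) :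
    𝓦.projC (S.act g m) (S.tangentAct g m v) = S.tangentAct g m (𝓦.projC m v) := by
  conv_lhs => rw [← projC_add_projW (𝓦 := 𝓦) v, map_add, map_add,
    projC_of_mem (hG.tangentAct_mem_C g (projC_mem v)),
    projC_of_mem_W (tangentAct_mem_W g (projW_mem v)), add_zero]

lemma tangentAct_mem_C_iff (𝓦 : S.VerticalComplement EG G) (hG : S.IsSymmetryGroup EG G) (g : G) :
    S.tangentAct g m v ∈ S.C (S.act g m) ↔ v ∈ S.C m := by
  refine ⟨fun h => ?_, hG.tangentAct_mem_C g⟩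
  have h1 := projC_act (𝓦 := 𝓦) hG g v
  rw [projC_of_mem h] at h1
  rw [hG.tangentAct_injective g m h1]
  exact projC_mem v

variable [FiniteDimensional ℝ EG]

lemma leftInverse_infGen (hG : S.IsSymmetryGroup EG G) (ξ : GroupLieAlgebra 𝓘(ℝ, EG) G) :
    (S.infGen EG G m).toLinearMap.leftInverse (S.infGen EG G m ξ) = ξ :=
  LinearMap.leftInverse_apply_of_inj (LinearMap.ker_eq_bot.2 (hG.infGen_injective m)) ξ

lemma connection_eq (hG : S.IsSymmetryGroup EG G) {ξ : GroupLieAlgebra 𝓘(ℝ, EG) G}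
    (h : 𝓦.projW m v = S.infGen EG G m ξ) : 𝓦.connection m v = ξ := by
  refine Eq.trans (congrArg (S.infGen EG G m).toLinearMap.leftInverse h) ?_
  exact leftInverse_infGen hG ξ

lemma infGen_connection (hG : S.IsSymmetryGroup EG G) (v : TangentSpace (phaseModel E F) m) :
    S.infGen EG G m (𝓦.connection m v) = 𝓦.projW m v := by
  obtain ⟨ξ, hξ⟩ := 𝓦.vertical_le m (projW_mem (𝓦 := 𝓦) v)
  have hξ' : S.infGen EG G m ξ = 𝓦.projW m v := hξ
  rw [connection_eq hG hξ'.symm, hξ']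

lemma connection_eq_zero_iff (hG : S.IsSymmetryGroup EG G) :
    𝓦.connection m v = 0 ↔ v ∈ S.C m := by
  constructor
  · intro h
    apply mem_C_of_projW (𝓦 := 𝓦)
    rw [← infGen_connection hG, h, map_zero]
  · intro h
    exact connection_eq hG ((projW_of_mem_C h).trans (map_zero _).symm)

lemma projC_eq (hG : S.IsSymmetryGroup EG G) (v : TangentSpace (phaseModel E F) m) :
    𝓦.projC m v = v - S.infGen EG G m (𝓦.connection m v) := by
  rw [infGen_connection hG, eq_sub_iff_add_eq, projC_add_projW]

/-- The connection, with values in the model space of `G`. -/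
def connForm (𝓦 : S.VerticalComplement EG G) (m : S.Phase) :
    TangentSpace (phaseModel E F) m →L[ℝ] EG :=
  (lieAlgebraEquiv EG G).toContinuousLinearMap ∘L 𝓦.connection m

/-- The connection on `Q`, restriction of the connection to the zero section. -/
def connQ (𝓦 : S.VerticalComplement EG G) : ∀ q : Q, TangentSpace 𝓘(ℝ, E) q →L[ℝ] EG :=
  pull 𝓘(ℝ, E) (phaseModel E F) (zeroSection F V) 𝓦.connForm

/-- The connection on `Q`, with arguments in the model space. -/
def connQE (𝓦 : S.VerticalComplement EG G) (q : Q) : E →L[ℝ] EG := 𝓦.connQ q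

/-- `W` consists of the values of the infinitesimal generators of a subspace of the Lie algebra. -/
abbrev GeneratedBy (𝓦 : S.VerticalComplement EG G)
    (gW : Submodule ℝ (GroupLieAlgebra 𝓘(ℝ, EG) G)) : Prop :=
  ∀ m : S.Phase, (𝓦.W m : Set (TangentSpace (phaseModel E F) m)) =
    {w | ∃ ξ ∈ gW, S.infGen EG G m ξ = w}

variable {gW : Submodule ℝ (GroupLieAlgebra 𝓘(ℝ, EG) G)}

lemma connection_infGen (hG : S.IsSymmetryGroup EG G)
    (hgW : 𝓦.GeneratedBy gW) {ξ : GroupLieAlgebra 𝓘(ℝ, EG) G} (hξ : ξ ∈ gW)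
    (m : S.Phase) : 𝓦.connection m (S.infGen EG G m ξ) = ξ := by
  refine connection_eq hG (projW_of_mem ?_)
  have : S.infGen EG G m ξ ∈ (𝓦.W m : Set (TangentSpace (phaseModel E F) m)) := by
    rw [hgW]; exact ⟨ξ, hξ, rfl⟩
  exact this

lemma connection_mem (hG : S.IsSymmetryGroup EG G)
    (hgW : 𝓦.GeneratedBy gW) (v : TangentSpace (phaseModel E F) m) :
    𝓦.connection m v ∈ gW := by
  have h : 𝓦.projW m v ∈ (𝓦.W m : Set (TangentSpace (phaseModel E F) m)) := projW_mem v
  rw [hgW] at h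
  obtain ⟨ξ, hξ, h⟩ := h
  rwa [connection_eq hG h.symm]

lemma connection_eq_of_sub_mem (hG : S.IsSymmetryGroup EG G)
    (hgW : 𝓦.GeneratedBy gW) {ξ : GroupLieAlgebra 𝓘(ℝ, EG) G} (hξ : ξ ∈ gW)
    (h : v - S.infGen EG G m ξ ∈ S.C m) : 𝓦.connection m v = ξ := by
  have h1 := (connection_eq_zero_iff (𝓦 := 𝓦) hG).2 h
  rwa [map_sub, connection_infGen hG hgW hξ, sub_eq_zero] at h1

/-- Membership in C is a condition on Tτ v, and the generators project to those of Q. With ξ ranging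
over a subspace `gW` that does not depend on m, A_W(v) is thus determined by τ(m) and Tτ v. -/
lemma connection_eq_of_tangentProj (hG : S.IsSymmetryGroup EG G)
    (hgW : 𝓦.GeneratedBy gW) {ξ : GroupLieAlgebra 𝓘(ℝ, EG) G} (hξ : ξ ∈ gW)
    (h : S.MemD m.1 (S.projE m v - genQ E EG G m.1 ξ)) : 𝓦.connection m v = ξ := by
  refine connection_eq_of_sub_mem hG hgW hξ ?_
  rw [mem_C_iff]
  have h1 : S.projE m (v - S.infGen EG G m ξ) =
      S.projE m v - genQ E EG G m.1 ξ := by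
    rw [map_sub]
    rw [hG.tangentProj_infGen m ξ]
  exact (congrArg (S.MemD m.1) h1).mpr h

lemma sub_genQ_connection_mem (hG : S.IsSymmetryGroup EG G)
    (v : TangentSpace (phaseModel E F) m) :
    S.MemD m.1 (S.projE m v - genQ E EG G m.1 (𝓦.connection m v)) := by
  have h : 𝓦.projC m v ∈ S.C m := projC_mem v
  rw [projC_eq hG, mem_C_iff] at h
  have h1 : S.projE m (v - S.infGen EG G m (𝓦.connection m v)) =
      S.projE m v - genQ E EG G m.1 (𝓦.connection m v) := by
    rw [map_sub]
    rw [hG.tangentProj_infGen m]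
  exact (congrArg (S.MemD m.1) h1).mp h

lemma tangentProj_zeroSection (q : Q) (w : E) :
    S.projE (zeroSection F V q)
      (mfderiv 𝓘(ℝ, E) (phaseModel E F) (zeroSection F V) q w) = w := by
  have h := mfderiv_comp (I := 𝓘(ℝ, E)) q (mdifferentiableAt_proj (S := S) (zeroSection F V q))
    ((contMDiff_zeroSection ℝ V : ContMDiff 𝓘(ℝ, E) (phaseModel E F) ∞ _).mdifferentiableAt
      (x := q) (by simp))
  have e : (fun x : S.Phase => x.1) ∘ (zeroSection F V) = id := rfl
  rw [e, mfderiv_id] at h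
  exact (congrArg (fun L : E →L[ℝ] E => L w) h).symm

lemma connQ_spec (hG : S.IsSymmetryGroup EG G)
    (hgW : 𝓦.GeneratedBy gW) (q : Q) (w : E) :
    (lieAlgebraEquiv EG G).symm (𝓦.connQE q w) ∈ gW ∧
    S.MemD q (w - genQ E EG G q ((lieAlgebraEquiv EG G).symm (𝓦.connQE q w))) := by
  refine ⟨connection_mem hG hgW _, ?_⟩
  have h := sub_genQ_connection_mem (𝓦 := 𝓦) hG (m := zeroSection F V q)
    (mfderiv 𝓘(ℝ, E) (phaseModel E F) (zeroSection F V) q w)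
  have e := tangentProj_zeroSection (S := S) q w
  exact (congrArg (fun x : E => S.MemD q (x -
    genQ E EG G q ((lieAlgebraEquiv EG G).symm (𝓦.connQE q w)))) e).mp h

lemma connQ_eq (hG : S.IsSymmetryGroup EG G)
    (hgW : 𝓦.GeneratedBy gW) {q : Q} {w : E}
    {ξ : GroupLieAlgebra 𝓘(ℝ, EG) G} (hξ : ξ ∈ gW)
    (h : S.MemD q (w - genQ E EG G q ξ)) :
    𝓦.connQE q w = lieAlgebraEquiv EG G ξ := by
  refine congrArg (lieAlgebraEquiv EG G) (connection_eq_of_tangentProj (m := zeroSection F V q)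
    (v := mfderiv 𝓘(ℝ, E) (phaseModel E F) (zeroSection F V) q w) hG hgW hξ ?_)
  have e := tangentProj_zeroSection (S := S) q w
  exact (congrArg (fun x : E => S.MemD q (x - genQ E EG G q ξ)) e).mpr h

/-- A_W is basic: its value at m and that of its restriction to the zero section satisfy the same
characterization over τ(m). This is the source of semi-basicness. -/
lemma connForm_eq_pull (hG : S.IsSymmetryGroup EG G)
    (hgW : 𝓦.GeneratedBy gW) :
    𝓦.connForm = pull (phaseModel E F) 𝓘(ℝ, E) (fun x : S.Phase => x.1) 𝓦.connQ := by
  funext m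
  ext v
  exact (connQ_eq hG hgW (connection_mem hG hgW v) (sub_genQ_connection_mem hG v)).symm

end Projections

end VerticalComplement

end NonholonomicSystem

/-! ### Vector fields in charts -/

section ChartFields

variable {E : Type*} [NormedAddCommGroup E] [NormedSpace ℝ E]
  {H : Type*} [TopologicalSpace H] {I : ModelWithCorners ℝ E H}
  {P : Type*} [TopologicalSpace P] [ChartedSpace H P] [IsManifold I ∞ P]

lemma contMDiffAt_chartVec_of_eq {E'' : Type*} [NormedAddCommGroup E''] [NormedSpace ℝ E'']
    {H'' : Type*} [TopologicalSpace H''] {I'' : ModelWithCorners ℝ E'' H''}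
    {P'' : Type*} [TopologicalSpace P''] [ChartedSpace H'' P'']
    {x : P'' → TangentBundle I P} {z : P''} (hx : ContMDiffAt I'' I.tangent ∞ x z) {p : P}
    (hp : (x z).1 = p) : ContMDiffAt I'' 𝓘(ℝ, E) ∞
      (fun n => (mfderiv I 𝓘(ℝ, E) (extChartAt I p) (x n).1 (x n).2 : E)) z := by
  subst hp; exact contMDiffAt_chartVec hx

variable [I.Boundaryless]

lemma mfderiv_chart_comp_symm {p : P} {y : E} (hy : y ∈ (extChartAt I p).target) :
    (mfderiv I 𝓘(ℝ, E) (extChartAt I p) ((extChartAt I p).symm y) : E →L[ℝ] E) ∘L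
      (mfderiv 𝓘(ℝ, E) I (extChartAt I p).symm y : E →L[ℝ] E) =
    ContinuousLinearMap.id ℝ E := by
  have : IsManifold I 1 P := IsManifold.of_le (n := ∞) (by simp)
  have h := mfderiv_extChartAt_comp_mfderivWithin_extChartAt_symm (I := I) hy
  rw [I.range_eq_univ, mfderivWithin_univ] at h
  exact h

lemma mfderiv_symm_comp_chart {p : P} {y : E} (hy : y ∈ (extChartAt I p).target) :
    (mfderiv 𝓘(ℝ, E) I (extChartAt I p).symm y : E →L[ℝ] E) ∘L
      (mfderiv I 𝓘(ℝ, E) (extChartAt I p) ((extChartAt I p).symm y) : E →L[ℝ] E) =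
    ContinuousLinearMap.id ℝ E := by
  have : IsManifold I 1 P := IsManifold.of_le (n := ∞) (by simp)
  have h := mfderivWithin_extChartAt_symm_comp_mfderiv_extChartAt (I := I) hy
  rw [I.range_eq_univ, mfderivWithin_univ] at h
  exact h

lemma mfderiv_chart_symm_apply {p : P} {y : E} (hy : y ∈ (extChartAt I p).target) (u : E) :
    (mfderiv I 𝓘(ℝ, E) (extChartAt I p) ((extChartAt I p).symm y)
      (mfderiv 𝓘(ℝ, E) I (extChartAt I p).symm y u) : E) = u :=
  congrArg (fun L : E →L[ℝ] E => L u) (mfderiv_chart_comp_symm hy)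

lemma mfderiv_symm_chart_apply {p : P} {y : E} (hy : y ∈ (extChartAt I p).target) (u : E) :
    (mfderiv 𝓘(ℝ, E) I (extChartAt I p).symm y
      (mfderiv I 𝓘(ℝ, E) (extChartAt I p) ((extChartAt I p).symm y) u) : E) = u :=
  congrArg (fun L : E →L[ℝ] E => L u) (mfderiv_symm_comp_chart hy)

/-- The coordinate expression of a smooth vector field is smooth. -/
lemma contDiffAt_chartField {X : ∀ p : P, TangentSpace I p}
    (hX : ContMDiff I I.tangent ∞ (fun p => (⟨p, X p⟩ : TangentBundle I P))) (p : P) :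
    ContDiffAt ℝ ∞ (fun y => (mfderiv I 𝓘(ℝ, E) (extChartAt I p) ((extChartAt I p).symm y)
      (X ((extChartAt I p).symm y)) : E)) (extChartAt I p p) := by
  have h := contMDiffAt_chart_symm (I := I) (mem_extChartAt_target (I := I) p)
  exact contMDiffAt_iff_contDiffAt.1 <| contMDiffAt_chartVec_of_eq (ContMDiffAt.comp _ hX.contMDiffAt h) (extChartAt_to_inv p)

end ChartFields

namespace NonholonomicSystem
namespace VerticalComplement
-- Smoothness of A_W; ⟨J, K_W⟩ is semi-basic
section Smooth

variable {E F : Type*} [NormedAddCommGroup E] [NormedSpace ℝ E]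
  [NormedAddCommGroup F] [NormedSpace ℝ F]
  {Q : Type*} [TopologicalSpace Q] [ChartedSpace E Q] [IsManifold 𝓘(ℝ, E) ∞ Q]
  {V : Q → Type*} [TopologicalSpace (TotalSpace F V)] [∀ q, TopologicalSpace (V q)]
  [∀ q, AddCommGroup (V q)] [∀ q, Module ℝ (V q)] [FiberBundle F V] [VectorBundle ℝ F V]
  [ContMDiffVectorBundle ∞ F V 𝓘(ℝ, E)]
  {S : NonholonomicSystem E F Q V}
variable {EG : Type*} [NormedAddCommGroup EG] [NormedSpace ℝ EG]
  {G : Type*} [TopologicalSpace G] [ChartedSpace EG G] [Group G] [LieGroup 𝓘(ℝ, EG) ∞ G]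
  [MulAction G Q]
variable [FiniteDimensional ℝ E] [FiniteDimensional ℝ F] [FiniteDimensional ℝ EG]
  {𝓦 : S.VerticalComplement EG G}
  {m : S.Phase} {v : TangentSpace (phaseModel E F) m}
  {gW : Submodule ℝ (GroupLieAlgebra 𝓘(ℝ, EG) G)}

lemma contMDiff_genQ (hG : S.IsSymmetryGroup EG G) (ξ : GroupLieAlgebra 𝓘(ℝ, EG) G) :
    ContMDiff 𝓘(ℝ, E) 𝓘(ℝ, E).tangent ∞
      (fun q : Q => (⟨q, genQ E EG G q ξ⟩ : TangentBundle 𝓘(ℝ, E) Q)) := by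
  have : IsManifold 𝓘(ℝ, EG) ∞ G := ContMDiffMul.toIsManifold
  refine (contMDiff_tangent_left hG.contMDiff_smul (1 : G) ξ).congr fun q => ?_
  have h : ∀ q', q' = q → (⟨q, genQ E EG G q ξ⟩ : TangentBundle 𝓘(ℝ, E) Q) =
      ⟨q', (genQ E EG G q ξ : E)⟩ := by rintro _ rfl; rfl
  exact h _ (one_smul G q)

/-- The inclusion of `D`, with values in the model space. -/
def inclE (S : NonholonomicSystem E F Q V) (q : Q) : V q →ₗ[ℝ] E := S.incl q

/-- The map `(ξ, f) ↦ ξ_Q + f` to the tangent space, where `f` is read in a trivialization. -/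
def splitMap (S : NonholonomicSystem E F Q V) (gE : Submodule ℝ EG) (q₀ q : Q) :
    (gE × F) →L[ℝ] E :=
  ((genQ E EG G q) ∘L (lieAlgebraEquiv EG G).symm.toContinuousLinearMap ∘L gE.subtypeL).coprod
    (LinearMap.toContinuousLinearMap (inclE S q ∘ₗ (trivializationAt F V q₀).symmₗ ℝ q))

/-- The coordinate expression of `splitMap`. -/
def chartSplitMap (G : Type*) [TopologicalSpace G] [ChartedSpace EG G] [Group G]
    [LieGroup 𝓘(ℝ, EG) ∞ G] [MulAction G Q] (S : NonholonomicSystem E F Q V)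
    (gE : Submodule ℝ EG) (q₀ : Q) (y : E) : (gE × F) →L[ℝ] E :=
  (mfderiv 𝓘(ℝ, E) 𝓘(ℝ, E) (extChartAt 𝓘(ℝ, E) q₀) ((extChartAt 𝓘(ℝ, E) q₀).symm y) : E →L[ℝ] E) ∘L
    splitMap (G := G) S gE q₀ ((extChartAt 𝓘(ℝ, E) q₀).symm y)

/-- At a fixed pair (ξ, f) this is the sum of two fields read in the chart: the generator ξ_Q and
the local section of D with constant component f. -/
lemma contDiffAt_chartSplitMap (hG : S.IsSymmetryGroup EG G) (gE : Submodule ℝ EG) (q₀ : Q) :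
    ContDiffAt ℝ ∞ (chartSplitMap G S gE q₀) (extChartAt 𝓘(ℝ, E) q₀ q₀) := by
  rw [← contMDiffAt_iff_contDiffAt]
  refine contMDiffAt_clm_of_apply fun ⟨ξ, f⟩ => ?_
  have h1 := contDiffAt_chartField (contMDiff_genQ hG ((lieAlgebraEquiv EG G).symm ξ)) q₀
  -- The zero vector serves only to select a bundle chart over q₀; that chart contains every fibre
  -- coordinate f.
  set m₀ : S.Phase := ⟨q₀, 0⟩ with hm₀
  set y₀ := extChartAt 𝓘(ℝ, E) q₀ q₀ with hy₀
  have hy : (y₀, f) ∈ (extChartAt (phaseModel E F) m₀).target := by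
    rw [FiberBundle.extChartAt_target]
    refine ⟨⟨mem_extChartAt_target q₀, ?_⟩, mem_univ _⟩
    simp [hm₀, hy₀, FiberBundle.mem_baseSet_trivializationAt']
  have ht := (isOpen_extChartAt_target (I := phaseModel E F) m₀).mem_nhds hy
  have h2 : ContMDiffAt 𝓘(ℝ, E) (phaseModel E F) ∞
      (fun y : E => (extChartAt (phaseModel E F) m₀).symm (y, f)) y₀ :=
    ContMDiffAt.comp (g := (extChartAt (phaseModel E F) m₀).symm) y₀ (contMDiffAt_chart_symm hy)
      (contDiffAt_id.prodMk contDiffAt_const).contMDiffAt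
  have e1 : ((extChartAt (phaseModel E F) m₀).symm (y₀, f)).1 = q₀ := by
    rw [chart_symm_eq _ hy]
    exact extChartAt_to_inv q₀
  have h3 := contMDiffAt_chartVec_of_eq (p := q₀)
    (ContMDiffAt.comp y₀ (S.contMDiff_velocity _) h2) e1
  refine (h1.contMDiffAt.add h3).congr_of_eventuallyEq ?_
  have hc : Filter.Tendsto (fun y : E => (y, f)) (𝓝 y₀) (𝓝 (y₀, f)) :=
    (Continuous.prodMk continuous_id continuous_const).tendsto y₀
  filter_upwards [hc.eventually ht] with y hy
  have e2 := chart_symm_eq m₀ hy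
  have e3 := congrArg (fun n : S.Phase => (show E from
    mfderiv 𝓘(ℝ, E) 𝓘(ℝ, E) (extChartAt 𝓘(ℝ, E) q₀) n.1 (S.incl n.1 n.2))) e2
  refine Eq.trans ?_ (congrArg (fun x : E => (show E from mfderiv 𝓘(ℝ, E) 𝓘(ℝ, E)
    (extChartAt 𝓘(ℝ, E) q₀) ((extChartAt 𝓘(ℝ, E) q₀).symm y)
      (genQ E EG G ((extChartAt 𝓘(ℝ, E) q₀).symm y) ((lieAlgebraEquiv EG G).symm ξ))) + x) e3.symm)
  exact map_add (mfderiv 𝓘(ℝ, E) 𝓘(ℝ, E) (extChartAt 𝓘(ℝ, E) q₀)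
    ((extChartAt 𝓘(ℝ, E) q₀).symm y) : E →L[ℝ] E) _ _

/-- `𝔤_W`, as a subspace of the model space of `G`. -/
abbrev modelSubspace (gW : Submodule ℝ (GroupLieAlgebra 𝓘(ℝ, EG) G)) : Submodule ℝ EG :=
  gW.map (lieAlgebraEquiv EG G).toLinearEquiv.toLinearMap

lemma symm_mem_of_mem_modelSubspace {x : EG} (hx : x ∈ modelSubspace gW) :
    (lieAlgebraEquiv EG G).symm x ∈ gW := by
  obtain ⟨ξ, hξ, rfl⟩ := hx
  exact hξ

lemma connQE_splitMap (hG : S.IsSymmetryGroup EG G)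
    (hgW : 𝓦.GeneratedBy gW) (q₀ q : Q) (x : modelSubspace gW × F) :
    𝓦.connQE q (splitMap (G := G) S (modelSubspace gW) q₀ q x) = x.1 := by
  refine (connQ_eq hG hgW (symm_mem_of_mem_modelSubspace x.1.2) ?_).trans
    ((lieAlgebraEquiv EG G).apply_symm_apply _)
  have : splitMap (G := G) S (modelSubspace gW) q₀ q x -
      genQ E EG G q ((lieAlgebraEquiv EG G).symm x.1) =
        inclE S q ((trivializationAt F V q₀).symmₗ ℝ q x.2) := by
    refine (sub_eq_iff_eq_add').2 ?_
    rfl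
  rw [this]
  exact ⟨_, rfl⟩

/-- This is T_qQ = 𝔤_W ⊕ D_q. The connection recovers the 𝔤_W component; what is left lies in D,
where the trivialization recovers f. -/
lemma splitMap_bijective (hG : S.IsSymmetryGroup EG G)
    (hgW : 𝓦.GeneratedBy gW) (q : Q) :
    Bijective (splitMap (G := G) S (modelSubspace gW) q q) := by
  have hq := FiberBundle.mem_baseSet_trivializationAt' (F := F) (E := V) q
  constructor
  · rw [injective_iff_map_eq_zero]
    rintro ⟨ξ, f⟩ h
    have h1 := connQE_splitMap hG hgW q q (ξ, f)
    rw [h, map_zero] at h1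
    have h2 : ξ = 0 := Subtype.ext h1.symm
    subst h2
    have h3 : inclE S q ((trivializationAt F V q).symmₗ ℝ q f) = 0 := by
      refine Eq.trans ?_ h
      refine Eq.trans (zero_add _).symm ?_
      exact congrArg (· + inclE S q ((trivializationAt F V q).symmₗ ℝ q f))
        ((map_zero (genQ E EG G q)).symm)
    have h4 : (trivializationAt F V q).symmₗ ℝ q f = 0 :=
      S.incl_injective q (h3.trans (map_zero (inclE S q)).symm)
    have h5 := (trivializationAt F V q).linearMapAt_symmₗ (R := ℝ) hq f
    rw [h4, map_zero] at h5
    rw [← h5]; rfl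
  · intro w
    obtain ⟨h1, n, h2⟩ := connQ_spec (𝓦 := 𝓦) hG hgW q w
    refine ⟨(⟨𝓦.connQE q w, (lieAlgebraEquiv EG G).symm (𝓦.connQE q w), h1, rfl⟩,
      (trivializationAt F V q).linearMapAt ℝ q n), ?_⟩
    have h3 : (trivializationAt F V q).symmₗ ℝ q ((trivializationAt F V q).linearMapAt ℝ q n) = n :=
      (trivializationAt F V q).symmₗ_linearMapAt (R := ℝ) hq n
    have h4 : inclE S q n = w - genQ E EG G q ((lieAlgebraEquiv EG G).symm (𝓦.connQE q w)) := h2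
    show genQ E EG G q ((lieAlgebraEquiv EG G).symm (𝓦.connQE q w)) +
      inclE S q ((trivializationAt F V q).symmₗ ℝ q ((trivializationAt F V q).linearMapAt ℝ q n)) = w
    rw [h3, h4, add_sub_cancel]

/-- The connection on Q is the first component of the inverse of `splitMap`. Invertibility is known
at q₀, persists nearby because invertible maps form an open set, and inversion is smooth. -/
lemma smoothFormAt_connQ (hG : S.IsSymmetryGroup EG G)
    (hgW : 𝓦.GeneratedBy gW) (q₀ : Q) :
    SmoothFormAt 𝓘(ℝ, E) 𝓦.connQ q₀ := by
  set y₀ := extChartAt 𝓘(ℝ, E) q₀ q₀ with hy₀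
  have hL := contDiffAt_chartSplitMap hG (modelSubspace gW) q₀
  have hbij : Bijective (chartSplitMap G S (modelSubspace gW) q₀ y₀) := by
    have h1 := splitMap_bijective hG hgW q₀
    have h2 : ∀ q, q = q₀ → Bijective (splitMap (G := G) S (modelSubspace gW) q₀ q) := by
      rintro _ rfl; exact h1
    have hy := mem_extChartAt_target (I := 𝓘(ℝ, E)) q₀
    have h3 : Bijective (mfderiv 𝓘(ℝ, E) 𝓘(ℝ, E) (extChartAt 𝓘(ℝ, E) q₀)
        ((extChartAt 𝓘(ℝ, E) q₀).symm y₀) : E →L[ℝ] E) :=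
      ⟨LeftInverse.injective (fun u : E => mfderiv_symm_chart_apply hy u),
        RightInverse.surjective (fun u : E => mfderiv_chart_symm_apply hy u)⟩
    exact h3.comp (h2 _ (extChartAt_to_inv q₀))
  let e : (modelSubspace gW × F) ≃L[ℝ] E :=
    (LinearEquiv.ofBijective (chartSplitMap G S (modelSubspace gW) q₀ y₀).toLinearMap
      hbij).toContinuousLinearEquiv
  have he : (e : (modelSubspace gW × F) →L[ℝ] E) = chartSplitMap G S (modelSubspace gW) q₀ y₀ := by
    exact ContinuousLinearMap.ext fun _ => rfl
  have hinv : ContDiffAt ℝ ∞ (fun y => (chartSplitMap G S (modelSubspace gW) q₀ y).inverse) y₀ := by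
    refine ContDiffAt.comp (g := ContinuousLinearMap.inverse) y₀ ?_ hL
    rw [← he]
    exact contDiffAt_map_inverse e
  have hev : ∀ᶠ y in 𝓝 y₀, chartSplitMap G S (modelSubspace gW) q₀ y ∈
      range ((↑) : ((modelSubspace gW × F) ≃L[ℝ] E) → (modelSubspace gW × F) →L[ℝ] E) :=
    hL.continuousAt.eventually (by rw [← he]; exact ContinuousLinearEquiv.nhds e)
  have key : chartForm 𝓘(ℝ, E) 𝓦.connQ q₀ =ᶠ[𝓝 y₀] fun y =>
      ((modelSubspace gW).subtypeL ∘L ContinuousLinearMap.fst ℝ (modelSubspace gW) F) ∘L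
        (chartSplitMap G S (modelSubspace gW) q₀ y).inverse := by
    filter_upwards [hev, extChartAt_target_mem_nhds (I := 𝓘(ℝ, E)) q₀] with y ⟨e', he'⟩ hy
    rw [← he', ContinuousLinearMap.inverse_equiv]
    ext1 u
    obtain ⟨x, rfl⟩ := e'.surjective u
    have h1 : e' x = chartSplitMap G S (modelSubspace gW) q₀ y x :=
      congrArg (fun L : (modelSubspace gW × F) →L[ℝ] E => L x) he'
    refine Eq.trans ?_ (congrArg (fun z : modelSubspace gW × F => (z.1 : EG))
      (e'.symm_apply_apply x)).symm
    rw [h1]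
    refine Eq.trans ?_ (connQE_splitMap hG hgW q₀ ((extChartAt 𝓘(ℝ, E) q₀).symm y) x)
    exact congrArg (𝓦.connQE ((extChartAt 𝓘(ℝ, E) q₀).symm y)) (mfderiv_symm_chart_apply hy _)
  exact (contDiffAt_const.clm_comp hinv).congr_of_eventuallyEq key

lemma smoothFormAt_connForm (hG : S.IsSymmetryGroup EG G)
    (hgW : 𝓦.GeneratedBy gW) (m : S.Phase) :
    SmoothFormAt (phaseModel E F) 𝓦.connForm m := by
  rw [connForm_eq_pull hG hgW]
  exact SmoothFormAt.pull (contMDiff_proj V m) (smoothFormAt_connQ hG hgW m.1)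

lemma extDerivOne_connForm_eq_zero (hG : S.IsSymmetryGroup EG G)
    (hgW : 𝓦.GeneratedBy gW) {X : TangentSpace (phaseModel E F) m}
    (hX : S.tangentProj m X = 0) (Y : TangentSpace (phaseModel E F) m) :
    extDerivOne (phaseModel E F) 𝓦.connForm m X Y = 0 := by
  rw [connForm_eq_pull hG hgW]
  refine (extDerivOne_pull (contMDiff_proj V m) (smoothFormAt_connQ hG hgW m.1) X Y).trans ?_
  exact (congrArg (fun x : TangentSpace 𝓘(ℝ, E) m.1 =>
    extDerivOne 𝓘(ℝ, E) 𝓦.connQ m.1 x (S.tangentProj m Y)) hX).trans (by rw [map_zero]; rfl)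

lemma formJK_apply (X Y : TangentSpace (phaseModel E F) m) :
    𝓦.formJK m X Y = S.theta m (S.infGen EG G m ((lieAlgebraEquiv EG G).symm
      (extDerivOne (phaseModel E F) 𝓦.connForm m (𝓦.projC m X) (𝓦.projC m Y)))) := rfl

/-- A vector tangent to the fibre of τ lies in C, so P_C fixes it, and dA_W, being pulled back by τ,
annihilates it. -/
lemma formJK_eq_zero (hG : S.IsSymmetryGroup EG G)
    (hgW : 𝓦.GeneratedBy gW) {X : TangentSpace (phaseModel E F) m}
    (hX : S.tangentProj m X = 0) : 𝓦.formJK m X = 0 := by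
  ext Y
  rw [formJK_apply, projC_of_mem (mem_C_of_tangentProj_eq_zero hX),
    extDerivOne_connForm_eq_zero hG hgW hX, map_zero, map_zero, map_zero]
  rfl

end Smooth
end VerticalComplement
end NonholonomicSystem

/-! ### Two further facts about d on a vector space -/

section Flat

variable {T A B : Type*} [NormedAddCommGroup T] [NormedSpace ℝ T]
  [NormedAddCommGroup A] [NormedSpace ℝ A] [NormedAddCommGroup B] [NormedSpace ℝ B]

lemma flatD_sub {α β : T → T →L[ℝ] A} {y : T} (hα : DifferentiableAt ℝ α y)
    (hβ : DifferentiableAt ℝ β y) : flatD (fun z => α z - β z) y = flatD α y - flatD β y := by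
  have h : fderiv ℝ (fun z => α z - β z) y = fderiv ℝ α y - fderiv ℝ β y := fderiv_sub hα hβ
  ext u v
  simp only [flatD_apply, h, sub_apply]
  abel

/-- In d⟨j, a⟩ = dj ∧ a + ⟨j, da⟩ the first term vanishes on ker a. -/
lemma flatD_clm_comp_of_apply_eq_zero {j : T → A →L[ℝ] B} {a : T → T →L[ℝ] A} {y u v : T}
    (hj : DifferentiableAt ℝ j y) (ha : DifferentiableAt ℝ a y) (hu : a y u = 0) (hv : a y v = 0) :
    flatD (fun z => j z ∘L a z) y u v = j y (flatD a y u v) := by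
  rw [flatD_apply, flatD_apply, (hj.hasFDerivAt.clm_comp ha.hasFDerivAt).fderiv]
  simp [hu, hv]

/-- At the origin dβ involves each component of β only along the opposite axis. This is what allows
Cartan's formula to be used without flows. -/
lemma flatD_plane_eq_zero {β : ℝ × ℝ → ℝ × ℝ →L[ℝ] ℝ} (hβ : DifferentiableAt ℝ β 0) {c : ℝ}
    (h1 : ∀ᶠ t in 𝓝 (0 : ℝ), β (t, 0) (0, 1) = c) (h2 : ∀ᶠ s in 𝓝 (0 : ℝ), β (0, s) (1, 0) = 0) :
    flatD β 0 (1, 0) (0, 1) = 0 := by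
  have key : ∀ u v : ℝ × ℝ, ∀ b : ℝ, (∀ᶠ t in 𝓝 (0 : ℝ), β (t • u) v = b) →
      fderiv ℝ β 0 u v = 0 := by
    intro u v b h
    have h3 : HasDerivAt (fun t : ℝ => β (0 + t • u) v) (fderiv ℝ β 0 u v) 0 := by
      have h4 : HasDerivAt (fun t : ℝ => β (0 + t • u) v) _ 0 :=
        (hβ.hasFDerivAt.clm_apply (hasFDerivAt_const v (0 : ℝ × ℝ))).hasLineDerivAt u
      convert h4 using 1
      simp
    have h5 : (fun t : ℝ => β (0 + t • u) v) =ᶠ[𝓝 0] fun _ => b := by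
      filter_upwards [h] with t ht
      rw [zero_add, ht]
    exact h3.unique ((hasDerivAt_const (0 : ℝ) b).congr_of_eventuallyEq h5)
  rw [flatD_apply, key (1, 0) (0, 1) c (by simpa using h1), key (0, 1) (1, 0) 0 (by simpa using h2),
    sub_zero]

end Flat

namespace NonholonomicSystem
namespace VerticalComplement
-- The 1-form Θ_M ∘ P_C and invariance of ⟨J, K_W⟩
section Reduced

variable {E F : Type*} [NormedAddCommGroup E] [NormedSpace ℝ E]
  [NormedAddCommGroup F] [NormedSpace ℝ F]
  {Q : Type*} [TopologicalSpace Q] [ChartedSpace E Q] [IsManifold 𝓘(ℝ, E) ∞ Q]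
  {V : Q → Type*} [TopologicalSpace (TotalSpace F V)] [∀ q, TopologicalSpace (V q)]
  [∀ q, AddCommGroup (V q)] [∀ q, Module ℝ (V q)] [FiberBundle F V] [VectorBundle ℝ F V]
  [ContMDiffVectorBundle ∞ F V 𝓘(ℝ, E)]
  {S : NonholonomicSystem E F Q V}
variable {EG : Type*} [NormedAddCommGroup EG] [NormedSpace ℝ EG]
  {G : Type*} [TopologicalSpace G] [ChartedSpace EG G] [Group G] [LieGroup 𝓘(ℝ, EG) ∞ G]
  [MulAction G Q]
variable [FiniteDimensional ℝ E] [FiniteDimensional ℝ F] [FiniteDimensional ℝ EG]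
  {𝓦 : S.VerticalComplement EG G}
  {m : S.Phase} {v : TangentSpace (phaseModel E F) m}
  {gW : Submodule ℝ (GroupLieAlgebra 𝓘(ℝ, EG) G)}

/-- The 1-form `Θ_M ∘ P_C`. -/
def horTheta (𝓦 : S.VerticalComplement EG G) (m : S.Phase) :
    TangentSpace (phaseModel E F) m →L[ℝ] ℝ := S.theta m ∘L 𝓦.projC m

/-- The coordinate expression of the infinitesimal generators. -/
def chartGen (EG : Type*) [NormedAddCommGroup EG] [NormedSpace ℝ EG] (G : Type*) [TopologicalSpace G] [ChartedSpace EG G] [Group G]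
    [LieGroup 𝓘(ℝ, EG) ∞ G] [MulAction G Q] (S : NonholonomicSystem E F Q V)
    (m : S.Phase) (y : E × F) : EG →L[ℝ] E × F :=
  (mfderiv (phaseModel E F) 𝓘(ℝ, E × F) (extChartAt (phaseModel E F) m)
      ((extChartAt (phaseModel E F) m).symm y) : E × F →L[ℝ] E × F) ∘L
    (S.infGen EG G ((extChartAt (phaseModel E F) m).symm y)) ∘L
      (lieAlgebraEquiv EG G).symm.toContinuousLinearMap

lemma contDiffAt_chartGen (hG : S.IsSymmetryGroup EG G) (m : S.Phase) :
    ContDiffAt ℝ ∞ (chartGen EG G S m) (extChartAt (phaseModel E F) m m) := by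
  rw [← contMDiffAt_iff_contDiffAt]
  refine contMDiffAt_clm_of_apply fun ξ => ?_
  exact (contDiffAt_chartField (hG.contMDiff_infGen ((lieAlgebraEquiv EG G).symm ξ)) m).contMDiffAt

lemma chartForm_chartGen {A : Type*} [NormedAddCommGroup A] [NormedSpace ℝ A]
    (α : ∀ m : S.Phase, TangentSpace (phaseModel E F) m →L[ℝ] A) {y : E × F}
    (hy : y ∈ (extChartAt (phaseModel E F) m).target) (ξ : EG) :
    chartForm (phaseModel E F) α m y (chartGen EG G S m y ξ) =
      α ((extChartAt (phaseModel E F) m).symm y)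
        (S.infGen EG G _ ((lieAlgebraEquiv EG G).symm ξ)) :=
  congrArg (show E × F →L[ℝ] A from α ((extChartAt (phaseModel E F) m).symm y))
    (mfderiv_symm_chart_apply hy _)

lemma horTheta_apply (hG : S.IsSymmetryGroup EG G) (v : TangentSpace (phaseModel E F) m) :
    𝓦.horTheta m v = S.theta m v - S.theta m (S.infGen EG G m (𝓦.connection m v)) :=
  (congrArg (S.theta m) (projC_eq hG v)).trans (map_sub _ _ _)

/-- The coordinate form of Θ_M ∘ P_C = Θ_M − ⟨J, A_W⟩, which gives both the smoothness of the form
and its derivative along C. -/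
lemma chartForm_horTheta (hG : S.IsSymmetryGroup EG G) (m : S.Phase) :
    chartForm (phaseModel E F) 𝓦.horTheta m =ᶠ[𝓝 (extChartAt (phaseModel E F) m m)] fun y =>
      chartForm (phaseModel E F) S.theta m y -
        (chartForm (phaseModel E F) S.theta m y ∘L chartGen EG G S m y) ∘L
          chartForm (phaseModel E F) 𝓦.connForm m y := by
  filter_upwards [extChartAt_target_mem_nhds (I := phaseModel E F) m] with y hy
  refine ContinuousLinearMap.ext fun u => ?_
  refine (horTheta_apply hG _).trans ?_
  refine congrArg (fun x : ℝ => chartForm (phaseModel E F) S.theta m y u - x) ?_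
  exact (chartForm_chartGen S.theta hy (chartForm (phaseModel E F) 𝓦.connForm m y u)).symm

lemma smoothFormAt_horTheta (hG : S.IsSymmetryGroup EG G)
    (hgW : 𝓦.GeneratedBy gW) (m : S.Phase) :
    SmoothFormAt (phaseModel E F) 𝓦.horTheta m := by
  have h1 : ContDiffAt ℝ ∞ _ _ := smoothFormAt_theta m
  have h2 : ContDiffAt ℝ ∞ _ _ := smoothFormAt_connForm hG hgW m
  exact (h1.sub ((h1.clm_comp (contDiffAt_chartGen hG m)).clm_comp h2)).congr_of_eventuallyEq
    (chartForm_horTheta hG m)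

lemma horTheta_act (hG : S.IsSymmetryGroup EG G) (g : G) (v : TangentSpace (phaseModel E F) m) :
    𝓦.horTheta (S.act g m) (S.tangentAct g m v) = 𝓦.horTheta m v :=
  (congrArg (S.theta (S.act g m)) (projC_act hG g v)).trans (hG.theta_act g m _)

/-- The value of a form at the centre of a chart. -/
lemma chartForm_self {A : Type*} [NormedAddCommGroup A] [NormedSpace ℝ A]
    (α : ∀ m : S.Phase, TangentSpace (phaseModel E F) m →L[ℝ] A) (m : S.Phase) :
    (chartForm (phaseModel E F) α m (extChartAt (phaseModel E F) m m) : E × F →L[ℝ] A) = α m := by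
  have h : ∀ m', m' = m → (α m' : E × F →L[ℝ] A) = α m := by rintro _ rfl; rfl
  refine ContinuousLinearMap.ext fun u => ?_
  refine (congrArg (show E × F →L[ℝ] A from α _) (congrArg (fun L : E × F →L[ℝ] E × F => L u)
    (mfderiv_chart_symm_self (I := phaseModel E F) m))).trans ?_
  exact congrArg (fun L : E × F →L[ℝ] A => L u) (h _ (extChartAt_to_inv m))

/-- On `C`, the form `⟨J, K_W⟩` is the difference of `dΘ_M` and `d (Θ_M ∘ P_C)`. -/
lemma extDerivOne_horTheta (hG : S.IsSymmetryGroup EG G)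
    (hgW : 𝓦.GeneratedBy gW) {X Y : TangentSpace (phaseModel E F) m}
    (hX : X ∈ S.C m) (hY : Y ∈ S.C m) :
    extDerivOne (phaseModel E F) 𝓦.horTheta m X Y =
      extDerivOne (phaseModel E F) S.theta m X Y - 𝓦.formJK m X Y := by
  have h1 : ContDiffAt ℝ ∞ _ _ := smoothFormAt_theta m
  have h2 : ContDiffAt ℝ ∞ _ _ := smoothFormAt_connForm hG hgW m
  have h3 := contDiffAt_chartGen hG m
  have hX0 : chartForm (phaseModel E F) 𝓦.connForm m (extChartAt (phaseModel E F) m m) X = 0 :=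
    (congrArg (fun L : E × F →L[ℝ] EG => L X) (chartForm_self 𝓦.connForm m)).trans
      ((congrArg (lieAlgebraEquiv EG G) ((connection_eq_zero_iff hG).2 hX)).trans (map_zero _))
  have hY0 : chartForm (phaseModel E F) 𝓦.connForm m (extChartAt (phaseModel E F) m m) Y = 0 :=
    (congrArg (fun L : E × F →L[ℝ] EG => L Y) (chartForm_self 𝓦.connForm m)).trans
      ((congrArg (lieAlgebraEquiv EG G) ((connection_eq_zero_iff hG).2 hY)).trans (map_zero _))
  have hj := (h1.clm_comp h3).differentiableAt (by simp)
  have ha := h2.differentiableAt (by simp)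
  rw [formJK_apply, projC_of_mem hX, projC_of_mem hY, extDerivOne_eq, extDerivOne_eq,
    extDerivOne_eq, flatD_congr (chartForm_horTheta hG m),
    flatD_sub (h1.differentiableAt (by simp)) (hj.clm_comp ha)]
  refine congrArg (fun x : ℝ => flatD (chartForm (phaseModel E F) S.theta m)
    (extChartAt (phaseModel E F) m m) X Y - x) ?_
  -- Here A_W(X) = A_W(Y) = 0 leaves only ⟨J, dA_W⟩, so no derivative of the momentum map survives.
  refine (flatD_clm_comp_of_apply_eq_zero hj ha hX0 hY0).trans ?_
  refine (chartForm_chartGen S.theta (mem_extChartAt_target (I := phaseModel E F) m) _).trans ?_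
  exact congrArg (fun x : S.Phase => S.theta x (S.infGen EG G x ((lieAlgebraEquiv EG G).symm
    (flatD (chartForm (phaseModel E F) 𝓦.connForm m) (extChartAt (phaseModel E F) m m) X Y))))
    (extChartAt_to_inv m)

lemma extDerivOne_act (hG : S.IsSymmetryGroup EG G)
    {α : ∀ m : S.Phase, TangentSpace (phaseModel E F) m →L[ℝ] ℝ} (g : G)
    (hα : SmoothFormAt (phaseModel E F) α (S.act g m))
    (h : ∀ (m : S.Phase) (v : TangentSpace (phaseModel E F) m),
      α (S.act g m) (S.tangentAct g m v) = α m v) (X Y : TangentSpace (phaseModel E F) m) :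
    extDerivOne (phaseModel E F) α (S.act g m) (S.tangentAct g m X) (S.tangentAct g m Y) =
      extDerivOne (phaseModel E F) α m X Y := by
  have e : pull (phaseModel E F) (phaseModel E F) (S.act g) α = α := by
    funext m; ext v; exact h m v
  have h1 := extDerivOne_pull (hG.contMDiff_act_right g m) hα X Y
  rw [e] at h1
  exact h1.symm

/-- Both dΘ_M and d(Θ_M ∘ P_C) are invariant, so this identity yields invariance of ⟨J, K_W⟩ without
treating the equivariance of J and K_W separately. -/
lemma formJK_eq (hG : S.IsSymmetryGroup EG G)
    (hgW : 𝓦.GeneratedBy gW) (X Y : TangentSpace (phaseModel E F) m) :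
    𝓦.formJK m X Y = extDerivOne (phaseModel E F) S.theta m (𝓦.projC m X) (𝓦.projC m Y) -
      extDerivOne (phaseModel E F) 𝓦.horTheta m (𝓦.projC m X) (𝓦.projC m Y) := by
  rw [extDerivOne_horTheta hG hgW (projC_mem X) (projC_mem Y), sub_sub_cancel, formJK_apply,
    formJK_apply, projC_of_mem (projC_mem X), projC_of_mem (projC_mem Y)]

lemma formJK_act (hG : S.IsSymmetryGroup EG G)
    (hgW : 𝓦.GeneratedBy gW) (g : G) (X Y : TangentSpace (phaseModel E F) m) :
    𝓦.formJK (S.act g m) (S.tangentAct g m X) (S.tangentAct g m Y) = 𝓦.formJK m X Y := by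
  rw [formJK_eq hG hgW, formJK_eq hG hgW, projC_act hG, projC_act hG,
    extDerivOne_act hG g (smoothFormAt_theta _) (fun m v => hG.theta_act g m v),
    extDerivOne_act hG g (smoothFormAt_horTheta hG hgW _) (fun m v => horTheta_act hG g v)]

end Reduced
end VerticalComplement
end NonholonomicSystem

/-! ### Coordinate lines -/

section Lines

variable {E : Type*} [NormedAddCommGroup E] [NormedSpace ℝ E]
  {H : Type*} [TopologicalSpace H] {I : ModelWithCorners ℝ E H} [I.Boundaryless]
  {P : Type*} [TopologicalSpace P] [ChartedSpace H P] [IsManifold I ∞ P]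

variable (I) in
/-- The straight line through `p` with velocity `v`, in the preferred chart at `p`. -/
def coordLine (p : P) (v : E) (t : ℝ) : P := (extChartAt I p).symm (extChartAt I p p + t • v)

lemma coordLine_zero (p : P) (v : E) : coordLine I p v 0 = p := by
  rw [coordLine, zero_smul, add_zero, extChartAt_to_inv]

lemma contMDiffAt_coordLine (p : P) (v : E) : ContMDiffAt 𝓘(ℝ, ℝ) I ∞ (coordLine I p v) 0 := by
  have h : extChartAt I p p + (0 : ℝ) • v ∈ (extChartAt I p).target := by
    rw [zero_smul, add_zero]; exact mem_extChartAt_target p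
  refine ContMDiffAt.comp (g := (extChartAt I p).symm) (0 : ℝ) (contMDiffAt_chart_symm h) ?_
  exact (contDiffAt_const.add (contDiffAt_id.smul contDiffAt_const)).contMDiffAt

lemma mfderiv_coordLine (p : P) (v : E) : (mfderiv 𝓘(ℝ, ℝ) I (coordLine I p v) 0 (1 : ℝ) : E) = v := by
  have h : extChartAt I p p + (0 : ℝ) • v = extChartAt I p p := by rw [zero_smul, add_zero]
  have h0 : extChartAt I p p + (0 : ℝ) • v ∈ (extChartAt I p).target := by
    rw [h]; exact mem_extChartAt_target p
  have hd : HasFDerivAt (fun t : ℝ => extChartAt I p p + t • v)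
      ((1 : ℝ →L[ℝ] ℝ).smulRight v) 0 := by
    simpa using! ((hasFDerivAt_id (𝕜 := ℝ) (0 : ℝ)).smul_const v).const_add (extChartAt I p p)
  have h1 := mfderiv_comp (I := 𝓘(ℝ, ℝ)) (0 : ℝ) (mdifferentiableAt_chart_symm h0)
    hd.differentiableAt.mdifferentiableAt
  have h2 : mfderiv 𝓘(ℝ, ℝ) 𝓘(ℝ, E) (fun t : ℝ => extChartAt I p p + t • v) 0 =
      (1 : ℝ →L[ℝ] ℝ).smulRight v := by
    rw [mfderiv_eq_fderiv]; exact hd.fderiv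
  have h3 : (mfderiv 𝓘(ℝ, E) I (extChartAt I p).symm (extChartAt I p p + (0 : ℝ) • v) : E →L[ℝ] E) =
      ContinuousLinearMap.id ℝ E :=
    (congrArg (fun y : E => (show E →L[ℝ] E from mfderiv 𝓘(ℝ, E) I (extChartAt I p).symm y)) h).trans
      (mfderiv_chart_symm_self p)
  have h4 := h1.trans (congrArg₂ (fun (A : E →L[ℝ] E) (B : ℝ →L[ℝ] E) => A ∘L B) h3 h2)
  refine (congrArg (fun L : ℝ →L[ℝ] E => L 1) h4).trans ?_
  simp

end Lines

namespace NonholonomicSystem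
namespace VerticalComplement
-- W lies in the kernel of d(Θ_M ∘ P_C)
section Kernel

variable {E F : Type*} [NormedAddCommGroup E] [NormedSpace ℝ E]
  [NormedAddCommGroup F] [NormedSpace ℝ F]
  {Q : Type*} [TopologicalSpace Q] [ChartedSpace E Q] [IsManifold 𝓘(ℝ, E) ∞ Q]
  {V : Q → Type*} [TopologicalSpace (TotalSpace F V)] [∀ q, TopologicalSpace (V q)]
  [∀ q, AddCommGroup (V q)] [∀ q, Module ℝ (V q)] [FiberBundle F V] [VectorBundle ℝ F V]
  [ContMDiffVectorBundle ∞ F V 𝓘(ℝ, E)]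
  {S : NonholonomicSystem E F Q V}
variable {EG : Type*} [NormedAddCommGroup EG] [NormedSpace ℝ EG]
  {G : Type*} [TopologicalSpace G] [ChartedSpace EG G] [Group G] [LieGroup 𝓘(ℝ, EG) ∞ G]
  [MulAction G Q]
variable [FiniteDimensional ℝ E] [FiniteDimensional ℝ F] [FiniteDimensional ℝ EG]
  {𝓦 : S.VerticalComplement EG G}
  {m : S.Phase} {v : TangentSpace (phaseModel E F) m}
  {gW : Submodule ℝ (GroupLieAlgebra 𝓘(ℝ, EG) G)}

lemma horTheta_infGen (hG : S.IsSymmetryGroup EG G)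
    (hgW : 𝓦.GeneratedBy gW) {ξ : GroupLieAlgebra 𝓘(ℝ, EG) G} (hξ : ξ ∈ gW)
    (m : S.Phase) : 𝓦.horTheta m (S.infGen EG G m ξ) = 0 := by
  rw [horTheta_apply hG, connection_infGen hG hgW hξ, sub_self]

/-- The form `Θ_M ∘ P_C`, with arguments in the model space. -/
def modelHorTheta (𝓦 : S.VerticalComplement EG G) (m : S.Phase) : (E × F) →L[ℝ] ℝ := 𝓦.horTheta m

/-- For θ = Θ_M ∘ P_C one has i_{ξ_M} dθ = L_{ξ_M} θ − d(θ(ξ_M)) = 0, by invariance and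
`horTheta_infGen`. To avoid flows, θ is pulled back to the plane by σ(t, s) = γ(t) · c(s), with γ a
curve in G of velocity ξ and c a curve in M of velocity v; γ need not be a one-parameter subgroup.
-/
lemma extDerivOne_horTheta_infGen (hG : S.IsSymmetryGroup EG G)
    (hgW : 𝓦.GeneratedBy gW) {ξ : GroupLieAlgebra 𝓘(ℝ, EG) G} (hξ : ξ ∈ gW)
    (v : TangentSpace (phaseModel E F) m) :
    extDerivOne (phaseModel E F) 𝓦.horTheta m (S.infGen EG G m ξ) v = 0 := by
  have : IsManifold 𝓘(ℝ, EG) ∞ G := ContMDiffMul.toIsManifold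
  let γ : ℝ → G := coordLine 𝓘(ℝ, EG) (1 : G) (lieAlgebraEquiv EG G ξ)
  let c : ℝ → S.Phase := coordLine (phaseModel E F) m v
  have hγ0 : γ 0 = 1 := coordLine_zero _ _
  have hc0 : c 0 = m := coordLine_zero _ _
  have hγ : ContMDiffAt 𝓘(ℝ, ℝ) 𝓘(ℝ, EG) ∞ γ 0 := contMDiffAt_coordLine _ _
  have hc : ContMDiffAt 𝓘(ℝ, ℝ) (phaseModel E F) ∞ c 0 := contMDiffAt_coordLine _ _
  let σ : ℝ × ℝ → S.Phase := fun p => S.act (γ p.1) (c p.2)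
  have hσ00 : σ 0 = m := by
    show S.act (γ 0) (c 0) = m
    rw [hγ0, hG.act_one, hc0]
  have hσ : ContMDiffAt 𝓘(ℝ, ℝ × ℝ) (phaseModel E F) ∞ σ 0 := by
    have h1 : ContMDiffAt 𝓘(ℝ, ℝ × ℝ) 𝓘(ℝ, EG) ∞ (fun p : ℝ × ℝ => γ p.1) 0 :=
      ContMDiffAt.comp (g := γ) (f := Prod.fst) (0 : ℝ × ℝ) hγ contDiffAt_fst.contMDiffAt
    have h2 : ContMDiffAt 𝓘(ℝ, ℝ × ℝ) (phaseModel E F) ∞ (fun p : ℝ × ℝ => c p.2) 0 :=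
      ContMDiffAt.comp (g := c) (f := Prod.snd) (0 : ℝ × ℝ) hc contDiffAt_snd.contMDiffAt
    exact hG.contMDiff_act.contMDiffAt.comp (0 : ℝ × ℝ) (h1.prodMk h2)
  have hσd : ∀ᶠ p in 𝓝 (0 : ℝ × ℝ), MDifferentiableAt 𝓘(ℝ, ℝ × ℝ) (phaseModel E F) σ p := by
    have : IsManifold (phaseModel E F) 1 S.Phase := IsManifold.of_le (n := ∞) (by simp)
    have h1 : ContMDiffAt 𝓘(ℝ, ℝ × ℝ) (phaseModel E F) 1 σ 0 := hσ.of_le (by simp)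
    filter_upwards [(contMDiffAt_iff_contMDiffAt_nhds (by simp)).1 h1] with p hp
    exact hp.mdifferentiableAt (by simp)
  -- the derivatives of `σ` along the two axes
  have ht : ∀ t s : ℝ, MDifferentiableAt 𝓘(ℝ, ℝ × ℝ) (phaseModel E F) σ (t, s) →
      (mfderiv 𝓘(ℝ, ℝ × ℝ) (phaseModel E F) σ (t, s) ((1, 0) : ℝ × ℝ) : E × F) =
        mfderiv 𝓘(ℝ, ℝ) (phaseModel E F) (fun t => σ (t, s)) t (1 : ℝ) := by
    intro t s h
    have hd : HasFDerivAt (fun t : ℝ => (t, s)) (ContinuousLinearMap.inl ℝ ℝ ℝ) t :=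
      hasFDerivAt_prodMk_left t s
    have h1 := (h.hasMFDerivAt.comp t hd.hasMFDerivAt).mfderiv
    exact (congrArg (fun L : ℝ →L[ℝ] E × F => L 1) h1).symm
  have hs : ∀ t s : ℝ, MDifferentiableAt 𝓘(ℝ, ℝ × ℝ) (phaseModel E F) σ (t, s) →
      (mfderiv 𝓘(ℝ, ℝ × ℝ) (phaseModel E F) σ (t, s) ((0, 1) : ℝ × ℝ) : E × F) =
        mfderiv 𝓘(ℝ, ℝ) (phaseModel E F) (fun s => σ (t, s)) s (1 : ℝ) := by
    intro t s h
    have hd : HasFDerivAt (fun s : ℝ => (t, s)) (ContinuousLinearMap.inr ℝ ℝ ℝ) s :=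
      hasFDerivAt_prodMk_right t s
    have h1 := (h.hasMFDerivAt.comp s hd.hasMFDerivAt).mfderiv
    exact (congrArg (fun L : ℝ →L[ℝ] E × F => L 1) h1).symm
  have hs' : ∀ t : ℝ, (mfderiv 𝓘(ℝ, ℝ) (phaseModel E F) (fun s => σ (t, s)) 0 (1 : ℝ) : E × F) =
      S.modelTangentAct (γ t) (c 0) (mfderiv 𝓘(ℝ, ℝ) (phaseModel E F) c 0 (1 : ℝ)) := by
    intro t
    have h1 := mfderiv_comp (I := 𝓘(ℝ, ℝ)) (0 : ℝ) (hG.mdifferentiableAt_act (γ t) (c 0))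
      (hc.mdifferentiableAt (by simp))
    exact congrArg (fun L : ℝ →L[ℝ] E × F => L 1) h1
  have ht' : ∀ s : ℝ, (mfderiv 𝓘(ℝ, ℝ) (phaseModel E F) (fun t => σ (t, s)) 0 (1 : ℝ) : E × F) =
      S.infGen EG G (c s) ξ := by
    intro s
    have h1 := mfderiv_comp (I := 𝓘(ℝ, ℝ)) (0 : ℝ) (hG.mdifferentiableAt_orbit (c s) (γ 0))
      (hγ.mdifferentiableAt (by simp))
    refine (congrArg (fun L : ℝ →L[ℝ] E × F => L 1) h1).trans ?_
    have h2 : (mfderiv 𝓘(ℝ, EG) (phaseModel E F) (fun g : G => S.act g (c s)) (γ 0) :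
        EG →L[ℝ] E × F) = mfderiv 𝓘(ℝ, EG) (phaseModel E F) (fun g : G => S.act g (c s)) 1 :=
      congrArg (fun g : G => (show EG →L[ℝ] E × F from
        mfderiv 𝓘(ℝ, EG) (phaseModel E F) (fun g : G => S.act g (c s)) g)) hγ0
    refine (congrArg (fun L : EG →L[ℝ] E × F => L (mfderiv 𝓘(ℝ, ℝ) 𝓘(ℝ, EG) γ 0 (1 : ℝ))) h2).trans ?_
    exact congrArg (mfderiv 𝓘(ℝ, EG) (phaseModel E F) (fun g : G => S.act g (c s)) 1 :
      EG →L[ℝ] E × F) (mfderiv_coordLine (I := 𝓘(ℝ, EG)) (1 : G) (lieAlgebraEquiv EG G ξ))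
  have hsm : SmoothFormAt (phaseModel E F) 𝓦.horTheta (σ 0) := smoothFormAt_horTheta hG hgW _
  have hβ := smoothFormAt_model.1 (SmoothFormAt.pull hσ hsm)
  -- Along the t-axis ∂σ/∂s is the translate of c'(0) by γ(t), so invariance of the form makes its
  -- value constant.
  have h1 : ∀ᶠ t in 𝓝 (0 : ℝ), (show ℝ × ℝ →L[ℝ] ℝ from pull 𝓘(ℝ, ℝ × ℝ) (phaseModel E F) σ
      𝓦.horTheta (t, 0)) (0, 1) =
      𝓦.modelHorTheta (c 0) (mfderiv 𝓘(ℝ, ℝ) (phaseModel E F) c 0 (1 : ℝ)) := by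
    have hcont : Filter.Tendsto (fun t : ℝ => (t, (0 : ℝ))) (𝓝 0) (𝓝 (0 : ℝ × ℝ)) :=
      Continuous.tendsto' (by fun_prop) _ _ rfl
    filter_upwards [hcont.eventually hσd] with t htd
    refine (congrArg (𝓦.modelHorTheta (σ (t, 0))) ((hs t 0 htd).trans (hs' t))).trans ?_
    exact horTheta_act hG (γ t) _
  -- Along the s-axis ∂σ/∂t is the generator ξ_M at c(s), on which the form vanishes.
  have h2 : ∀ᶠ s in 𝓝 (0 : ℝ), (show ℝ × ℝ →L[ℝ] ℝ from pull 𝓘(ℝ, ℝ × ℝ) (phaseModel E F) σ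
      𝓦.horTheta (0, s)) (1, 0) = 0 := by
    have hcont : Filter.Tendsto (fun s : ℝ => ((0 : ℝ), s)) (𝓝 0) (𝓝 (0 : ℝ × ℝ)) :=
      Continuous.tendsto' (by fun_prop) _ _ rfl
    filter_upwards [hcont.eventually hσd] with s hsd
    refine (congrArg (𝓦.modelHorTheta (σ (0, s))) ((ht 0 s hsd).trans (ht' s))).trans ?_
    have e : σ (0, s) = c s := by
      show S.act (γ 0) (c s) = c s
      rw [hγ0, hG.act_one]
    rw [e]
    exact horTheta_infGen hG hgW hξ (c s)
  have h3 := flatD_plane_eq_zero (hβ.differentiableAt (by simp)) h1 h2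
  have h4 := extDerivOne_pull hσ hsm ((1, 0) : ℝ × ℝ) ((0, 1) : ℝ × ℝ)
  rw [extDerivOne_model] at h4
  have h5 := h4.symm.trans h3
  have e1 : (mfderiv 𝓘(ℝ, ℝ × ℝ) (phaseModel E F) σ 0 ((1, 0) : ℝ × ℝ) : E × F) =
      S.infGen EG G m ξ :=
    ((ht 0 0 hσd.self_of_nhds).trans (ht' 0)).trans
      (congrArg (fun x : S.Phase => (show E × F from S.infGen EG G x ξ)) hc0)
  have e2 : (mfderiv 𝓘(ℝ, ℝ × ℝ) (phaseModel E F) σ 0 ((0, 1) : ℝ × ℝ) : E × F) = v := by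
    refine ((hs 0 0 hσd.self_of_nhds).trans (hs' 0)).trans ?_
    have : S.modelTangentAct (γ 0) (c 0) = ContinuousLinearMap.id ℝ (E × F) := by
      rw [hγ0]; exact hG.modelTangentAct_one _
    rw [this]
    exact mfderiv_coordLine (I := phaseModel E F) m (show E × F from v)
  have h6 : ∀ m', m' = m → ∀ x y : E × F, x = S.infGen EG G m ξ → y = v →
      extDerivOne (phaseModel E F) 𝓦.horTheta m' x y =
        extDerivOne (phaseModel E F) 𝓦.horTheta m (S.infGen EG G m ξ) v := by
    rintro _ rfl _ _ rfl rfl; rfl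
  exact (h6 _ hσ00 _ _ e1 e2).symm.trans h5

end Kernel
end VerticalComplement
end NonholonomicSystem

/-! ### The sharp map of a form nondegenerate on a subspace -/

section LinearAlgebra

variable {T : Type*} [AddCommGroup T] [Module ℝ T] [TopologicalSpace T] [FiniteDimensional ℝ T]
  {K : Submodule ℝ T} {Ω : T →L[ℝ] T →L[ℝ] ℝ}

lemma restrictForm_bijective (h : ∀ X ∈ K, (∀ Y ∈ K, Ω X Y = 0) → X = 0) :
    Bijective (restrictForm K Ω) := by
  have hinj : Injective (restrictForm K Ω) := by
    rw [injective_iff_map_eq_zero]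
    intro X hX
    exact Subtype.ext (h X X.2 fun Y hY => congrArg (fun L : Module.Dual ℝ K => L ⟨Y, hY⟩) hX)
  exact ⟨hinj, (LinearMap.injective_iff_surjective_of_finrank_eq_finrank
    (Subspace.dual_finrank_eq (K := ℝ) (V := K)).symm).1 hinj⟩

omit [FiniteDimensional ℝ T] in
lemma sharpOfPair_mem (α : T →L[ℝ] ℝ) : sharpOfPair K Ω α ∈ K := by
  rw [sharpOfPair]
  split_ifs with h
  · exact K.neg_mem (Subtype.coe_prop _)
  · exact K.zero_mem

omit [FiniteDimensional ℝ T] in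
lemma apply_sharpOfPair (h : Bijective (restrictForm K Ω)) (α : T →L[ℝ] ℝ) {Y : T} (hY : Y ∈ K) :
    Ω (sharpOfPair K Ω α) Y = -α Y := by
  rw [sharpOfPair, dif_pos h]
  have h1 := (LinearEquiv.ofBijective (restrictForm K Ω) h).apply_symm_apply (restrictCovector K α)
  have h2 := congrArg (fun L : Module.Dual ℝ K => L ⟨Y, hY⟩) h1
  rw [LinearMap.neg_apply, map_neg]
  exact congrArg Neg.neg h2

end LinearAlgebra

namespace NonholonomicSystem
namespace VerticalComplement
-- π_JK as the sharp map of d(Θ_M ∘ P_C) on C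
section Gauge

variable {E F : Type*} [NormedAddCommGroup E] [NormedSpace ℝ E]
  [NormedAddCommGroup F] [NormedSpace ℝ F]
  {Q : Type*} [TopologicalSpace Q] [ChartedSpace E Q] [IsManifold 𝓘(ℝ, E) ∞ Q]
  {V : Q → Type*} [TopologicalSpace (TotalSpace F V)] [∀ q, TopologicalSpace (V q)]
  [∀ q, AddCommGroup (V q)] [∀ q, Module ℝ (V q)] [FiberBundle F V] [VectorBundle ℝ F V]
  [ContMDiffVectorBundle ∞ F V 𝓘(ℝ, E)]
  {S : NonholonomicSystem E F Q V}
variable {EG : Type*} [NormedAddCommGroup EG] [NormedSpace ℝ EG]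
  {G : Type*} [TopologicalSpace G] [ChartedSpace EG G] [Group G] [LieGroup 𝓘(ℝ, EG) ∞ G]
  [MulAction G Q]
variable [FiniteDimensional ℝ E] [FiniteDimensional ℝ F]

lemma piNh_mem (m : S.Phase) (α : TangentSpace (phaseModel E F) m →L[ℝ] ℝ) :
    S.piNh m α ∈ S.C m := sharpOfPair_mem α

lemma omega_piNh (m : S.Phase) (α : TangentSpace (phaseModel E F) m →L[ℝ] ℝ)
    {Y : TangentSpace (phaseModel E F) m} (hY : Y ∈ S.C m) : S.omega m (S.piNh m α) Y = -α Y :=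
  apply_sharpOfPair (restrictForm_bijective fun _ hX h => omega_nondegenerate hX h) α hY

variable [FiniteDimensional ℝ EG]
  {𝓦 : S.VerticalComplement EG G}
  {m : S.Phase} {X Y : TangentSpace (phaseModel E F) m}
  {gW : Submodule ℝ (GroupLieAlgebra 𝓘(ℝ, EG) G)}

lemma extDerivOne_swap {A : Type*} [NormedAddCommGroup A] [NormedSpace ℝ A]
    (α : ∀ m : S.Phase, TangentSpace (phaseModel E F) m →L[ℝ] A)
    (X Y : TangentSpace (phaseModel E F) m) :
    extDerivOne (phaseModel E F) α m X Y = -extDerivOne (phaseModel E F) α m Y X := by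
  rw [extDerivOne_eq]
  exact flatD_swap (T := E × F) _ _ _ _

lemma formJK_swap (X Y : TangentSpace (phaseModel E F) m) :
    𝓦.formJK m X Y = -𝓦.formJK m Y X := by
  rw [formJK_apply, formJK_apply, extDerivOne_swap, map_neg, map_neg, map_neg]

/-- A vector of `C` on which `Ω_M` and `-⟨J, K_W⟩` agree, as covectors along `C`, vanishes. -/
lemma eq_zero_of_omega_add_formJK (hG : S.IsSymmetryGroup EG G)
    (hgW : 𝓦.GeneratedBy gW) (hX : X ∈ S.C m)
    (h : ∀ Y ∈ S.C m, S.omega m X Y + 𝓦.formJK m X Y = 0) : X = 0 := by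
  have h1 : S.tangentProj m X = 0 := by
    refine tangentProj_eq_zero_of_omega hX fun Y hY => ?_
    have h2 := h Y (mem_C_of_tangentProj_eq_zero hY)
    have h3 : 𝓦.formJK m X Y = 0 := by
      rw [formJK_swap, formJK_eq_zero hG hgW hY, zero_apply, neg_zero]
    rwa [h3, add_zero] at h2
  refine omega_nondegenerate hX fun Y hY => ?_
  have h2 := h Y hY
  rwa [formJK_eq_zero hG hgW h1, zero_apply, add_zero] at h2

lemma horTheta_nondegenerate (hG : S.IsSymmetryGroup EG G)
    (hgW : 𝓦.GeneratedBy gW) (hX : X ∈ S.C m)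
    (h : ∀ Y ∈ S.C m, extDerivOne (phaseModel E F) 𝓦.horTheta m X Y = 0) : X = 0 := by
  refine eq_zero_of_omega_add_formJK (𝓦 := 𝓦) hG hgW hX fun Y hY => ?_
  have h1 := h Y hY
  rw [extDerivOne_horTheta hG hgW hX hY] at h1
  rw [omega_apply]
  linarith

lemma gaugeEndo_apply (α : TangentSpace (phaseModel E F) m →L[ℝ] ℝ)
    (Y : TangentSpace (phaseModel E F) m) :
    gaugeEndo S.piNh (fun x => -𝓦.formJK x) m α Y = α Y - 𝓦.formJK m (S.piNh m α) Y := by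
  rw [sub_eq_add_neg]; rfl

/-- In finite dimension it suffices to bound the kernel. If α = i_X⟨J, K_W⟩ with X = π_nh♯ α, then
Ω_M + ⟨J, K_W⟩ annihilates X along C, so X = 0 and with it α. -/
lemma isUnit_gaugeEndo (hG : S.IsSymmetryGroup EG G)
    (hgW : 𝓦.GeneratedBy gW) (m : S.Phase) :
    IsUnit (gaugeEndo S.piNh (fun x => -𝓦.formJK x) m) := by
  have : FiniteDimensional ℝ (TangentSpace (phaseModel E F) m →L[ℝ] ℝ) :=
    inferInstanceAs (FiniteDimensional ℝ (E × F →L[ℝ] ℝ))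
  rw [LinearMap.isUnit_iff_ker_eq_bot, LinearMap.ker_eq_bot']
  intro α hα
  have h1 : ∀ Y, α Y = 𝓦.formJK m (S.piNh m α) Y := fun Y => by
    have h2 := gaugeEndo_apply (𝓦 := 𝓦) α Y
    rw [hα] at h2
    exact (sub_eq_zero.1 h2.symm)
  have h3 : S.piNh m α = 0 := by
    refine eq_zero_of_omega_add_formJK (𝓦 := 𝓦) hG hgW (piNh_mem m α) fun Y hY => ?_
    rw [omega_piNh m α hY, ← h1, neg_add_cancel]
  ext Y
  rw [h1, h3, map_zero]

lemma piJK_mem (m : S.Phase) (α : TangentSpace (phaseModel E F) m →L[ℝ] ℝ) :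
    𝓦.piJK m α ∈ S.C m := piNh_mem m _

/-- With N the gauge endomorphism and X = π_nh♯ N⁻¹α, along C one has dΘ_M(X, ·) = N⁻¹α and i_X⟨J,
K_W⟩ = N⁻¹α − α; their difference is α. -/
lemma extDerivOne_horTheta_piJK (hG : S.IsSymmetryGroup EG G)
    (hgW : 𝓦.GeneratedBy gW) (α : TangentSpace (phaseModel E F) m →L[ℝ] ℝ)
    (hY : Y ∈ S.C m) :
    extDerivOne (phaseModel E F) 𝓦.horTheta m (𝓦.piJK m α) Y = α Y := by
  rw [extDerivOne_horTheta hG hgW (piJK_mem m α) hY]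
  have hu := isUnit_gaugeEndo (𝓦 := 𝓦) hG hgW m
  let N := gaugeEndo S.piNh (fun x => -𝓦.formJK x) m
  have h1 : N (Ring.inverse N α) = α :=
    congrArg (fun L : Module.End ℝ (TangentSpace (phaseModel E F) m →L[ℝ] ℝ) => L α)
      (Ring.mul_inverse_cancel N hu)
  have h2 := gaugeEndo_apply (𝓦 := 𝓦) (Ring.inverse N α) Y
  have h3 : 𝓦.piJK m α = S.piNh m (Ring.inverse N α) := rfl
  have h4 := omega_piNh m (Ring.inverse N α) hY
  rw [omega_apply] at h4
  have h5 : α Y = (Ring.inverse N α) Y - 𝓦.formJK m (S.piNh m (Ring.inverse N α)) Y := by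
    rw [← h2]; exact congrArg (fun β : TangentSpace (phaseModel E F) m →L[ℝ] ℝ => β Y) h1.symm
  rw [h3, h5]
  linarith

lemma eq_piJK (hG : S.IsSymmetryGroup EG G)
    (hgW : 𝓦.GeneratedBy gW) {α : TangentSpace (phaseModel E F) m →L[ℝ] ℝ}
    (hX : X ∈ S.C m)
    (h : ∀ Y ∈ S.C m, extDerivOne (phaseModel E F) 𝓦.horTheta m X Y = α Y) :
    X = 𝓦.piJK m α := by
  rw [← sub_eq_zero]
  refine horTheta_nondegenerate (𝓦 := 𝓦) hG hgW (Submodule.sub_mem _ hX (piJK_mem m α)) fun Y hY => ?_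
  rw [map_sub, sub_apply, h Y hY, extDerivOne_horTheta_piJK hG hgW α hY, sub_self]

lemma piJK_skew (hG : S.IsSymmetryGroup EG G)
    (hgW : 𝓦.GeneratedBy gW) (α β : TangentSpace (phaseModel E F) m →L[ℝ] ℝ) :
    β (𝓦.piJK m α) = -α (𝓦.piJK m β) := by
  rw [← extDerivOne_horTheta_piJK hG hgW β (piJK_mem m α), extDerivOne_swap,
    extDerivOne_horTheta_piJK hG hgW α (piJK_mem m β)]

/-- π_JK is characterized by C and d(Θ_M ∘ P_C), both invariant, so uniqueness (`eq_piJK`) gives its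
invariance. -/
lemma piJK_act (hG : S.IsSymmetryGroup EG G)
    (hgW : 𝓦.GeneratedBy gW) (g : G) (m : S.Phase)
    (α : TangentSpace (phaseModel E F) (S.act g m) →L[ℝ] ℝ) :
    𝓦.piJK (S.act g m) α = S.tangentAct g m (𝓦.piJK m (α ∘L S.tangentAct g m)) := by
  symm
  refine eq_piJK hG hgW (hG.tangentAct_mem_C g (piJK_mem m _)) fun Y hY => ?_
  obtain ⟨Y, rfl⟩ := hG.tangentAct_surjective g m Y
  rw [tangentAct_mem_C_iff 𝓦 hG] at hY
  rw [extDerivOne_act hG g (smoothFormAt_horTheta hG hgW _) (fun m v => horTheta_act hG g v),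
    extDerivOne_horTheta_piJK hG hgW _ hY]
  rfl

end Gauge

/-! ### The form, the connection and π_JK in one chart -/

section ChartPair

variable {E F : Type*} [NormedAddCommGroup E] [NormedSpace ℝ E]
  [NormedAddCommGroup F] [NormedSpace ℝ F]
  {Q : Type*} [TopologicalSpace Q] [ChartedSpace E Q] [IsManifold 𝓘(ℝ, E) ∞ Q]
  {V : Q → Type*} [TopologicalSpace (TotalSpace F V)] [∀ q, TopologicalSpace (V q)]
  [∀ q, AddCommGroup (V q)] [∀ q, Module ℝ (V q)] [FiberBundle F V] [VectorBundle ℝ F V]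
  [ContMDiffVectorBundle ∞ F V 𝓘(ℝ, E)]
  {S : NonholonomicSystem E F Q V}
variable {EG : Type*} [NormedAddCommGroup EG] [NormedSpace ℝ EG]
  {G : Type*} [TopologicalSpace G] [ChartedSpace EG G] [Group G] [LieGroup 𝓘(ℝ, EG) ∞ G]
  [MulAction G Q]
variable [FiniteDimensional ℝ E] [FiniteDimensional ℝ F] [FiniteDimensional ℝ EG]
  {𝓦 : S.VerticalComplement EG G}
  {m : S.Phase} {gW : Submodule ℝ (GroupLieAlgebra 𝓘(ℝ, EG) G)}

/-- The coordinate expression of `π_JK`. -/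
def chartSharp (𝓦 : S.VerticalComplement EG G) (m : S.Phase) (y : E × F)
    (β : E × F →L[ℝ] ℝ) : E × F :=
  mfderiv (phaseModel E F) 𝓘(ℝ, E × F) (extChartAt (phaseModel E F) m)
    ((extChartAt (phaseModel E F) m).symm y) (𝓦.piJK ((extChartAt (phaseModel E F) m).symm y)
      (β ∘L (mfderiv (phaseModel E F) 𝓘(ℝ, E × F) (extChartAt (phaseModel E F) m)
        ((extChartAt (phaseModel E F) m).symm y))))

lemma mfderiv_symm_chartSharp {y : E × F} (hy : y ∈ (extChartAt (phaseModel E F) m).target)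
    (β : E × F →L[ℝ] ℝ) :
    mfderiv 𝓘(ℝ, E × F) (phaseModel E F) (extChartAt (phaseModel E F) m).symm y
      (𝓦.chartSharp m y β) = 𝓦.piJK ((extChartAt (phaseModel E F) m).symm y)
      (β ∘L (mfderiv (phaseModel E F) 𝓘(ℝ, E × F) (extChartAt (phaseModel E F) m)
        ((extChartAt (phaseModel E F) m).symm y))) :=
  mfderiv_symm_chart_apply (I := phaseModel E F) hy _

lemma mfderiv_symm_chartGen {y : E × F} (hy : y ∈ (extChartAt (phaseModel E F) m).target) (ξ : EG) :
    mfderiv 𝓘(ℝ, E × F) (phaseModel E F) (extChartAt (phaseModel E F) m).symm y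
      (chartGen EG G S m y ξ) = S.infGen EG G ((extChartAt (phaseModel E F) m).symm y)
        ((lieAlgebraEquiv EG G).symm ξ) :=
  mfderiv_symm_chart_apply (I := phaseModel E F) hy _

lemma chartForm_connForm_eq_zero_iff (hG : S.IsSymmetryGroup EG G) {y u : E × F} :
    chartForm (phaseModel E F) 𝓦.connForm m y u = 0 ↔
      mfderiv 𝓘(ℝ, E × F) (phaseModel E F) (extChartAt (phaseModel E F) m).symm y u ∈
        S.C ((extChartAt (phaseModel E F) m).symm y) := by
  rw [← connection_eq_zero_iff (𝓦 := 𝓦) hG]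
  exact (lieAlgebraEquiv EG G).map_eq_zero_iff

/-- Collects the geometric input of `flatBracket_jacobi`: the pointwise facts on M hold at every
point of the chart domain and are carried over by the derivative of the inverse chart, an
isomorphism there. -/
lemma kernelPair (hG : S.IsSymmetryGroup EG G)
    (hgW : 𝓦.GeneratedBy gW) (m : S.Phase) :
    KernelPair (chartForm (phaseModel E F) 𝓦.horTheta m) (chartForm (phaseModel E F) 𝓦.connForm m)
      (chartGen EG G S m) (extChartAt (phaseModel E F) m m) where
  smooth_form := smoothFormAt_horTheta hG hgW m
  smooth_conn := smoothFormAt_connForm hG hgW m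
  smooth_gen := contDiffAt_chartGen hG m
  conn_gen := by
    filter_upwards [extChartAt_target_mem_nhds (I := phaseModel E F) m] with y hy u
    refine (chartForm_chartGen 𝓦.connForm hy _).trans ?_
    refine (congrArg (lieAlgebraEquiv EG G) (connection_infGen hG hgW ?_ _)).trans
      ((lieAlgebraEquiv EG G).apply_symm_apply _)
    exact connection_mem hG hgW _
  kernel := by
    filter_upwards [extChartAt_target_mem_nhds (I := phaseModel E F) m] with y hy u v
    rw [SmoothFormAt.flatD_chartForm hy (smoothFormAt_horTheta hG hgW _), mfderiv_symm_chartGen hy]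
    exact extDerivOne_horTheta_infGen hG hgW (connection_mem hG hgW _) _
  nondegenerate := by
    filter_upwards [extChartAt_target_mem_nhds (I := phaseModel E F) m] with y hy u hu h
    rw [chartForm_connForm_eq_zero_iff hG] at hu
    have h0 : mfderiv 𝓘(ℝ, E × F) (phaseModel E F) (extChartAt (phaseModel E F) m).symm y u = 0 := by
      refine horTheta_nondegenerate (𝓦 := 𝓦) hG hgW hu fun Y hY => ?_
      obtain ⟨v, rfl⟩ : ∃ v : E × F,
          mfderiv 𝓘(ℝ, E × F) (phaseModel E F) (extChartAt (phaseModel E F) m).symm y v = Y :=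
        ⟨_, mfderiv_symm_chart_apply (I := phaseModel E F) hy Y⟩
      have h1 := h v ((chartForm_connForm_eq_zero_iff hG).2 hY)
      rwa [SmoothFormAt.flatD_chartForm hy (smoothFormAt_horTheta hG hgW _)] at h1
    refine (mfderiv_chart_symm_apply (I := phaseModel E F) hy u).symm.trans ?_
    exact (congrArg (mfderiv (phaseModel E F) 𝓘(ℝ, E × F) (extChartAt (phaseModel E F) m)
      ((extChartAt (phaseModel E F) m).symm y) : E × F →L[ℝ] E × F) h0).trans (map_zero _)

lemma isSharpAt (hG : S.IsSymmetryGroup EG G)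
    (hgW : 𝓦.GeneratedBy gW) (m : S.Phase) :
    ∀ᶠ y in 𝓝 (extChartAt (phaseModel E F) m m), IsSharpAt (chartForm (phaseModel E F) 𝓦.horTheta m)
      (chartForm (phaseModel E F) 𝓦.connForm m) (𝓦.chartSharp m) y := by
  filter_upwards [extChartAt_target_mem_nhds (I := phaseModel E F) m] with y hy β
  constructor
  · rw [chartForm_connForm_eq_zero_iff hG, mfderiv_symm_chartSharp hy]
    exact piJK_mem _ _
  · intro v hv
    rw [chartForm_connForm_eq_zero_iff hG] at hv
    rw [SmoothFormAt.flatD_chartForm hy (smoothFormAt_horTheta hG hgW _),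
      mfderiv_symm_chartSharp hy, extDerivOne_horTheta_piJK hG hgW _ hv]
    exact congrArg β (mfderiv_chart_symm_apply (I := phaseModel E F) hy v)

end ChartPair
end VerticalComplement
end NonholonomicSystem

/-! ### Functions and differentials in charts -/

section ChartFunctions

variable {E : Type*} [NormedAddCommGroup E] [NormedSpace ℝ E]
  {H : Type*} [TopologicalSpace H] {I : ModelWithCorners ℝ E H} [I.Boundaryless]
  {P : Type*} [TopologicalSpace P] [ChartedSpace H P] [IsManifold I ∞ P]

lemma contDiffAt_comp_chart_symm {f : P → ℝ} {p : P} (hf : ContMDiffAt I 𝓘(ℝ, ℝ) ∞ f p) :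
    ContDiffAt ℝ ∞ (f ∘ (extChartAt I p).symm) (extChartAt I p p) := by
  rw [← contMDiffAt_iff_contDiffAt]
  refine ContMDiffAt.comp _ ?_ (contMDiffAt_chart_symm (mem_extChartAt_target (I := I) p))
  rwa [extChartAt_to_inv]

omit [I.Boundaryless] in
lemma contMDiffAt_of_contDiffAt_comp_symm {f : P → ℝ} {p : P}
    (hf : ContDiffAt ℝ ∞ (f ∘ (extChartAt I p).symm) (extChartAt I p p)) :
    ContMDiffAt I 𝓘(ℝ, ℝ) ∞ f p := by
  refine (ContMDiffAt.comp p hf.contMDiffAt contMDiffAt_extChartAt).congr_of_eventuallyEq ?_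
  filter_upwards [extChartAt_source_mem_nhds (I := I) p] with x hx
  simp only [comp_apply]
  rw [(extChartAt I p).left_inv hx]

lemma tendsto_chart_symm (p : P) :
    Filter.Tendsto (extChartAt I p).symm (𝓝 (extChartAt I p p)) (𝓝 p) := by
  have := continuousAt_extChartAt_symm (I := I) p
  rwa [ContinuousAt, extChartAt_to_inv] at this

lemma eventually_mdifferentiableAt_chart_symm {f : P → ℝ} {p : P}
    (hf : ContMDiffAt I 𝓘(ℝ, ℝ) ∞ f p) :
    ∀ᶠ y in 𝓝 (extChartAt I p p), MDifferentiableAt I 𝓘(ℝ, ℝ) f ((extChartAt I p).symm y) := by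
  have : IsManifold I 1 P := IsManifold.of_le (n := ∞) (by simp)
  have h1 : ContMDiffAt I 𝓘(ℝ, ℝ) 1 f p := hf.of_le (by simp)
  filter_upwards [(tendsto_chart_symm p).eventually
    ((contMDiffAt_iff_contMDiffAt_nhds (by simp)).1 h1)] with y hy
  exact hy.mdifferentiableAt (by simp)

lemma fderiv_comp_symm_apply {f : P → ℝ} {p : P} {y : E} (hy : y ∈ (extChartAt I p).target)
    (hf : MDifferentiableAt I 𝓘(ℝ, ℝ) f ((extChartAt I p).symm y)) (u : E) :
    fderiv ℝ (f ∘ (extChartAt I p).symm) y u =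
      differential I f ((extChartAt I p).symm y)
        (mfderiv 𝓘(ℝ, E) I (extChartAt I p).symm y u) := by
  have h := mfderiv_comp (I := 𝓘(ℝ, E)) y hf (mdifferentiableAt_chart_symm hy)
  rw [mfderiv_eq_fderiv] at h
  exact congrArg (fun L : E →L[ℝ] ℝ => L u) h

lemma fderiv_comp_symm_comp {f : P → ℝ} {p : P} {y : E} (hy : y ∈ (extChartAt I p).target)
    (hf : MDifferentiableAt I 𝓘(ℝ, ℝ) f ((extChartAt I p).symm y)) :
    (fderiv ℝ (f ∘ (extChartAt I p).symm) y ∘L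
      (mfderiv I 𝓘(ℝ, E) (extChartAt I p) ((extChartAt I p).symm y) : E →L[ℝ] E) : E →L[ℝ] ℝ) =
      differential I f ((extChartAt I p).symm y) := by
  refine ContinuousLinearMap.ext fun u => ?_
  refine (fderiv_comp_symm_apply hy hf _).trans ?_
  exact congrArg (show E →L[ℝ] ℝ from differential I f ((extChartAt I p).symm y))
    (mfderiv_symm_chart_apply hy u)

omit [I.Boundaryless] in
lemma contMDiffAt_linearFunction (p : P) (α : TangentSpace I p →L[ℝ] ℝ) :
    ContMDiffAt I 𝓘(ℝ, ℝ) ∞ (linearFunction I p α) p :=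
  ContMDiffAt.comp (g := (show E →L[ℝ] ℝ from α)) p
    (show E →L[ℝ] ℝ from α).contDiff.contDiffAt.contMDiffAt contMDiffAt_extChartAt

lemma differential_linearFunction (p : P) (α : TangentSpace I p →L[ℝ] ℝ) :
    differential I (linearFunction I p α) p = α := by
  have h0 := mem_extChartAt_target (I := I) p
  have hd : MDifferentiableAt I 𝓘(ℝ, ℝ) (linearFunction I p α)
      ((extChartAt I p).symm (extChartAt I p p)) := by
    rw [extChartAt_to_inv]
    exact (contMDiffAt_linearFunction p α).mdifferentiableAt (by simp)
  refine ContinuousLinearMap.ext fun u => ?_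
  have h1 := fderiv_comp_symm_apply h0 hd u
  have h2 : (linearFunction I p α ∘ (extChartAt I p).symm) =ᶠ[𝓝 (extChartAt I p p)]
      (show E →L[ℝ] ℝ from α) := by
    filter_upwards [extChartAt_target_mem_nhds (I := I) p] with y hy
    exact congrArg (show E →L[ℝ] ℝ from α) ((extChartAt I p).right_inv hy)
  have h1 := (congrArg (fun L : E →L[ℝ] ℝ => L u)
    (h2.fderiv_eq.trans (show E →L[ℝ] ℝ from α).fderiv)).symm.trans h1
  have h3 : ∀ p', p' = p → ∀ w : E, w = u →
      (differential I (linearFunction I p α) p u : ℝ) =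
        differential I (linearFunction I p α) p' w := by rintro _ rfl _ rfl; rfl
  refine (h3 _ (extChartAt_to_inv p) _ (congrArg (fun L : E →L[ℝ] E => L u)
    (mfderiv_chart_symm_self p))).trans h1.symm

end ChartFunctions

namespace NonholonomicSystem
namespace VerticalComplement
-- The bracket of π_JK and its Jacobiator
section Brackets

variable {E F : Type*} [NormedAddCommGroup E] [NormedSpace ℝ E]
  [NormedAddCommGroup F] [NormedSpace ℝ F]
  {Q : Type*} [TopologicalSpace Q] [ChartedSpace E Q] [IsManifold 𝓘(ℝ, E) ∞ Q]
  {V : Q → Type*} [TopologicalSpace (TotalSpace F V)] [∀ q, TopologicalSpace (V q)]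
  [∀ q, AddCommGroup (V q)] [∀ q, Module ℝ (V q)] [FiberBundle F V] [VectorBundle ℝ F V]
  [ContMDiffVectorBundle ∞ F V 𝓘(ℝ, E)]
  {S : NonholonomicSystem E F Q V}
variable {EG : Type*} [NormedAddCommGroup EG] [NormedSpace ℝ EG]
  {G : Type*} [TopologicalSpace G] [ChartedSpace EG G] [Group G] [LieGroup 𝓘(ℝ, EG) ∞ G]
  [MulAction G Q]
variable [FiniteDimensional ℝ E] [FiniteDimensional ℝ F] [FiniteDimensional ℝ EG]
  {𝓦 : S.VerticalComplement EG G}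
  {m : S.Phase} {gW : Submodule ℝ (GroupLieAlgebra 𝓘(ℝ, EG) G)} {f g h : S.Phase → ℝ}

lemma mfderiv_symm_chartSharp_fderiv {y : E × F} (hy : y ∈ (extChartAt (phaseModel E F) m).target)
    (hf : MDifferentiableAt (phaseModel E F) 𝓘(ℝ, ℝ) f ((extChartAt (phaseModel E F) m).symm y)) :
    mfderiv 𝓘(ℝ, E × F) (phaseModel E F) (extChartAt (phaseModel E F) m).symm y
      (𝓦.chartSharp m y (fderiv ℝ (f ∘ (extChartAt (phaseModel E F) m).symm) y)) =
    𝓦.piJK ((extChartAt (phaseModel E F) m).symm y)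
      (differential (phaseModel E F) f ((extChartAt (phaseModel E F) m).symm y)) := by
  rw [mfderiv_symm_chartSharp hy]
  exact congrArg (𝓦.piJK ((extChartAt (phaseModel E F) m).symm y))
    (fderiv_comp_symm_comp (I := phaseModel E F) hy hf)

lemma bracket_comp_symm (hf : ContMDiffAt (phaseModel E F) 𝓘(ℝ, ℝ) ∞ f m)
    (hg : ContMDiffAt (phaseModel E F) 𝓘(ℝ, ℝ) ∞ g m) :
    bracket (phaseModel E F) 𝓦.piJK f g ∘ (extChartAt (phaseModel E F) m).symm
      =ᶠ[𝓝 (extChartAt (phaseModel E F) m m)]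
    flatBracket (𝓦.chartSharp m) (f ∘ (extChartAt (phaseModel E F) m).symm)
      (g ∘ (extChartAt (phaseModel E F) m).symm) := by
  filter_upwards [extChartAt_target_mem_nhds (I := phaseModel E F) m,
    eventually_mdifferentiableAt_chart_symm hf, eventually_mdifferentiableAt_chart_symm hg]
    with y hy hfy hgy
  rw [flatBracket, fderiv_comp_symm_apply hy hgy, mfderiv_symm_chartSharp_fderiv hy hfy]
  rfl

lemma contMDiffAt_bracket (hG : S.IsSymmetryGroup EG G)
    (hgW : 𝓦.GeneratedBy gW)
    (hf : ContMDiffAt (phaseModel E F) 𝓘(ℝ, ℝ) ∞ f m)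
    (hg : ContMDiffAt (phaseModel E F) 𝓘(ℝ, ℝ) ∞ g m) :
    ContMDiffAt (phaseModel E F) 𝓘(ℝ, ℝ) ∞ (bracket (phaseModel E F) 𝓦.piJK f g) m := by
  refine contMDiffAt_of_contDiffAt_comp_symm
    (ContDiffAt.congr_of_eventuallyEq ?_ (bracket_comp_symm hf hg))
  exact contDiffAt_flatBracket (kernelPair hG hgW m) (isSharpAt hG hgW m)
    (contDiffAt_comp_chart_symm hf) (contDiffAt_comp_chart_symm hg)

lemma isBivectorField_piJK (hG : S.IsSymmetryGroup EG G)
    (hgW : 𝓦.GeneratedBy gW) : IsBivectorField (phaseModel E F) 𝓦.piJK where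
  skew _ α β := piJK_skew hG hgW α β
  smooth _ _ hf hg m := contMDiffAt_bracket hG hgW (hf m) (hg m)

/-- The inner bracket coincides with its coordinate version on a neighbourhood, so the differential
taken by the outer bracket coincides as well. -/
lemma bracket_bracket (hG : S.IsSymmetryGroup EG G)
    (hgW : 𝓦.GeneratedBy gW)
    (hf : ContMDiffAt (phaseModel E F) 𝓘(ℝ, ℝ) ∞ f m)
    (hg : ContMDiffAt (phaseModel E F) 𝓘(ℝ, ℝ) ∞ g m)
    (hh : ContMDiffAt (phaseModel E F) 𝓘(ℝ, ℝ) ∞ h m) :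
    bracket (phaseModel E F) 𝓦.piJK f (bracket (phaseModel E F) 𝓦.piJK g h) m =
    flatBracket (𝓦.chartSharp m) (f ∘ (extChartAt (phaseModel E F) m).symm)
      (flatBracket (𝓦.chartSharp m) (g ∘ (extChartAt (phaseModel E F) m).symm)
        (h ∘ (extChartAt (phaseModel E F) m).symm)) (extChartAt (phaseModel E F) m m) := by
  have h1 := (bracket_comp_symm (𝓦 := 𝓦) hf (contMDiffAt_bracket (𝓦 := 𝓦) hG hgW hg hh)).self_of_nhds
  rw [comp_apply, extChartAt_to_inv] at h1
  rw [h1, flatBracket, (bracket_comp_symm hg hh).fderiv_eq]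
  rfl

/-- Identifies the terms of the flat Jacobiator with those of ψ: since π_JK takes values in C, the
projections in K_W have no effect and dA_W may replace it. -/
lemma fderiv_chartGen_flatD (hG : S.IsSymmetryGroup EG G)
    (hgW : 𝓦.GeneratedBy gW)
    (hf : ContMDiffAt (phaseModel E F) 𝓘(ℝ, ℝ) ∞ f m)
    (hg : ContMDiffAt (phaseModel E F) 𝓘(ℝ, ℝ) ∞ g m)
    (hh : ContMDiffAt (phaseModel E F) 𝓘(ℝ, ℝ) ∞ h m) :
    fderiv ℝ (h ∘ (extChartAt (phaseModel E F) m).symm) (extChartAt (phaseModel E F) m m)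
      (chartGen EG G S m (extChartAt (phaseModel E F) m m)
        (flatD (chartForm (phaseModel E F) 𝓦.connForm m) (extChartAt (phaseModel E F) m m)
          (𝓦.chartSharp m (extChartAt (phaseModel E F) m m)
            (fderiv ℝ (f ∘ (extChartAt (phaseModel E F) m).symm) (extChartAt (phaseModel E F) m m)))
          (𝓦.chartSharp m (extChartAt (phaseModel E F) m m)
            (fderiv ℝ (g ∘ (extChartAt (phaseModel E F) m).symm)
              (extChartAt (phaseModel E F) m m))))) =
    differential (phaseModel E F) h m (S.infGen EG G m (𝓦.curvature m
      (𝓦.piJK m (differential (phaseModel E F) f m))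
      (𝓦.piJK m (differential (phaseModel E F) g m)))) := by
  have hy := mem_extChartAt_target (I := phaseModel E F) m
  rw [fderiv_comp_symm_apply hy (eventually_mdifferentiableAt_chart_symm hh).self_of_nhds,
    mfderiv_symm_chartGen hy, SmoothFormAt.flatD_chartForm hy (smoothFormAt_connForm hG hgW _),
    mfderiv_symm_chartSharp_fderiv hy (eventually_mdifferentiableAt_chart_symm hf).self_of_nhds,
    mfderiv_symm_chartSharp_fderiv hy (eventually_mdifferentiableAt_chart_symm hg).self_of_nhds]
  have key : ∀ x : S.Phase, x = m →
      differential (phaseModel E F) h x (S.infGen EG G x ((lieAlgebraEquiv EG G).symm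
        (extDerivOne (phaseModel E F) 𝓦.connForm x
          (𝓦.piJK x (differential (phaseModel E F) f x))
          (𝓦.piJK x (differential (phaseModel E F) g x))))) =
      differential (phaseModel E F) h m (S.infGen EG G m (𝓦.curvature m
        (𝓦.piJK m (differential (phaseModel E F) f m))
        (𝓦.piJK m (differential (phaseModel E F) g m)))) := by
    rintro x rfl
    have e : 𝓦.curvature x (𝓦.piJK x (differential (phaseModel E F) f x))
        (𝓦.piJK x (differential (phaseModel E F) g x)) = (lieAlgebraEquiv EG G).symm
        (extDerivOne (phaseModel E F) 𝓦.connForm x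
          (𝓦.projC x (𝓦.piJK x (differential (phaseModel E F) f x)))
          (𝓦.projC x (𝓦.piJK x (differential (phaseModel E F) g x)))) := rfl
    rw [e, projC_of_mem (piJK_mem x _), projC_of_mem (piJK_mem x _)]
  exact key _ (extChartAt_to_inv m)

lemma jacobiator_piJK (hG : S.IsSymmetryGroup EG G)
    (hgW : 𝓦.GeneratedBy gW)
    (hf : ContMDiffAt (phaseModel E F) 𝓘(ℝ, ℝ) ∞ f m)
    (hg : ContMDiffAt (phaseModel E F) 𝓘(ℝ, ℝ) ∞ g m)
    (hh : ContMDiffAt (phaseModel E F) 𝓘(ℝ, ℝ) ∞ h m) :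
    jacobiator (phaseModel E F) 𝓦.piJK f g h m =
      -𝓦.psi 𝓦.piJK m (differential (phaseModel E F) f m) (differential (phaseModel E F) g m)
        (differential (phaseModel E F) h m) := by
  rw [jacobiator, bracket_bracket hG hgW hf hg hh, bracket_bracket hG hgW hg hh hf,
    bracket_bracket hG hgW hh hf hg,
    flatBracket_jacobi (kernelPair hG hgW m) (isSharpAt hG hgW m)
      (contDiffAt_comp_chart_symm hf) (contDiffAt_comp_chart_symm hg) (contDiffAt_comp_chart_symm hh),
    fderiv_chartGen_flatD hG hgW hf hg hh, fderiv_chartGen_flatD hG hgW hg hh hf,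
    fderiv_chartGen_flatD hG hgW hh hf hg]
  rfl

lemma schouten_piJK (hG : S.IsSymmetryGroup EG G)
    (hgW : 𝓦.GeneratedBy gW) (α β γ : TangentSpace (phaseModel E F) m →L[ℝ] ℝ) :
    (1 / 2) * schouten (phaseModel E F) 𝓦.piJK m α β γ = -𝓦.psi 𝓦.piJK m α β γ := by
  rw [schouten, jacobiator_piJK hG hgW (contMDiffAt_linearFunction m α)
    (contMDiffAt_linearFunction m β) (contMDiffAt_linearFunction m γ),
    differential_linearFunction, differential_linearFunction, differential_linearFunction]
  ring

end Brackets
end VerticalComplement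
end NonholonomicSystem

/-! ### Algebra of brackets -/

section Brackets

variable {E : Type*} [NormedAddCommGroup E] [NormedSpace ℝ E]
  {H : Type*} [TopologicalSpace H] {I : ModelWithCorners ℝ E H}
  {P : Type*} [TopologicalSpace P] [ChartedSpace H P] {p : P} {f g h : P → ℝ}
  {ϖ : BivectorData I (P := P)}

lemma differential_add (hf : MDifferentiableAt I 𝓘(ℝ, ℝ) f p)
    (hg : MDifferentiableAt I 𝓘(ℝ, ℝ) g p) :
    differential I (f + g) p = differential I f p + differential I g p :=
  (hf.hasMFDerivAt.add hg.hasMFDerivAt).mfderiv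

lemma differential_smul (hf : MDifferentiableAt I 𝓘(ℝ, ℝ) f p) (c : ℝ) :
    differential I (c • f) p = c • differential I f p :=
  (hf.hasMFDerivAt.const_smul c).mfderiv

lemma differential_mul (hf : MDifferentiableAt I 𝓘(ℝ, ℝ) f p)
    (hg : MDifferentiableAt I 𝓘(ℝ, ℝ) g p) :
    differential I (f * g) p = f p • differential I g p + g p • differential I f p :=
  (hf.hasMFDerivAt.mul hg.hasMFDerivAt).mfderiv

lemma bracket_add_left (hf : MDifferentiableAt I 𝓘(ℝ, ℝ) f p)
    (hg : MDifferentiableAt I 𝓘(ℝ, ℝ) g p) :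
    bracket I ϖ (f + g) h p = bracket I ϖ f h p + bracket I ϖ g h p := by
  rw [bracket, differential_add hf hg, map_add, map_add]; rfl

lemma bracket_add_right (hg : MDifferentiableAt I 𝓘(ℝ, ℝ) g p)
    (hh : MDifferentiableAt I 𝓘(ℝ, ℝ) h p) :
    bracket I ϖ f (g + h) p = bracket I ϖ f g p + bracket I ϖ f h p := by
  rw [bracket, differential_add hg hh]; rfl

lemma bracket_smul_left (hf : MDifferentiableAt I 𝓘(ℝ, ℝ) f p) (c : ℝ) :
    bracket I ϖ (c • f) h p = c * bracket I ϖ f h p := by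
  rw [bracket, differential_smul hf, map_smul, map_smul]; rfl

lemma bracket_smul_right (hg : MDifferentiableAt I 𝓘(ℝ, ℝ) g p) (c : ℝ) :
    bracket I ϖ f (c • g) p = c * bracket I ϖ f g p := by
  rw [bracket, differential_smul hg]; rfl

lemma bracket_mul_left (hf : MDifferentiableAt I 𝓘(ℝ, ℝ) f p)
    (hg : MDifferentiableAt I 𝓘(ℝ, ℝ) g p) :
    bracket I ϖ (f * g) h p = f p * bracket I ϖ g h p + bracket I ϖ f h p * g p := by
  rw [bracket, differential_mul hf hg, map_add, map_smul, map_smul, map_add, map_smul, map_smul,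
    mul_comm (bracket I ϖ f h p)]; rfl

end Brackets

/-! ### Local sections of submersions -/

section Sections

variable {E : Type*} [NormedAddCommGroup E] [NormedSpace ℝ E]
  {H : Type*} [TopologicalSpace H] {I : ModelWithCorners ℝ E H} [I.Boundaryless]
  {P : Type*} [TopologicalSpace P] [ChartedSpace H P]
  {E' : Type*} [NormedAddCommGroup E'] [NormedSpace ℝ E']
  {P' : Type*} [TopologicalSpace P'] [ChartedSpace E' P'] {ρ : P → P'} {p : P}

/-- In adapted charts a submersion is the projection (u, w) ↦ u. The section keeps w equal to its
value at p. -/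
lemma exists_localSection (h : IsSubmersionAt I 𝓘(ℝ, E') ∞ ρ p) :
    ∃ s : P' → P, s (ρ p) = p ∧ ContMDiffAt 𝓘(ℝ, E') I ∞ s (ρ p) ∧
      ∀ᶠ x in 𝓝 (ρ p), ρ (s x) = x := by
  set φ := h.domChart with hφ
  set ψ := h.codChart with hψ
  set e := h.equiv with he
  set y₀ := φ.extend I p with hy₀
  have hp : p ∈ (φ.extend I).source := by
    rw [OpenPartialHomeomorph.extend_source]; exact h.mem_domChart_source
  have hy₀t : y₀ ∈ (φ.extend I).target := (φ.extend I).map_source hp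
  have htarget : (φ.extend I).target ∈ 𝓝 y₀ := by
    have := OpenPartialHomeomorph.extend_target_mem_nhdsWithin (I := I) (f := φ)
      h.mem_domChart_source
    rwa [I.range_eq_univ, nhdsWithin_univ] at this
  let r : P' → E := fun x => e.symm (ψ x, (e y₀).2)
  have hr0 : r (ρ p) = y₀ := by
    have h1 : ψ (ρ p) = (e y₀).1 := by
      have h2 := h.writtenInCharts hy₀t
      simp only [comp_apply] at h2
      rw [hy₀, ← hφ, (φ.extend I).left_inv hp] at h2
      exact h2
    show e.symm (ψ (ρ p), (e y₀).2) = y₀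
    rw [h1]
    exact e.symm_apply_apply y₀
  have hr : ContMDiffAt 𝓘(ℝ, E') 𝓘(ℝ, E) ∞ r (ρ p) := by
    have h1 : ContMDiffAt 𝓘(ℝ, E') 𝓘(ℝ, E') ∞ ψ (ρ p) :=
      contMDiffAt_of_mem_maximalAtlas h.codChart_mem_maximalAtlas h.mem_codChart_source
    have h2 : ContDiff ℝ ∞ (fun u : E' => e.symm (u, (e y₀).2)) :=
      e.symm.contDiff.comp (contDiff_id.prodMk contDiff_const)
    exact ContMDiffAt.comp (g := fun u : E' => e.symm (u, (e y₀).2)) (ρ p)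
      h2.contDiffAt.contMDiffAt h1
  have hs : ContMDiffAt 𝓘(ℝ, E) I ∞ (φ.extend I).symm y₀ := by
    refine (contMDiffOn_extend_symm h.domChart_mem_maximalAtlas).contMDiffAt ?_
    have e1 : I '' φ.target = (φ.extend I).target := by
      rw [OpenPartialHomeomorph.extend_target']
    rw [e1]; exact htarget
  refine ⟨(φ.extend I).symm ∘ r, ?_, ?_, ?_⟩
  · rw [comp_apply, hr0]; exact (φ.extend I).left_inv hp
  · exact ContMDiffAt.comp (ρ p) (by rw [hr0]; exact hs) hr
  · have h1 : ∀ᶠ x in 𝓝 (ρ p), r x ∈ (φ.extend I).target :=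
      hr.continuousAt.eventually (by rw [hr0]; exact htarget)
    filter_upwards [h1, ψ.open_source.mem_nhds h.mem_codChart_source] with x hx hxs
    have h2 := h.writtenInCharts hx
    have h3 : ψ (ρ ((φ.extend I).symm (r x))) = ψ x := by
      refine Eq.trans h2 ?_
      show (e (e.symm (ψ x, (e y₀).2))).1 = ψ x
      rw [e.apply_symm_apply]
    refine ψ.injOn ?_ hxs h3
    apply h.source_subset_preimage_source
    have := (φ.extend I).map_target hx
    rwa [OpenPartialHomeomorph.extend_source] at this

end Sections

namespace NonholonomicSystem
namespace VerticalComplement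

/-! ### Reduction -/

section Invariant

variable {E F : Type*} [NormedAddCommGroup E] [NormedSpace ℝ E]
  [NormedAddCommGroup F] [NormedSpace ℝ F]
  {Q : Type*} [TopologicalSpace Q] [ChartedSpace E Q] [IsManifold 𝓘(ℝ, E) ∞ Q]
  {V : Q → Type*} [TopologicalSpace (TotalSpace F V)] [∀ q, TopologicalSpace (V q)]
  [∀ q, AddCommGroup (V q)] [∀ q, Module ℝ (V q)] [FiberBundle F V] [VectorBundle ℝ F V]
  [ContMDiffVectorBundle ∞ F V 𝓘(ℝ, E)]
  {S : NonholonomicSystem E F Q V}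
variable {EG : Type*} [NormedAddCommGroup EG] [NormedSpace ℝ EG]
  {G : Type*} [TopologicalSpace G] [ChartedSpace EG G] [Group G] [LieGroup 𝓘(ℝ, EG) ∞ G]
  [MulAction G Q]
variable [FiniteDimensional ℝ E] [FiniteDimensional ℝ F] [FiniteDimensional ℝ EG]
  {𝓦 : S.VerticalComplement EG G}
  {m : S.Phase} {gW : Submodule ℝ (GroupLieAlgebra 𝓘(ℝ, EG) G)} {f g h : S.Phase → ℝ}

lemma differential_comp_tangentAct (hG : S.IsSymmetryGroup EG G)
    (hf : ∀ (a : G) (m : S.Phase), f (S.act a m) = f m) (a : G)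
    (hd : MDifferentiableAt (phaseModel E F) 𝓘(ℝ, ℝ) f (S.act a m)) :
    differential (phaseModel E F) f (S.act a m) ∘L S.tangentAct a m =
      differential (phaseModel E F) f m := by
  have h1 := mfderiv_comp (I := phaseModel E F) m hd (hG.mdifferentiableAt_act a m)
  have e : f ∘ S.act a = f := funext fun m => hf a m
  rw [e] at h1
  exact h1.symm

lemma differential_infGen (hG : S.IsSymmetryGroup EG G)
    (hf : ∀ (a : G) (m : S.Phase), f (S.act a m) = f m)
    (hd : MDifferentiableAt (phaseModel E F) 𝓘(ℝ, ℝ) f m) (ξ : GroupLieAlgebra 𝓘(ℝ, EG) G) :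
    differential (phaseModel E F) f m (S.infGen EG G m ξ) = 0 := by
  have h1 := mfderiv_comp (I := 𝓘(ℝ, EG)) (1 : G) (g := f) (f := fun a : G => S.act a m)
    (by rw [hG.act_one]; exact hd) (hG.mdifferentiableAt_orbit m 1)
  have e : f ∘ (fun a : G => S.act a m) = fun _ => f m := funext fun a => hf a m
  rw [e, mfderiv_const] at h1
  have h2 : ∀ m', m' = m → ∀ v : E × F, (differential (phaseModel E F) f m' v : ℝ) =
      differential (phaseModel E F) f m v := by rintro _ rfl _; rfl
  exact (h2 _ (hG.act_one m) _).symm.trans (congrArg (fun L : EG →L[ℝ] ℝ => L ξ) h1).symm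

lemma bracket_act (hG : S.IsSymmetryGroup EG G)
    (hgW : 𝓦.GeneratedBy gW)
    (hf : ∀ (a : G) (m : S.Phase), f (S.act a m) = f m)
    (hg : ∀ (a : G) (m : S.Phase), g (S.act a m) = g m)
    (hfd : MDifferentiable (phaseModel E F) 𝓘(ℝ, ℝ) f)
    (hgd : MDifferentiable (phaseModel E F) 𝓘(ℝ, ℝ) g) (a : G) (m : S.Phase) :
    bracket (phaseModel E F) 𝓦.piJK f g (S.act a m) = bracket (phaseModel E F) 𝓦.piJK f g m := by
  rw [bracket, piJK_act hG hgW, differential_comp_tangentAct hG hf a (hfd _), bracket]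
  exact congrArg (fun L : TangentSpace (phaseModel E F) m →L[ℝ] ℝ =>
    L (𝓦.piJK m (differential (phaseModel E F) f m)))
    (differential_comp_tangentAct hG hg a (hgd _))

/-- ψ evaluates differentials on infinitesimal generators only, and those of invariant functions
vanish there. -/
lemma jacobiator_eq_zero (hG : S.IsSymmetryGroup EG G)
    (hgW : 𝓦.GeneratedBy gW)
    (hf : ∀ (a : G) (m : S.Phase), f (S.act a m) = f m)
    (hg : ∀ (a : G) (m : S.Phase), g (S.act a m) = g m)
    (hh : ∀ (a : G) (m : S.Phase), h (S.act a m) = h m)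
    (hfs : ContMDiffAt (phaseModel E F) 𝓘(ℝ, ℝ) ∞ f m)
    (hgs : ContMDiffAt (phaseModel E F) 𝓘(ℝ, ℝ) ∞ g m)
    (hhs : ContMDiffAt (phaseModel E F) 𝓘(ℝ, ℝ) ∞ h m) :
    jacobiator (phaseModel E F) 𝓦.piJK f g h m = 0 := by
  rw [jacobiator_piJK hG hgW hfs hgs hhs, psi,
    differential_infGen hG hf (hfs.mdifferentiableAt (by simp)),
    differential_infGen hG hg (hgs.mdifferentiableAt (by simp)),
    differential_infGen hG hh (hhs.mdifferentiableAt (by simp))]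
  simp

lemma orbitProj_act (a : G) (m : S.Phase) : S.orbitProj G (S.act a m) = S.orbitProj G m :=
  (Quot.sound ⟨a, rfl⟩).symm

lemma exists_act_eq_of_orbitProj_eq (hG : S.IsSymmetryGroup EG G) {m m' : S.Phase}
    (h : S.orbitProj G m = S.orbitProj G m') : ∃ a : G, S.act a m = m' := by
  have heq : Equivalence (fun m m' : S.Phase => ∃ a : G, S.act a m = m') :=
    { refl := fun m => ⟨1, hG.act_one m⟩
      symm := by
        rintro m _ ⟨a, rfl⟩
        exact ⟨a⁻¹, by rw [hG.act_act, inv_mul_cancel, hG.act_one]⟩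
      trans := by
        rintro m _ _ ⟨a, rfl⟩ ⟨b, rfl⟩
        exact ⟨b * a, (hG.act_act b a m).symm⟩ }
  exact heq.eqvGen_iff.1 (Quot.eqvGen_exact h)

lemma smoothOrbitFunctions_mdifferentiable (f : S.smoothOrbitFunctions G) :
    MDifferentiable (phaseModel E F) 𝓘(ℝ, ℝ)
      (fun x => (f : S.OrbitSpace G → ℝ) (S.orbitProj G x)) :=
  (show ContMDiff (phaseModel E F) 𝓘(ℝ, ℝ) ∞ _ from f.2).mdifferentiable (by simp)

/-- The bracket of two functions on the orbit space. -/
def orbitBracket (hG : S.IsSymmetryGroup EG G)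
    (hgW : 𝓦.GeneratedBy gW) (f g : S.smoothOrbitFunctions G) :
    S.smoothOrbitFunctions G :=
  ⟨Quot.lift (bracket (phaseModel E F) 𝓦.piJK
      (fun x => (f : S.OrbitSpace G → ℝ) (S.orbitProj G x))
      (fun x => (g : S.OrbitSpace G → ℝ) (S.orbitProj G x))) (by
        rintro m _ ⟨a, rfl⟩
        exact (bracket_act hG hgW (fun a m => congrArg f.1 (orbitProj_act a m))
          (fun a m => congrArg g.1 (orbitProj_act a m)) (smoothOrbitFunctions_mdifferentiable f)
          (smoothOrbitFunctions_mdifferentiable g) a m).symm),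
    fun m => contMDiffAt_bracket hG hgW (f.2 m) (g.2 m)⟩

lemma orbitFunctions_ext {f g : S.smoothOrbitFunctions G}
    (h : ∀ m, (f : S.OrbitSpace G → ℝ) (S.orbitProj G m) =
      (g : S.OrbitSpace G → ℝ) (S.orbitProj G m)) : f = g :=
  Subtype.ext (funext (Quot.ind h))

/-- The bracket on the orbit space, as a bilinear map. -/
def orbitBracketLin (hG : S.IsSymmetryGroup EG G)
    (hgW : 𝓦.GeneratedBy gW) :
    S.smoothOrbitFunctions G →ₗ[ℝ] S.smoothOrbitFunctions G →ₗ[ℝ] S.smoothOrbitFunctions G :=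
  LinearMap.mk₂ ℝ (orbitBracket hG hgW)
    (fun f f' _ => orbitFunctions_ext fun m => bracket_add_left
      (smoothOrbitFunctions_mdifferentiable f m) (smoothOrbitFunctions_mdifferentiable f' m))
    (fun c f _ => orbitFunctions_ext fun m => bracket_smul_left
      (smoothOrbitFunctions_mdifferentiable f m) c)
    (fun _ g g' => orbitFunctions_ext fun m => bracket_add_right
      (smoothOrbitFunctions_mdifferentiable g m) (smoothOrbitFunctions_mdifferentiable g' m))
    (fun c _ g => orbitFunctions_ext fun m => bracket_smul_right
      (smoothOrbitFunctions_mdifferentiable g m) c)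

lemma isPoissonBracket_orbitBracketLin (hG : S.IsSymmetryGroup EG G)
    (hgW : 𝓦.GeneratedBy gW) :
    IsPoissonBracket (orbitBracketLin (𝓦 := 𝓦) hG hgW) where
  skew _ _ := orbitFunctions_ext fun _ => piJK_skew hG hgW _ _
  leibniz f g _ := orbitFunctions_ext fun m => bracket_mul_left
    (smoothOrbitFunctions_mdifferentiable f m) (smoothOrbitFunctions_mdifferentiable g m)
  jacobi f g h := orbitFunctions_ext fun m => jacobiator_eq_zero hG hgW
    (fun a m => congrArg f.1 (orbitProj_act a m)) (fun a m => congrArg g.1 (orbitProj_act a m))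
    (fun a m => congrArg h.1 (orbitProj_act a m)) (f.2 m) (g.2 m) (h.2 m)

lemma existsUnique_orbitBracket (hG : S.IsSymmetryGroup EG G)
    (hgW : 𝓦.GeneratedBy gW) :
    ∃! Λ : S.smoothOrbitFunctions G →ₗ[ℝ] S.smoothOrbitFunctions G →ₗ[ℝ]
        S.smoothOrbitFunctions G,
      (∀ (f g : S.smoothOrbitFunctions G) (m : S.Phase),
        (Λ f g : S.OrbitSpace G → ℝ) (S.orbitProj G m) =
          bracket (phaseModel E F) 𝓦.piJK (fun x => (f : S.OrbitSpace G → ℝ) (S.orbitProj G x))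
            (fun x => (g : S.OrbitSpace G → ℝ) (S.orbitProj G x)) m) ∧
      IsPoissonBracket Λ := by
  refine ⟨orbitBracketLin hG hgW, ⟨fun _ _ _ => rfl, isPoissonBracket_orbitBracketLin hG hgW⟩, ?_⟩
  rintro Λ ⟨hΛ, -⟩
  exact LinearMap.ext₂ fun f g => orbitFunctions_ext fun m => hΛ f g m

end Invariant

/-! ### The reduced bivector field on the quotient manifold -/

section Quotient

variable {E F : Type*} [NormedAddCommGroup E] [NormedSpace ℝ E]
  [NormedAddCommGroup F] [NormedSpace ℝ F]
  {Q : Type*} [TopologicalSpace Q] [ChartedSpace E Q] [IsManifold 𝓘(ℝ, E) ∞ Q]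
  {V : Q → Type*} [TopologicalSpace (TotalSpace F V)] [∀ q, TopologicalSpace (V q)]
  [∀ q, AddCommGroup (V q)] [∀ q, Module ℝ (V q)] [FiberBundle F V] [VectorBundle ℝ F V]
  [ContMDiffVectorBundle ∞ F V 𝓘(ℝ, E)]
  {S : NonholonomicSystem E F Q V}
variable {EG : Type*} [NormedAddCommGroup EG] [NormedSpace ℝ EG]
  {G : Type*} [TopologicalSpace G] [ChartedSpace EG G] [Group G] [LieGroup 𝓘(ℝ, EG) ∞ G]
  [MulAction G Q]
variable [FiniteDimensional ℝ E] [FiniteDimensional ℝ F] [FiniteDimensional ℝ EG]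
  {𝓦 : S.VerticalComplement EG G}
  {m : S.Phase} {gW : Submodule ℝ (GroupLieAlgebra 𝓘(ℝ, EG) G)}
  {EN : Type*} [NormedAddCommGroup EN] [NormedSpace ℝ EN] [ChartedSpace EN (S.OrbitSpace G)]

variable (EN) in
/-- The derivative of the orbit projection, with values in the model space. -/
def tangentOrbitProj (m : S.Phase) : TangentSpace (phaseModel E F) m →L[ℝ] EN :=
  mfderiv (phaseModel E F) 𝓘(ℝ, EN) (S.orbitProj G) m

variable (EN) in
/-- The push-forward of `π_JK` by the orbit projection. -/
def pushSharp (𝓦 : S.VerticalComplement EG G) (m : S.Phase) :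
    (EN →L[ℝ] ℝ) →ₗ[ℝ] EN where
  toFun α := tangentOrbitProj (G := G) EN m (𝓦.piJK m (α ∘L tangentOrbitProj (G := G) EN m))
  map_add' α β := by
    rw [ContinuousLinearMap.add_comp, map_add, map_add]
  map_smul' c α := by
    rw [ContinuousLinearMap.smul_comp, map_smul, map_smul]; rfl

lemma tangentOrbitProj_act (hG : S.IsSymmetryGroup EG G)
    (hρ : MDifferentiable (phaseModel E F) 𝓘(ℝ, EN) (S.orbitProj G)) (a : G) (m : S.Phase) :
    tangentOrbitProj (G := G) EN (S.act a m) ∘L S.tangentAct a m =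
      tangentOrbitProj (G := G) EN m := by
  have h1 := mfderiv_comp (I := phaseModel E F) m (hρ (S.act a m)) (hG.mdifferentiableAt_act a m)
  have e : S.orbitProj G ∘ S.act a = S.orbitProj G := funext fun m => orbitProj_act a m
  rw [e] at h1
  exact h1.symm

/-- Invariance of π_JK and of ρ makes the push-forward constant on orbits, so the representative
chosen in `quotientSharp` is immaterial. -/
lemma pushSharp_act (hG : S.IsSymmetryGroup EG G)
    (hgW : 𝓦.GeneratedBy gW)
    (hρ : MDifferentiable (phaseModel E F) 𝓘(ℝ, EN) (S.orbitProj G)) (a : G) (m : S.Phase) :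
    𝓦.pushSharp EN (S.act a m) = 𝓦.pushSharp EN m := by
  refine LinearMap.ext fun α => ?_
  show tangentOrbitProj (G := G) EN (S.act a m) (𝓦.piJK (S.act a m)
    (α ∘L tangentOrbitProj (G := G) EN (S.act a m))) = tangentOrbitProj (G := G) EN m (𝓦.piJK m
    (α ∘L tangentOrbitProj (G := G) EN m))
  rw [piJK_act hG hgW, ContinuousLinearMap.comp_assoc, tangentOrbitProj_act hG hρ]
  exact congrArg (fun L : TangentSpace (phaseModel E F) m →L[ℝ] EN =>
    L (𝓦.piJK m (α ∘L tangentOrbitProj (G := G) EN m))) (tangentOrbitProj_act hG hρ a m)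

variable (EN) in
/-- The bivector field induced by `π_JK` on the orbit space. -/
def quotientSharp (𝓦 : S.VerticalComplement EG G) :
    BivectorData 𝓘(ℝ, EN) (P := S.OrbitSpace G) :=
  fun n => 𝓦.pushSharp EN (Quot.out n)

lemma quotientSharp_orbitProj (hG : S.IsSymmetryGroup EG G)
    (hgW : 𝓦.GeneratedBy gW)
    (hρ : MDifferentiable (phaseModel E F) 𝓘(ℝ, EN) (S.orbitProj G)) (m : S.Phase) :
    (𝓦.quotientSharp EN (S.orbitProj G m) : (EN →L[ℝ] ℝ) →ₗ[ℝ] EN) = 𝓦.pushSharp EN m := by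
  obtain ⟨a, ha⟩ := exists_act_eq_of_orbitProj_eq hG
    (Quot.out_eq (S.orbitProj G m) : S.orbitProj G (Quot.out (S.orbitProj G m)) = S.orbitProj G m)
  have h1 := pushSharp_act (𝓦 := 𝓦) hG hgW hρ a (Quot.out (S.orbitProj G m))
  rw [ha] at h1
  exact h1.symm

lemma differential_comp_orbitProj
    (hρ : MDifferentiable (phaseModel E F) 𝓘(ℝ, EN) (S.orbitProj G)) {f : S.OrbitSpace G → ℝ}
    (hf : MDifferentiableAt 𝓘(ℝ, EN) 𝓘(ℝ, ℝ) f (S.orbitProj G m)) :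
    differential (phaseModel E F) (f ∘ S.orbitProj G) m =
      (show EN →L[ℝ] ℝ from differential 𝓘(ℝ, EN) f (S.orbitProj G m)) ∘L
        tangentOrbitProj (G := G) EN m :=
  mfderiv_comp (I := phaseModel E F) m hf (hρ m)

lemma bracket_quotientSharp (hG : S.IsSymmetryGroup EG G)
    (hgW : 𝓦.GeneratedBy gW)
    (hρ : MDifferentiable (phaseModel E F) 𝓘(ℝ, EN) (S.orbitProj G)) {f g : S.OrbitSpace G → ℝ}
    (hf : MDifferentiable 𝓘(ℝ, EN) 𝓘(ℝ, ℝ) f) (hg : MDifferentiable 𝓘(ℝ, EN) 𝓘(ℝ, ℝ) g) :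
    bracket 𝓘(ℝ, EN) (𝓦.quotientSharp EN) f g ∘ S.orbitProj G =
      bracket (phaseModel E F) 𝓦.piJK (f ∘ S.orbitProj G) (g ∘ S.orbitProj G) := by
  funext m
  rw [bracket, differential_comp_orbitProj hρ (hf _), differential_comp_orbitProj hρ (hg _)]
  exact congrArg (fun L : (EN →L[ℝ] ℝ) →ₗ[ℝ] EN =>
    (show EN →L[ℝ] ℝ from differential 𝓘(ℝ, EN) g (S.orbitProj G m))
      (L (differential 𝓘(ℝ, EN) f (S.orbitProj G m)))) (quotientSharp_orbitProj hG hgW hρ m)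

variable [IsManifold 𝓘(ℝ, EN) ∞ (S.OrbitSpace G)]

/-- Skewness and the Jacobi identity are checked after pulling back by the surjection ρ, where they
hold for π_JK on invariant functions. Smoothness of a bracket comes from composing its pullback with
a local section of ρ. -/
lemma isPoisson_quotientSharp (hG : S.IsSymmetryGroup EG G)
    (hgW : 𝓦.GeneratedBy gW)
    (hsub : IsSubmersion (phaseModel E F) 𝓘(ℝ, EN) ∞ (S.orbitProj G)) :
    IsPoisson 𝓘(ℝ, EN) (𝓦.quotientSharp EN) := by
  have hs : ContMDiff (phaseModel E F) 𝓘(ℝ, EN) ∞ (S.orbitProj G) := hsub.contMDiff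
  have hρ : MDifferentiable (phaseModel E F) 𝓘(ℝ, EN) (S.orbitProj G) :=
    hs.mdifferentiable (by simp)
  have hb : ∀ f g : S.OrbitSpace G → ℝ, ContMDiff 𝓘(ℝ, EN) 𝓘(ℝ, ℝ) ∞ f →
      ContMDiff 𝓘(ℝ, EN) 𝓘(ℝ, ℝ) ∞ g →
      ContMDiff 𝓘(ℝ, EN) 𝓘(ℝ, ℝ) ∞ (bracket 𝓘(ℝ, EN) (𝓦.quotientSharp EN) f g) := by
    intro f g hf hg
    refine Quot.ind fun m => ?_
    obtain ⟨s, hs0, hsm, hρs⟩ := exists_localSection (hsub.isSubmersionAt m)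
    have h1 : ContMDiffAt (phaseModel E F) 𝓘(ℝ, ℝ) ∞
        (bracket 𝓘(ℝ, EN) (𝓦.quotientSharp EN) f g ∘ S.orbitProj G) (s (S.orbitProj G m)) := by
      rw [bracket_quotientSharp hG hgW hρ (hf.mdifferentiable (by simp))
        (hg.mdifferentiable (by simp))]
      exact contMDiffAt_bracket hG hgW (hf.comp hs _) (hg.comp hs _)
    refine (ContMDiffAt.comp (S.orbitProj G m) h1 hsm).congr_of_eventuallyEq ?_
    filter_upwards [hρs] with x hx
    rw [comp_apply, comp_apply, hx]
  refine ⟨⟨?_, hb⟩, ?_⟩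
  · refine Quot.ind fun m => ?_
    intro α β
    have e := quotientSharp_orbitProj (𝓦 := 𝓦) hG hgW hρ m
    refine (congrArg (fun L : (EN →L[ℝ] ℝ) →ₗ[ℝ] EN => (show EN →L[ℝ] ℝ from β) (L α)) e).trans ?_
    refine Eq.trans ?_ (congrArg (fun L : (EN →L[ℝ] ℝ) →ₗ[ℝ] EN =>
      -(show EN →L[ℝ] ℝ from α) (L β)) e).symm
    exact piJK_skew hG hgW ((show EN →L[ℝ] ℝ from α) ∘L tangentOrbitProj (G := G) EN m)
      ((show EN →L[ℝ] ℝ from β) ∘L tangentOrbitProj (G := G) EN m)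
  · intro f g h hf hg hh
    have key : ∀ {f g h : S.OrbitSpace G → ℝ}, ContMDiff 𝓘(ℝ, EN) 𝓘(ℝ, ℝ) ∞ f →
        ContMDiff 𝓘(ℝ, EN) 𝓘(ℝ, ℝ) ∞ g → ContMDiff 𝓘(ℝ, EN) 𝓘(ℝ, ℝ) ∞ h → ∀ m : S.Phase,
        bracket 𝓘(ℝ, EN) (𝓦.quotientSharp EN) f (bracket 𝓘(ℝ, EN) (𝓦.quotientSharp EN) g h)
          (S.orbitProj G m) = bracket (phaseModel E F) 𝓦.piJK (f ∘ S.orbitProj G)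
            (bracket (phaseModel E F) 𝓦.piJK (g ∘ S.orbitProj G) (h ∘ S.orbitProj G)) m := by
      intro f g h hf hg hh m
      rw [← bracket_quotientSharp hG hgW hρ (hg.mdifferentiable (by simp))
          (hh.mdifferentiable (by simp)),
        ← bracket_quotientSharp hG hgW hρ (hf.mdifferentiable (by simp))
          ((hb g h hg hh).mdifferentiable (by simp))]
      rfl
    refine Quot.ind fun m => ?_
    have h1 := jacobiator_eq_zero (𝓦 := 𝓦) hG hgW (m := m)
      (fun a m => congrArg f (orbitProj_act (G := G) a m))
      (fun a m => congrArg g (orbitProj_act (G := G) a m))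
      (fun a m => congrArg h (orbitProj_act (G := G) a m)) (hf.comp hs m) (hg.comp hs m)
      (hh.comp hs m)
    refine Eq.trans ?_ h1
    exact congrArg₂ (· + ·) (congrArg₂ (· + ·) (key hf hg hh m) (key hg hh hf m)) (key hh hf hg m)

lemma existsUnique_quotientSharp (hG : S.IsSymmetryGroup EG G)
    (hgW : 𝓦.GeneratedBy gW)
    (hsub : IsSubmersion (phaseModel E F) 𝓘(ℝ, EN) ∞ (S.orbitProj G)) :
    ∃! Λ : BivectorData 𝓘(ℝ, EN) (P := S.OrbitSpace G),
      (∀ (m : S.Phase) (α : TangentSpace 𝓘(ℝ, EN) (S.orbitProj G m) →L[ℝ] ℝ),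
        Λ (S.orbitProj G m) α =
          mfderiv (phaseModel E F) 𝓘(ℝ, EN) (S.orbitProj G) m
            (𝓦.piJK m (α ∘L mfderiv (phaseModel E F) 𝓘(ℝ, EN) (S.orbitProj G) m))) ∧
      IsPoisson 𝓘(ℝ, EN) Λ := by
  have hρ : MDifferentiable (phaseModel E F) 𝓘(ℝ, EN) (S.orbitProj G) :=
    hsub.contMDiff.mdifferentiable (by simp)
  refine ⟨𝓦.quotientSharp EN, ⟨fun m α => ?_, isPoisson_quotientSharp hG hgW hsub⟩, ?_⟩
  · exact congrArg (fun L : (EN →L[ℝ] ℝ) →ₗ[ℝ] EN => L α) (quotientSharp_orbitProj hG hgW hρ m)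
  · rintro Λ ⟨hΛ, -⟩
    refine funext (Quot.ind fun m => LinearMap.ext fun α => (hΛ m α).trans ?_)
    exact (congrArg (fun L : (EN →L[ℝ] ℝ) →ₗ[ℝ] EN => L α)
      (quotientSharp_orbitProj hG hgW hρ m)).symm

end Quotient
end VerticalComplement
end NonholonomicSystem

end

end Nonholonomic

/-! ### The main theorem -/

open Bundle Manifold Nonholonomic in
theorem mainTheorem6
    {E : Type*} [NormedAddCommGroup E] [NormedSpace ℝ E] [FiniteDimensional ℝ E]
    {F : Type*} [NormedAddCommGroup F] [NormedSpace ℝ F] [FiniteDimensional ℝ F]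
    {EG : Type*} [NormedAddCommGroup EG] [NormedSpace ℝ EG] [FiniteDimensional ℝ EG]
    -- the configuration manifold
    {Q : Type*} [TopologicalSpace Q] [T2Space Q] [SecondCountableTopology Q] [ChartedSpace E Q]
    [IsManifold 𝓘(ℝ, E) ∞ Q]
    -- the constraint distribution, as a vector bundle
    {V : Q → Type*} [TopologicalSpace (TotalSpace F V)] [∀ q, TopologicalSpace (V q)]
    [∀ q, AddCommGroup (V q)] [∀ q, Module ℝ (V q)] [FiberBundle F V] [VectorBundle ℝ F V]
    [ContMDiffVectorBundle ∞ F V 𝓘(ℝ, E)]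
    -- the symmetry group
    {G : Type*} [TopologicalSpace G] [T2Space G] [SecondCountableTopology G] [ChartedSpace EG G]
    [Group G] [LieGroup 𝓘(ℝ, EG) ∞ G] [MulAction G Q]
    (S : NonholonomicSystem E F Q V) (hG : S.IsSymmetryGroup EG G)
    (𝓦 : S.VerticalComplement EG G) (hW : 𝓦.VerticalSymmetry) :
    -- `Ω_M` is nondegenerate on `C`, so `π_nh` is defined
    (∀ m : S.Phase, ∀ X ∈ S.C m, (∀ Y ∈ S.C m, S.omega m X Y = 0) → X = 0) ∧
    -- `⟨J, K_W⟩` is semi-basic and `G`-invariant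
    (∀ (m : S.Phase) (X : TangentSpace (phaseModel E F) m),
      S.tangentProj m X = 0 → 𝓦.formJK m X = 0) ∧
    (∀ (g : G) (m : S.Phase) (X Y : TangentSpace (phaseModel E F) m),
      𝓦.formJK (S.act g m) (S.tangentAct g m X) (S.tangentAct g m Y) = 𝓦.formJK m X Y) ∧
    -- the gauge transformation of `π_nh` by `-⟨J, K_W⟩` is well defined
    (∀ m : S.Phase, IsUnit (gaugeEndo S.piNh (fun x => -𝓦.formJK x) m)) ∧
    -- `π_JK` is a `G`-invariant bivector field
    IsBivectorField (phaseModel E F) 𝓦.piJK ∧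
    (∀ (g : G) (m : S.Phase) (α : TangentSpace (phaseModel E F) (S.act g m) →L[ℝ] ℝ),
      𝓦.piJK (S.act g m) α = S.tangentAct g m (𝓦.piJK m (α ∘L S.tangentAct g m))) ∧
    -- `½ [π_JK, π_JK] = -ψ_{π_JK}`, on covectors, and in terms of the bracket of functions
    (∀ (m : S.Phase) (α β γ : TangentSpace (phaseModel E F) m →L[ℝ] ℝ),
      (1 / 2) * schouten (phaseModel E F) 𝓦.piJK m α β γ = -𝓦.psi 𝓦.piJK m α β γ) ∧
    (∀ f g h : S.Phase → ℝ, ContMDiff (phaseModel E F) 𝓘(ℝ, ℝ) ∞ f →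
      ContMDiff (phaseModel E F) 𝓘(ℝ, ℝ) ∞ g → ContMDiff (phaseModel E F) 𝓘(ℝ, ℝ) ∞ h →
      ∀ m : S.Phase, jacobiator (phaseModel E F) 𝓦.piJK f g h m =
        -𝓦.psi 𝓦.piJK m (differential (phaseModel E F) f m) (differential (phaseModel E F) g m)
          (differential (phaseModel E F) h m)) ∧
    -- the reduced bracket is a Poisson bracket on `C^∞ (M / G)`
    (∃! Λ : S.smoothOrbitFunctions G →ₗ[ℝ] S.smoothOrbitFunctions G →ₗ[ℝ]
        S.smoothOrbitFunctions G,
      (∀ (f g : S.smoothOrbitFunctions G) (m : S.Phase),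
        (Λ f g : S.OrbitSpace G → ℝ) (S.orbitProj G m) =
          bracket (phaseModel E F) 𝓦.piJK (fun x => (f : S.OrbitSpace G → ℝ) (S.orbitProj G x))
            (fun x => (g : S.OrbitSpace G → ℝ) (S.orbitProj G x)) m) ∧
      IsPoissonBracket Λ) ∧
    -- for the manifold structure of `M / G`, the reduced bivector field is a Poisson structure
    (∀ {EN : Type*} [NormedAddCommGroup EN] [NormedSpace ℝ EN] [FiniteDimensional ℝ EN]
      [ChartedSpace EN (S.OrbitSpace G)] [IsManifold 𝓘(ℝ, EN) ∞ (S.OrbitSpace G)],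
      IsSubmersion (phaseModel E F) 𝓘(ℝ, EN) ∞ (S.orbitProj G) →
      ∃! Λ : BivectorData 𝓘(ℝ, EN) (P := S.OrbitSpace G),
        (∀ (m : S.Phase) (α : TangentSpace 𝓘(ℝ, EN) (S.orbitProj G m) →L[ℝ] ℝ),
          Λ (S.orbitProj G m) α =
            mfderiv (phaseModel E F) 𝓘(ℝ, EN) (S.orbitProj G) m
              (𝓦.piJK m (α ∘L mfderiv (phaseModel E F) 𝓘(ℝ, EN) (S.orbitProj G) m))) ∧
        IsPoisson 𝓘(ℝ, EN) Λ) := by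
  obtain ⟨gW, -, hgW⟩ := hW
  refine ⟨fun _ _ hX h => NonholonomicSystem.omega_nondegenerate hX h,
    fun _ _ hX => NonholonomicSystem.VerticalComplement.formJK_eq_zero hG hgW hX,
    fun g m X Y => NonholonomicSystem.VerticalComplement.formJK_act hG hgW g X Y,
    fun m => NonholonomicSystem.VerticalComplement.isUnit_gaugeEndo hG hgW m,
    NonholonomicSystem.VerticalComplement.isBivectorField_piJK hG hgW,
    fun g m α => NonholonomicSystem.VerticalComplement.piJK_act hG hgW g m α,
    fun _ α β γ => NonholonomicSystem.VerticalComplement.schouten_piJK hG hgW α β γ,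
    fun _ _ _ hf hg hh m =>
      NonholonomicSystem.VerticalComplement.jacobiator_piJK hG hgW (hf m) (hg m) (hh m),
    NonholonomicSystem.VerticalComplement.existsUnique_orbitBracket hG hgW, ?_⟩
  intro EN _ _ _ _ _ hsub
  exact NonholonomicSystem.VerticalComplement.existsUnique_quotientSharp hG hgW hsub
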